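/- **Setting.** Fix $0<c_1<c_2$, $0<\varepsilon_g<1/2$ and $C>0$. For $N>0$, $n\in\mathbb N$ with $I_W:=[c_1N,c_2N]\subset[0,\sqrt n-N]$, and for $i\ge 0$, put $$b_i(x)=\sqrt N\,e^{-x^2/2}\frac{x^i}{\sqrt{i!}},\qquad \mathbf u_i(x)=(b_i(x),b_i'(x)),\qquad \mathbf v_i(x,y)=(b_i(x),b_i'(x),b_i(y),b_i'(y)).$$ Let $\iota\in\{0,1\}$ be the first index of all sums below. For coefficients $\boldsymbol a=(a_i)$ let $$P_n(x,\boldsymbol a)=e^{-x^2/2}\sum_{i=\iota}^n a_i\frac{x^i}{\sqrt{i!}},\qquad S_n(x,\boldsymbol a)=\sum_{i=\iota}^n a_i\mathbf u_i(x),\qquad S_n(x,y,\boldsymbol a)=\sum_{i=\iota}^n a_i\mathbf v_i(x,y),$$ so that $S_n(x,\boldsymbol a)/\sqrt N=(P_n,P_n')(x,\boldsymbol a)$. For $\delta>0$ let $F_\delta(t)=\frac1{2\delta}1_{|t|<\delta}$, $\Phi_\delta(t_1,t_2)=|t_2|F_\delta(t_1)$ and $\Psi_\delta(t_1,t_2,t_3,t_4)=\Phi_\delta(t_1,t_2)\Phi_\delta(t_3,t_4)$.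 Let $\boldsymbol\xi=(\xi_i)$ be i.i.d. copies of a subgaussian real random variable $\xi$ with mean zero and variance one, and let $\boldsymbol G=(G_i)$ be i.i.d. standard Gaussian. For $\mathbf w_k=\mathbf u_k(x)$ ($d=2$) or $\mathbf w_k=\mathbf v_k(x,y)$ ($d=4$) put $X_k=\xi_k\mathbf w_k$. For a multi-index $\alpha\in\{1,\dots,d\}^\ell$ let $n_j(\alpha)=|\{i:\alpha_i=j\}|$, $z^\alpha=\prod_j z_j^{n_j(\alpha)}$ and $H_\alpha(t)=\prod_jH_{n_j(\alpha)}(t_j)$, where $H_0=1$, $H_{k+1}(s)=sH_k(s)-H_k'(s)$. With $g$ standard Gaussian let $$c_n(\alpha,X)=\frac1N\sum_{k=\iota}^n\big(\mathbb E X_k^\alpha-\mathbb E (g\mathbf w_k)^\alpha\big),$$ $$\Gamma_{n,2}(X,t)=\frac1{24}\sum_{\beta\in[d]^4}c_n(\beta,X)H_\beta(t)+\frac1{72}\sum_{\rho\in[d]^3}\sum_{\beta\in[d]^3}c_n(\beta,X)c_n(\rho,X)H_{(\beta,\rho)}(t),$$ where $(\beta,\rho)\in[d]^6$ is the concatenation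 of $\beta$ and $\rho$. Write $X_n(x)$, $X_n(x,y)$ for the two families $(X_k)$, let $V_n(x)$, $V_n(x,y)$ be the matrices $\frac1N\sum_{k=\iota}^n\mathbb E[X_kX_k^{T}]$, let $\|\cdot\|_2$ be the spectral norm, and let $W_d$ be a standard Gaussian vector in $\mathbb R^d$. **Statement.** There is $M_0$, depending only on $c_1,c_2,\varepsilon_g,C$, such that for every $K$ there are $A,N_0>0$, depending only on $c_1,c_2,\varepsilon_g,C,K$, with the following property. Suppose $\mathbb E|\xi|^{M_0}\le K$, $N\ge N_0$, $[c_1N,c_2N]\subset[0,\sqrt n-N]$ and $\delta\ge N^{-C}$. Then for every $x\in I_W$ $$\big|\mathbb EF_\delta(P_n(x,\boldsymbol\xi))-\mathbb EF_\delta(P_n(x,\boldsymbol G))\big|\le A N^{-1/2},$$ $$\Big|\mathbb E\Phi_\delta\Big(\tfrac{S_n(x,\boldsymbol\xi)}{\sqrt N}\Big)-\mathbb E\Phi_\delta\Big(\tfrac{S_n(x,\boldsymbol G)}{\sqrt N}\Big)-\frac1N\mathbb E\big[\Phi_\delta(W_2)\Gamma_{n,2}(X_n(x),W_2)\big]\Big|\le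 A\Big(N^{-3/2}+\frac1N\|V_n(x)-I_2\|_2\Big),$$ and for all $x,y\in I_W$ with $|x-y|\ge N^{\varepsilon_g}$ $$\Big|\mathbb E\Psi_\delta\Big(\tfrac{S_n(x,y,\boldsymbol\xi)}{\sqrt N}\Big)-\mathbb E\Psi_\delta\Big(\tfrac{S_n(x,y,\boldsymbol G)}{\sqrt N}\Big)-\frac1N\mathbb E\big[\Psi_\delta(W_4)\Gamma_{n,2}(X_n(x,y),W_4)\big]\Big|\le A\Big(N^{-3/2}+\frac1N\|V_n(x,y)-I_4\|_2\Big).$$ -/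

import Mathlib

open MeasureTheory ProbabilityTheory
open scoped BigOperators

noncomputable section

namespace WeylEW

/-- The coefficient `b_i(x) = √N e^{-x²/2} x^i / √(i!)`. -/
def b (N : ℝ) (i : ℕ) (x : ℝ) : ℝ :=
  Real.sqrt N * Real.exp (-x ^ 2 / 2) * x ^ i / Real.sqrt (Nat.factorial i : ℝ)

/-- The planar vector `u_i(x) = (b_i(x), b_i'(x))`. -/
def u (N : ℝ) (i : ℕ) (x : ℝ) : Fin 2 → ℝ :=
  ![b N i x, deriv (b N i) x]

/-- The vector `v_i(x, y) = (b_i(x), b_i'(x), b_i(y), b_i'(y))`. -/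
def v (N : ℝ) (i : ℕ) (x y : ℝ) : Fin 4 → ℝ :=
  ![b N i x, deriv (b N i) x, b N i y, deriv (b N i) y]

/-- The normalized Weyl polynomial `e^{-x²/2} ∑_{i ∈ s} a_i x^i / √(i!)` with coefficients `a`. -/
def weylPoly (s : Finset ℕ) (a : ℕ → ℝ) (x : ℝ) : ℝ :=
  Real.exp (-x ^ 2 / 2) * ∑ i ∈ s, a i * (x ^ i / Real.sqrt (Nat.factorial i : ℝ))

/-- The random walk `∑_{i ∈ s} a_i w_i` with steps `a_i w_i`. -/
def walk {d : ℕ} (s : Finset ℕ) (w : ℕ → Fin d → ℝ) (a : ℕ → ℝ) : Fin d → ℝ :=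
  ∑ i ∈ s, a i • w i

/-- `F_δ(t) = (2δ)⁻¹ 1_{|t| < δ}`. -/
def F (δ t : ℝ) : ℝ := if |t| < δ then 1 / (2 * δ) else 0

/-- `Φ_δ(t₁, t₂) = |t₂| F_δ(t₁)`. -/
def Phi (δ : ℝ) (t : Fin 2 → ℝ) : ℝ := |t 1| * F δ (t 0)

/-- `Ψ_δ(t₁, t₂, t₃, t₄) = Φ_δ(t₁, t₂) Φ_δ(t₃, t₄)`. -/
def Psi (δ : ℝ) (t : Fin 4 → ℝ) : ℝ := Phi δ ![t 0, t 1] * Phi δ ![t 2, t 3]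

/-- The law of a standard Gaussian vector in `ℝ^d`. -/
def stdGauss (d : ℕ) : Measure (Fin d → ℝ) := Measure.pi fun _ => gaussianReal 0 1

/-- The number `n_j(α)` of occurrences of the coordinate `j` in the multi-index `α`. -/
def occ {d l : ℕ} (α : Fin l → Fin d) (j : Fin d) : ℕ :=
  (Finset.univ.filter fun i => α i = j).card

/-- The monomial `z^α = ∏_j z_j^{n_j(α)}`. -/
def mono {d l : ℕ} (α : Fin l → Fin d) (z : Fin d → ℝ) : ℝ := ∏ j, z j ^ occ α j

/-- The Hermite polynomial `H_α(t) = ∏_j H_{n_j(α)}(t_j)`, with the one-dimensional polynomials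
normalized by `H_0 = 1` and `H_{k+1}(x) = x H_k(x) - H_k'(x)`. -/
def hermiteMulti {d l : ℕ} (α : Fin l → Fin d) (t : Fin d → ℝ) : ℝ :=
  ∏ j, Polynomial.aeval (t j) (Polynomial.hermite (occ α j))

/-- The average covariance matrix `V = N⁻¹ ∑_{k ∈ s} E[X_k X_kᵀ]` of random vectors `X_k`. -/
def avgCov {d : ℕ} {Ω : Type*} [MeasurableSpace Ω] (μ : Measure Ω) (N : ℝ) (s : Finset ℕ)
    (X : ℕ → Ω → Fin d → ℝ) : Matrix (Fin d) (Fin d) ℝ :=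
  Matrix.of fun i j => (1 / N) * ∑ k ∈ s, ∫ ω, X k ω i * X k ω j ∂μ

/-- `c(α, X) = N⁻¹ ∑_{k ∈ s} (E[X_k^α] - E[G_k^α])` for random vectors `X_k` with Gaussian
counterparts `G_k`. -/
def cAvg {d l : ℕ} {Ω Ω' : Type*} [MeasurableSpace Ω] [MeasurableSpace Ω']
    (μ : Measure Ω) (ν : Measure Ω') (N : ℝ) (s : Finset ℕ)
    (X : ℕ → Ω → Fin d → ℝ) (G : ℕ → Ω' → Fin d → ℝ) (α : Fin l → Fin d) : ℝ :=
  (1 / N) * ∑ k ∈ s, ((∫ ω, mono α (X k ω) ∂μ) - ∫ ω, mono α (G k ω) ∂ν)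

/-- The second Edgeworth polynomial
`Γ₂(X, t) = (1/24) ∑_{β ∈ [d]⁴} c(β, X) H_β(t)
  + (1/72) ∑_{ρ, β ∈ [d]³} c(β, X) c(ρ, X) H_{(β, ρ)}(t)`,
where `(β, ρ) ∈ [d]⁶` is the concatenation of `β` and `ρ`. -/
def Gamma2 {d : ℕ} {Ω Ω' : Type*} [MeasurableSpace Ω] [MeasurableSpace Ω']
    (μ : Measure Ω) (ν : Measure Ω') (N : ℝ) (s : Finset ℕ)
    (X : ℕ → Ω → Fin d → ℝ) (G : ℕ → Ω' → Fin d → ℝ) (t : Fin d → ℝ) : ℝ :=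
  (1 / 24) * ∑ β : Fin 4 → Fin d, cAvg μ ν N s X G β * hermiteMulti β t
    + (1 / 72) * ∑ ρ : Fin 3 → Fin d, ∑ β : Fin 3 → Fin d,
        cAvg μ ν N s X G β * cAvg μ ν N s X G ρ * hermiteMulti (Fin.append β ρ) t

/-- `Γ₂` for the steps `X_k = ξ_k w_k` of a random walk. As `ξ_k` has mean zero and variance one,
the Gaussian vector corresponding to `X_k` is `g w_k` with `g` a standard Gaussian. -/
def walkGamma2 {d : ℕ} {Ω : Type*} [MeasurableSpace Ω] (μ : Measure Ω) (N : ℝ) (s : Finset ℕ)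
    (ξ : ℕ → Ω → ℝ) (w : ℕ → Fin d → ℝ) (t : Fin d → ℝ) : ℝ :=
  Gamma2 μ (gaussianReal 0 1) N s (fun k ω => ξ k ω • w k) (fun k g => g • w k) t

/-- The covariance matrix `N⁻¹ ∑_{k ∈ s} E[X_k X_kᵀ]` of the rescaled walk, `X_k = ξ_k w_k`. -/
def walkCov {d : ℕ} {Ω : Type*} [MeasurableSpace Ω] (μ : Measure Ω) (N : ℝ) (s : Finset ℕ)
    (ξ : ℕ → Ω → ℝ) (w : ℕ → Fin d → ℝ) : Matrix (Fin d) (Fin d) ℝ :=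
  avgCov μ N s (fun k ω => ξ k ω • w k)

/-- The spectral norm `‖A‖₂` of a square matrix. -/
def specNorm {d : ℕ} (A : Matrix (Fin d) (Fin d) ℝ) : ℝ :=
  ‖Matrix.toEuclideanCLM (n := Fin d) (𝕜 := ℝ) A‖

end WeylEW

end

/-!
# Second order expansions for the Weyl polynomial with general coefficients

After division by `√N` the vectors `u_k(x)` become
`(wcoef x k, wcoef x k * dev x k)`, where `wcoef x k ^ 2` is the mass at `k` of the Poisson law of
mean `x²` and `dev x k = (k - x²) / x` is the standardized index. So `P_n(x)` and its derivative are
the coordinates of a walk `∑ ξ_k ω_k` whose steps have covariance equal to the identity, up to a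
Poisson tail beyond the range of summation; as the masses are `O(1 / N)`, the fourth and sixth power
sums of the steps are `O(1 / N)` and `O(1 / N²)`. Steps belonging to two points at distance at least
`N ^ ε` live on disjoint windows of indices, so the walk in dimension four has the same properties
(`isFrame_uvec`, `isFrame_vvec`). Since the covariance differs from the identity by `O(1 / N²)`, the
term with the spectral norm is not needed.

The characteristic function of the walk at the frequency `t` is the product of those of the
`ξ_k`, evaluated at `t ⬝ᵥ ω_k`. It is compared with the Fourier transform of the Edgeworth density,
which is `1 + Γ₂ / N` with respect to the Gaussian measure (`integral_edgeWeight_mul_cexp`,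
`one_add_walkGamma2_eq`). The test functions are even in each variable, so only real parts matter,
and the terms of orders `N ^ (-1/2)` and `N ^ (-3/2)`, which come from odd cumulants, are imaginary.

* For `|t|` up to a small power of `N`, the cumulant expansion gives an error of order `N ^ (-2)`, up
  to a power of `|t|` (`abs_re_prod_chf_sub_edgeFT_le`).
* For larger `|t| ≤ N ^ D`, with arbitrary `D`, the characteristic function is smaller than any power
  of `N`, provided that the values `t ⬝ᵥ ω_k` below a fixed `η` have a large sum of squares, for each
  of them contributes a factor `exp (-(t ⬝ᵥ ω_k)² / 4)` (`norm_prod_chf_le`). If no value exceeds `η`,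
  that sum is about `|t|²`. Otherwise consider the last index whose value does: the weights vary
  slowly and the second factor of a step value is linear in the index, so that among the next few
  multiples of `√N` indices there are `√N` with values comparable to `η`, and none of these exceeds
  `η` (`exists_finset_moderate`, `isSpread_uvec`, `isSpread_vvec`). This replaces any arithmetic or
  smoothness hypothesis on the law of `ξ`.
* Beyond `N ^ D` both transforms are merely bounded, and the decay of the test functions on the
  Fourier side takes over.

The factors `F_δ`, `|·|` and `1` of the test functions lie, up to tails, between functions with
integrable Fourier transforms: trapezoids and tents, that is, combinations of the triangle functions
`(a - |y|)₊` (`IsSandwiched`). Their transforms are bounded by a multiple of `N ^ (1/32)`, whatever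
`δ` is, so Fourier inversion costs a factor `N ^ (1/8)` in dimension at most four
(`abs_integral_sub_integral_le`). The bounds differ only on a set that is small for the Gaussian
measure, and on the tails, which even moments of the walk control
(`one_add_integral_sum_pow_le`). The slopes of the trapezoids have to be
narrower than `δ ≥ N ^ (-C)`, and so the cutoff `D = freqExp C` and the order `momDeg C` of the
moments depend on `C` alone.

The expansion is applied to `ξ` and to Gaussian coefficients, for which the correction vanishes, and
the two are subtracted (`exists_abs_integral_walk_sub_gaussian_le`).
-/

open MeasureTheory ProbabilityTheory
open scoped BigOperators

namespace WeylEW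

open Filter

universe w w'

/-! ### Cosine transforms of piecewise linear functions -/

/-- `g` is the cosine transform of the even function `m`, where `|m s| ≤ B` and
`|m s| ≤ E / s²`. -/
structure IsCosTransform (B E : ℝ) (m g : ℝ → ℝ) : Prop where
  measurable : Measurable m
  bound : ∀ s, |m s| ≤ B
  decay : ∀ s, |m s| * s ^ 2 ≤ E
  even : ∀ s, m (-s) = m s
  eq_integral : ∀ y, g y = ∫ s, m s * Real.cos (s * y)

namespace IsCosTransform

variable {B E : ℝ} {m g : ℝ → ℝ}

lemma abs_le_div (h : IsCosTransform B E m g) (s : ℝ) :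
    |m s| ≤ (B + E) * (1 + s ^ 2)⁻¹ := by
  rw [← div_eq_mul_inv, le_div_iff₀ (by positivity)]
  linarith [h.bound s, h.decay s]

lemma integrable (h : IsCosTransform B E m g) : Integrable m :=
  (integrable_inv_one_add_sq.const_mul (B + E)).mono' h.measurable.aestronglyMeasurable
    (Filter.Eventually.of_forall fun s => by simpa using h.abs_le_div s)

/-- The cosine transform as an inverse Fourier transform: the density is even, so the sines cancel. -/
lemma ofReal_eq (h : IsCosTransform B E m g) (y : ℝ) :
    (g y : ℂ) = ∫ s : ℝ, (m s : ℂ) * Complex.exp (((s * y : ℝ) : ℂ) * Complex.I) := by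
  have hc : Integrable fun s => m s * Real.cos (s * y) :=
    h.integrable.mul_bdd (c := 1) (by fun_prop) (by simp [Real.abs_cos_le_one])
  have hs : Integrable fun s => m s * Real.sin (s * y) :=
    h.integrable.mul_bdd (c := 1) (by fun_prop) (by simp [Real.abs_sin_le_one])
  have h0 : ∫ s, m s * Real.sin (s * y) = 0 := by
    have h1 := integral_neg_eq_self (fun s => m s * Real.sin (s * y)) volume
    have h2 : (fun s => m (-s) * Real.sin (-s * y)) = fun s => -(m s * Real.sin (s * y)) := by
      funext s; rw [h.even, neg_mul, Real.sin_neg]; ring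
    rw [h2, integral_neg] at h1
    linarith
  have h3 : ∀ s : ℝ, (m s : ℂ) * Complex.exp (((s * y : ℝ) : ℂ) * Complex.I)
      = ((m s * Real.cos (s * y) : ℝ) : ℂ) + ((m s * Real.sin (s * y) : ℝ) : ℂ) * Complex.I := by
    intro s
    rw [Complex.exp_mul_I, ← Complex.ofReal_cos, ← Complex.ofReal_sin]
    push_cast; ring
  have h4 := integral_add (f := fun s : ℝ => ((m s * Real.cos (s * y) : ℝ) : ℂ))
    (g := fun s : ℝ => ((m s * Real.sin (s * y) : ℝ) : ℂ) * Complex.I) hc.ofReal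
    (hs.ofReal.mul_const Complex.I)
  rw [integral_mul_const, integral_complex_ofReal, integral_complex_ofReal, h0,
    ← h.eq_integral] at h4
  simp_rw [h3]
  rw [h4]
  simp

end IsCosTransform

lemma one_sub_cos_nonneg (x : ℝ) : 0 ≤ 1 - Real.cos x := by linarith [Real.cos_le_one x]

lemma one_sub_cos_le_sq (x : ℝ) : 1 - Real.cos x ≤ x ^ 2 / 2 := by
  linarith [Real.one_sub_sq_div_two_le_cos (x := x)]

lemma integrable_one_sub_cos_div_sq (a : ℝ) :
    Integrable fun s : ℝ => (1 - Real.cos (a * s)) / s ^ 2 := by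
  refine (integrable_inv_one_add_sq.const_mul (a ^ 2 / 2 + 2)).mono'
    (Measurable.aestronglyMeasurable (by fun_prop)) (Filter.Eventually.of_forall fun s => ?_)
  rw [Real.norm_of_nonneg (div_nonneg (one_sub_cos_nonneg _) (sq_nonneg s)), ← div_eq_mul_inv]
  rcases eq_or_ne s 0 with rfl | hs
  · simp; positivity
  · have h2 : 0 < s ^ 2 := by positivity
    rw [div_le_div_iff₀ h2 (by positivity)]
    have h3 := one_sub_cos_le_sq (a * s)
    have h4 : 1 - Real.cos (a * s) ≤ 2 := by linarith [Real.neg_one_le_cos (a * s)]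
    nlinarith [mul_le_mul_of_nonneg_right h4 h2.le]

/-- The constant `∫ (1 - cos s) / s² ds`. Only its positivity matters below. -/
noncomputable def cosMass : ℝ := ∫ s : ℝ, (1 - Real.cos s) / s ^ 2

lemma cosMass_pos : 0 < cosMass := by
  have hi : Integrable fun s : ℝ => (1 - Real.cos s) / s ^ 2 := by
    simpa using integrable_one_sub_cos_div_sq 1
  unfold cosMass
  rw [integral_pos_iff_support_of_nonneg (fun s => div_nonneg (one_sub_cos_nonneg _)
    (sq_nonneg s)) hi]
  refine lt_of_lt_of_le ?_ (measure_mono (s := Set.Ioo 0 1) ?_)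
  · simp
  · intro s hs
    rw [Function.mem_support]
    have h1 : Real.cos s < 1 := by
      rw [← Real.cos_zero]
      exact Real.cos_lt_cos_of_nonneg_of_le_pi le_rfl
        (by linarith [hs.2, Real.pi_gt_three]) hs.1
    have := hs.1
    have h2 : 0 < 1 - Real.cos s := by linarith
    positivity

lemma integral_one_sub_cos_div_sq (a : ℝ) :
    ∫ s : ℝ, (1 - Real.cos (a * s)) / s ^ 2 = cosMass * |a| := by
  rcases eq_or_ne a 0 with rfl | ha
  · simp
  have h := Measure.integral_comp_mul_left (fun s : ℝ => (1 - Real.cos s) / s ^ 2) a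
  have h2 : ∀ s : ℝ, (1 - Real.cos (a * s)) / s ^ 2
      = a ^ 2 * ((1 - Real.cos (a * s)) / (a * s) ^ 2) := by
    intro s
    rcases eq_or_ne s 0 with rfl | hs
    · simp
    · field_simp
  simp_rw [h2]
  rw [integral_const_mul, h, smul_eq_mul, ← cosMass, abs_inv, ← sq_abs]
  have := abs_pos.2 ha
  field_simp

/-- The triangle function `(a - |y|)₊` is, up to the constant `cosMass`, the cosine transform of
`(1 - cos (a s)) / s²`. -/
lemma integral_triangle {a : ℝ} (ha : 0 ≤ a) (y : ℝ) :
    ∫ s : ℝ, (1 - Real.cos (a * s)) / s ^ 2 * Real.cos (s * y) = cosMass * max (a - |y|) 0 := by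
  have h1 : ∀ s : ℝ, (1 - Real.cos (a * s)) / s ^ 2 * Real.cos (s * y)
      = (1 / 2) * ((1 - Real.cos ((a + y) * s)) / s ^ 2)
        + (1 / 2) * ((1 - Real.cos ((a - y) * s)) / s ^ 2) - (1 - Real.cos (y * s)) / s ^ 2 := by
    intro s
    have e1 : (a + y) * s = a * s + y * s := by ring
    have e2 : (a - y) * s = a * s - y * s := by ring
    rw [e1, e2, Real.cos_add, Real.cos_sub, mul_comm s y]
    ring
  simp_rw [h1]
  have hi := fun c : ℝ => integrable_one_sub_cos_div_sq c
  rw [integral_sub (f := fun s => (1 / 2) * ((1 - Real.cos ((a + y) * s)) / s ^ 2)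
        + (1 / 2) * ((1 - Real.cos ((a - y) * s)) / s ^ 2))
      (((hi _).const_mul _).add ((hi _).const_mul _)) (hi _),
    integral_add ((hi _).const_mul _) ((hi _).const_mul _), integral_const_mul, integral_const_mul,
    integral_one_sub_cos_div_sq, integral_one_sub_cos_div_sq, integral_one_sub_cos_div_sq]
  have h2 : (1 / 2) * |a + y| + (1 / 2) * |a - y| - |y| = max (a - |y|) 0 := by
    rcases le_total 0 y with hy | hy <;> rcases le_total (a + y) 0 with h3 | h3 <;>
    rcases le_total (a - y) 0 with h4 | h4 <;>
    simp only [abs_of_nonneg, abs_of_nonpos, hy, h3, h4] <;>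
    first
    | rw [max_eq_left (by linarith)]; linarith
    | rw [max_eq_right (by linarith)]; linarith
  rw [← h2]; ring

/-- The trapezoid that equals `1` on `|y| ≤ a` and vanishes for `|y| ≥ b`. -/
noncomputable def trapezoid (a b y : ℝ) : ℝ := (max (b - |y|) 0 - max (a - |y|) 0) / (b - a)

/-- The tent that equals `|y|` for `|y| ≤ L`, `2L - |y|` for `L ≤ |y| ≤ 2L`, and then `0`. -/
noncomputable def tent (L y : ℝ) : ℝ := max (2 * L - |y|) 0 - 2 * max (L - |y|) 0

lemma isCosTransform_trapezoid {a b : ℝ} (ha : 0 ≤ a) (hab : a < b) :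
    ∃ m, IsCosTransform ((a + b) / (2 * cosMass)) (2 / (cosMass * (b - a))) m (trapezoid a b) := by
  have hκ := cosMass_pos
  have hd : 0 < b - a := by linarith
  have hb : 0 < b := by linarith
  refine ⟨fun s => (Real.cos (a * s) - Real.cos (b * s)) / (cosMass * (b - a) * s ^ 2),
    by fun_prop, fun s => ?_, fun s => ?_, fun s => by simp, fun y => ?_⟩
  · rcases eq_or_ne s 0 with rfl | hs
    · simpa using (by positivity : 0 ≤ (a + b) / (2 * cosMass))
    have h2 : 0 < s ^ 2 := by positivity
    rw [abs_div, abs_of_pos (by positivity : 0 < cosMass * (b - a) * s ^ 2), div_le_div_iff₀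
      (by positivity) (by positivity), Real.cos_sub_cos]
    have h3 : |Real.sin ((a * s + b * s) / 2)| ≤ |(a * s + b * s) / 2| := Real.abs_sin_le_abs
    have h4 : |Real.sin ((a * s - b * s) / 2)| ≤ |(a * s - b * s) / 2| := Real.abs_sin_le_abs
    have h5 : |-2 * Real.sin ((a * s + b * s) / 2) * Real.sin ((a * s - b * s) / 2)|
        ≤ (a + b) * (b - a) * s ^ 2 / 2 := by
      rw [abs_mul, abs_mul]
      calc _ ≤ |(-2 : ℝ)| * |(a * s + b * s) / 2| * |(a * s - b * s) / 2| := by gcongr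
        _ = |(a + b) * (b - a) * s ^ 2 / 2| := by
            rw [← abs_mul, ← abs_mul]; congr 1; ring
        _ = _ := abs_of_nonneg (by positivity)
    calc _ ≤ (a + b) * (b - a) * s ^ 2 / 2 * (2 * cosMass) := by gcongr
      _ = _ := by ring
  · rcases eq_or_ne s 0 with rfl | hs
    · simpa using (by positivity : 0 ≤ 2 / (cosMass * (b - a)))
    have h2 : 0 < s ^ 2 := by positivity
    have h3 : |Real.cos (a * s) - Real.cos (b * s)| ≤ 2 := by
      rw [abs_le]; constructor <;>
      linarith [Real.cos_le_one (a * s), Real.cos_le_one (b * s), Real.neg_one_le_cos (a * s),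
        Real.neg_one_le_cos (b * s)]
    rw [abs_div, abs_of_pos (by positivity : 0 < cosMass * (b - a) * s ^ 2)]
    calc _ = |Real.cos (a * s) - Real.cos (b * s)| / (cosMass * (b - a)) := by
          field_simp
      _ ≤ _ := by gcongr
  · have e : ∀ s : ℝ, (Real.cos (a * s) - Real.cos (b * s)) / (cosMass * (b - a) * s ^ 2)
        * Real.cos (s * y) = (cosMass * (b - a))⁻¹ * ((1 - Real.cos (b * s)) / s ^ 2
          * Real.cos (s * y) - (1 - Real.cos (a * s)) / s ^ 2 * Real.cos (s * y)) := by
      intro s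
      rcases eq_or_ne s 0 with rfl | hs
      · simp
      · field_simp; ring
    have hi : ∀ c : ℝ, Integrable fun s => (1 - Real.cos (c * s)) / s ^ 2 * Real.cos (s * y) :=
      fun c => (integrable_one_sub_cos_div_sq c).mul_bdd (c := 1) (by fun_prop)
        (by simp [Real.abs_cos_le_one])
    simp_rw [e]
    rw [integral_const_mul, integral_sub (hi b) (hi a), integral_triangle (by linarith),
      integral_triangle ha, trapezoid]
    field_simp

lemma isCosTransform_tent {L : ℝ} (hL : 0 ≤ L) :
    ∃ m, IsCosTransform (3 * L ^ 2 / cosMass) (6 / cosMass) m (tent L) := by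
  have hκ := cosMass_pos
  refine ⟨fun s => ((1 - Real.cos (2 * L * s)) - 2 * (1 - Real.cos (L * s))) / (cosMass * s ^ 2),
    by fun_prop, fun s => ?_, fun s => ?_, fun s => by simp, fun y => ?_⟩
  · rcases eq_or_ne s 0 with rfl | hs
    · simp; positivity
    have h2 : 0 < s ^ 2 := by positivity
    rw [abs_div, abs_of_pos (by positivity : 0 < cosMass * s ^ 2), div_le_div_iff₀
      (by positivity) (by positivity)]
    have h5 : |(1 - Real.cos (2 * L * s)) - 2 * (1 - Real.cos (L * s))| ≤ 3 * L ^ 2 * s ^ 2 := by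
      rw [abs_le]
      constructor <;> nlinarith [one_sub_cos_nonneg (2 * L * s), one_sub_cos_nonneg (L * s),
        one_sub_cos_le_sq (2 * L * s), one_sub_cos_le_sq (L * s), sq_nonneg (L * s)]
    calc _ ≤ 3 * L ^ 2 * s ^ 2 * cosMass := by gcongr
      _ = _ := by ring
  · rcases eq_or_ne s 0 with rfl | hs
    · simp; positivity
    have h2 : 0 < s ^ 2 := by positivity
    have h3 : |(1 - Real.cos (2 * L * s)) - 2 * (1 - Real.cos (L * s))| ≤ 6 := by
      rw [abs_le]; constructor <;>
      linarith [Real.cos_le_one (2 * L * s), Real.cos_le_one (L * s),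
        Real.neg_one_le_cos (2 * L * s), Real.neg_one_le_cos (L * s)]
    rw [abs_div, abs_of_pos (by positivity : 0 < cosMass * s ^ 2)]
    calc _ = |(1 - Real.cos (2 * L * s)) - 2 * (1 - Real.cos (L * s))| / cosMass := by
          field_simp
      _ ≤ _ := by gcongr
  · have e : ∀ s : ℝ, ((1 - Real.cos (2 * L * s)) - 2 * (1 - Real.cos (L * s)))
          / (cosMass * s ^ 2) * Real.cos (s * y)
        = cosMass⁻¹ * ((1 - Real.cos (2 * L * s)) / s ^ 2 * Real.cos (s * y)
          - 2 * ((1 - Real.cos (L * s)) / s ^ 2 * Real.cos (s * y))) := by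
      intro s
      rcases eq_or_ne s 0 with rfl | hs
      · simp
      · field_simp
    have hi : ∀ c : ℝ, Integrable fun s => (1 - Real.cos (c * s)) / s ^ 2 * Real.cos (s * y) :=
      fun c => (integrable_one_sub_cos_div_sq c).mul_bdd (c := 1) (by fun_prop)
        (by simp [Real.abs_cos_le_one])
    simp_rw [e]
    rw [integral_const_mul, integral_sub (hi _) ((hi _).const_mul _), integral_const_mul,
      integral_triangle (by linarith), integral_triangle hL, tent]
    field_simp

lemma IsCosTransform.mono {B E B' E' : ℝ} {m g : ℝ → ℝ} (h : IsCosTransform B E m g)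
    (hB : B ≤ B') (hE : E ≤ E') : IsCosTransform B' E' m g :=
  ⟨h.measurable, fun s => (h.bound s).trans hB, fun s => (h.decay s).trans hE, h.even,
    h.eq_integral⟩

lemma IsCosTransform.const_mul {B E : ℝ} {m g : ℝ → ℝ} (h : IsCosTransform B E m g) {c : ℝ}
    (hc : 0 ≤ c) : IsCosTransform (c * B) (c * E) (fun s => c * m s) (fun y => c * g y) := by
  refine ⟨h.measurable.const_mul c, fun s => ?_, fun s => ?_, fun s => by simp [h.even],
    fun y => ?_⟩
  · rw [abs_mul, abs_of_nonneg hc]; exact mul_le_mul_of_nonneg_left (h.bound s) hc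
  · rw [abs_mul, abs_of_nonneg hc, mul_assoc]; exact mul_le_mul_of_nonneg_left (h.decay s) hc
  · simp_rw [mul_assoc, integral_const_mul, h.eq_integral]

/-! ### Hermite polynomials under the standard Gaussian law -/

/-- All moments of `f` under `μ` are finite. -/
def AllMoments {Ω : Type*} [MeasurableSpace Ω] (μ : Measure Ω) (f : Ω → ℝ) : Prop :=
  ∀ p : NNReal, MemLp f p μ

namespace AllMoments

variable {Ω : Type*} [MeasurableSpace Ω] {μ : Measure Ω} {f g : Ω → ℝ}

lemma integrable (hf : AllMoments μ f) : Integrable f μ :=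
  memLp_one_iff_integrable.1 (by simpa using hf 1)

lemma mul (hf : AllMoments μ f) (hg : AllMoments μ g) : AllMoments μ (fun ω => f ω * g ω) := by
  intro p
  have h2 : MemLp g ((p * 2 : NNReal) : ENNReal) μ := hg _
  have h1 : MemLp f ((p * 2 : NNReal) : ENNReal) μ := hf _
  have : ENNReal.HolderTriple ((p * 2 : NNReal) : ENNReal) ((p * 2 : NNReal) : ENNReal)
      (p : ENNReal) := by
    constructor
    rcases eq_or_ne p 0 with rfl | hp
    · simp
    · push_cast
      rw [ENNReal.mul_inv (by simp) (by simp), ← mul_add, ENNReal.inv_two_add_inv_two, mul_one]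
  exact MemLp.mul' (r := (p : ENNReal)) h2 h1

lemma add (hf : AllMoments μ f) (hg : AllMoments μ g) : AllMoments μ (fun ω => f ω + g ω) :=
  fun p => (hf p).add (hg p)

lemma const [IsFiniteMeasure μ] (c : ℝ) : AllMoments μ (fun _ => c) := fun _ => memLp_const c

lemma const_mul (hf : AllMoments μ f) (c : ℝ) : AllMoments μ (fun ω => c * f ω) :=
  fun p => (hf p).const_mul c

lemma abs (hf : AllMoments μ f) : AllMoments μ (fun ω => |f ω|) := fun p => (hf p).abs

lemma sum {ι : Type*} (s : Finset ι) {F : ι → Ω → ℝ} (h : ∀ i ∈ s, AllMoments μ (F i)) :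
    AllMoments μ (fun ω => ∑ i ∈ s, F i ω) := fun p => memLp_finsetSum s fun i hi => h i hi p

lemma prod [IsFiniteMeasure μ] {ι : Type*} (s : Finset ι) {F : ι → Ω → ℝ}
    (h : ∀ i ∈ s, AllMoments μ (F i)) : AllMoments μ (fun ω => ∏ i ∈ s, F i ω) := by
  classical
  induction s using Finset.induction_on with
  | empty => simpa using const 1
  | insert a s ha ih =>
    simp_rw [Finset.prod_insert ha]
    exact (h a (by simp)).mul (ih fun i hi => h i (by simp [hi]))

lemma pow [IsFiniteMeasure μ] (hf : AllMoments μ f) (n : ℕ) :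
    AllMoments μ (fun ω => f ω ^ n) := by
  simpa using prod (Finset.range n) (F := fun _ => f) fun _ _ => hf

lemma mono (hf : AllMoments μ f) (hg : AEStronglyMeasurable g μ) (h : ∀ ω, |g ω| ≤ |f ω|) :
    AllMoments μ g := fun p => (hf p).mono hg (Filter.Eventually.of_forall h)

lemma aeval [IsFiniteMeasure μ] (hf : AllMoments μ f) (P : Polynomial ℤ) :
    AllMoments μ (fun ω => Polynomial.aeval (f ω) P) := by
  simp_rw [Polynomial.aeval_eq_sum_range]
  refine sum _ fun i _ => ?_
  simp_rw [zsmul_eq_mul]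
  exact (hf.pow i).const_mul _

end AllMoments

lemma allMoments_gaussianReal : AllMoments (gaussianReal 0 1) fun x => x :=
  fun p => memLp_id_gaussianReal p

instance isProbabilityMeasure_stdGauss (d : ℕ) : IsProbabilityMeasure (stdGauss d) := by
  unfold stdGauss; infer_instance

lemma measurePreserving_eval_stdGauss {d : ℕ} (j : Fin d) :
    MeasurePreserving (fun t : Fin d → ℝ => t j) (stdGauss d) (gaussianReal 0 1) :=
  measurePreserving_eval (fun _ : Fin d => gaussianReal 0 1) j

lemma AllMoments.comp_eval {d : ℕ} {f : ℝ → ℝ} (hf : AllMoments (gaussianReal 0 1) f)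
    (j : Fin d) : AllMoments (stdGauss d) fun t => f (t j) :=
  fun p => (hf p).comp_measurePreserving (measurePreserving_eval_stdGauss j)

lemma allMoments_hermiteMulti {d l : ℕ} (α : Fin l → Fin d) :
    AllMoments (stdGauss d) (hermiteMulti α) :=
  AllMoments.prod _ fun j _ => (allMoments_gaussianReal.comp_eval j).aeval _

lemma integrable_gaussianReal_iff {f : ℝ → ℂ} :
    Integrable f (gaussianReal 0 1) ↔ Integrable fun x => (gaussianPDFReal 0 1 x : ℂ) * f x := by
  rw [gaussianReal_of_var_ne_zero _ one_ne_zero, integrable_withDensity_iff_integrable_smul'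
    (measurable_gaussianPDF 0 1) (by simp [gaussianPDF])]
  simp [toReal_gaussianPDF]

lemma hasDerivAt_gaussianPDFReal (x : ℝ) :
    HasDerivAt (gaussianPDFReal 0 1) (-x * gaussianPDFReal 0 1 x) x := by
  have e : gaussianPDFReal 0 1 = fun y : ℝ => (Real.sqrt (2 * Real.pi))⁻¹
      * Real.exp (-y ^ 2 / 2) := by
    funext y; simp [gaussianPDFReal]
  have h1 : HasDerivAt (fun y : ℝ => -y ^ 2 / 2) (-x) x :=
    (((hasDerivAt_pow 2 x).neg).div_const 2).congr_deriv (by simp; ring)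
  rw [e]
  exact (h1.exp.const_mul _).congr_deriv (by ring)

/-- Gaussian integration by parts. -/
lemma integral_deriv_gaussianReal {f f' : ℝ → ℂ} (hf : ∀ x : ℝ, HasDerivAt f (f' x) x)
    (h0 : Integrable f (gaussianReal 0 1)) (h1 : Integrable f' (gaussianReal 0 1))
    (h2 : Integrable (fun x : ℝ => (x : ℂ) * f x) (gaussianReal 0 1)) :
    ∫ x, f' x ∂(gaussianReal 0 1) = ∫ x : ℝ, (x : ℂ) * f x ∂(gaussianReal 0 1) := by
  rw [integral_gaussianReal_eq_integral_smul one_ne_zero,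
    integral_gaussianReal_eq_integral_smul one_ne_zero]
  rw [integrable_gaussianReal_iff] at h0 h1 h2
  have hv : ∀ x : ℝ, HasDerivAt (fun y => (gaussianPDFReal 0 1 y : ℂ))
      ((-x * gaussianPDFReal 0 1 x : ℝ) : ℂ) x := fun x =>
    (hasDerivAt_gaussianPDFReal x).ofReal_comp
  have := integral_mul_deriv_eq_deriv_mul_of_integrable (u := f) (u' := f')
    (v := fun y => (gaussianPDFReal 0 1 y : ℂ))
    (v' := fun x => ((-x * gaussianPDFReal 0 1 x : ℝ) : ℂ)) (fun x _ => hf x) (fun x _ => hv x)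
    (by refine h2.neg.congr (Filter.Eventually.of_forall fun x => ?_)
        simp; ring)
    (by refine h1.congr (Filter.Eventually.of_forall fun x => ?_)
        simp [mul_comm])
    (by refine h0.congr (Filter.Eventually.of_forall fun x => ?_)
        simp [mul_comm])
  simp only [Complex.real_smul]
  calc _ = ∫ x, f' x * (gaussianPDFReal 0 1 x : ℂ) := by simp_rw [mul_comm]
    _ = -∫ x, f x * ((-x * gaussianPDFReal 0 1 x : ℝ) : ℂ) := by rw [this, neg_neg]
    _ = _ := by
      rw [← integral_neg]; congr 1; funext x; push_cast; ring

lemma integrable_ofReal_mul_cexp {Ω : Type*} [MeasurableSpace Ω] {μ : Measure Ω} {f : Ω → ℝ}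
    {g : Ω → ℝ} (hf : Integrable f μ) (hg : AEMeasurable g μ) :
    Integrable (fun ω => (f ω : ℂ) * Complex.exp ((g ω : ℂ) * Complex.I)) μ := by
  refine hf.ofReal.mul_bdd (c := 1) ?_
    (Filter.Eventually.of_forall fun ω => (Complex.norm_exp_ofReal_mul_I _).le)
  exact (by fun_prop : AEMeasurable _ μ).aestronglyMeasurable

/-- The Fourier transform of the `n`-th Hermite function. -/
lemma integral_hermite_mul_cexp (n : ℕ) (s : ℝ) :
    ∫ x : ℝ, ((Polynomial.aeval x (Polynomial.hermite n) : ℝ) : ℂ)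
        * Complex.exp (((s * x : ℝ) : ℂ) * Complex.I) ∂(gaussianReal 0 1)
      = (s * Complex.I) ^ n * Real.exp (-s ^ 2 / 2) := by
  induction n with
  | zero =>
    have h := charFun_gaussianReal (μ := 0) (v := 1) s
    rw [charFun_apply_real] at h
    simp only [Polynomial.hermite_zero, map_one, Complex.ofReal_one, one_mul, pow_zero]
    convert h using 2
    · funext x; push_cast; rfl
    · push_cast; congr 1; simp; ring
  | succ n ih =>
    have hP : ∀ P : Polynomial ℤ, Integrable (fun x : ℝ => (Polynomial.aeval x P : ℝ))
        (gaussianReal 0 1) := fun P => (allMoments_gaussianReal.aeval P).integrable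
    have hE : ∀ P : Polynomial ℤ, Integrable (fun x : ℝ => ((Polynomial.aeval x P : ℝ) : ℂ)
        * Complex.exp (((s * x : ℝ) : ℂ) * Complex.I)) (gaussianReal 0 1) := fun P =>
      integrable_ofReal_mul_cexp (hP P) (by fun_prop)
    set H := Polynomial.hermite n with hH
    have hd : ∀ x : ℝ, HasDerivAt (fun y : ℝ => ((Polynomial.aeval y H : ℝ) : ℂ)
        * Complex.exp (((s * y : ℝ) : ℂ) * Complex.I))
        (((Polynomial.aeval x (Polynomial.derivative H) : ℝ) : ℂ)
          * Complex.exp (((s * x : ℝ) : ℂ) * Complex.I)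
        + (s * Complex.I) * (((Polynomial.aeval x H : ℝ) : ℂ)
          * Complex.exp (((s * x : ℝ) : ℂ) * Complex.I))) x := by
      intro x
      have h1 := (H.hasDerivAt_aeval x).ofReal_comp
      have h2 : HasDerivAt (fun y : ℝ => ((s * y : ℝ) : ℂ) * Complex.I) ((s : ℂ) * Complex.I) x := by
        have := (((hasDerivAt_id x).const_mul s).ofReal_comp).mul_const Complex.I
        simpa using this
      exact (h1.mul h2.cexp).congr_deriv (by ring)
    have hx : ∀ x : ℝ, (x : ℂ) * (((Polynomial.aeval x H : ℝ) : ℂ)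
          * Complex.exp (((s * x : ℝ) : ℂ) * Complex.I))
        = ((Polynomial.aeval x (Polynomial.X * H) : ℝ) : ℂ)
          * Complex.exp (((s * x : ℝ) : ℂ) * Complex.I) := by
      intro x; simp; ring
    have key := integral_deriv_gaussianReal hd (hE H) ((hE _).add ((hE H).const_mul _))
      (by simp_rw [hx]; exact hE _)
    simp_rw [hx] at key
    rw [integral_add (hE _) ((hE H).const_mul _), integral_const_mul, ih] at key
    have e : ∀ x : ℝ, ((Polynomial.aeval x (Polynomial.hermite (n + 1)) : ℝ) : ℂ)
          * Complex.exp (((s * x : ℝ) : ℂ) * Complex.I)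
        = ((Polynomial.aeval x (Polynomial.X * H) : ℝ) : ℂ)
          * Complex.exp (((s * x : ℝ) : ℂ) * Complex.I)
        - ((Polynomial.aeval x (Polynomial.derivative H) : ℝ) : ℂ)
          * Complex.exp (((s * x : ℝ) : ℂ) * Complex.I) := by
      intro x; rw [Polynomial.hermite_succ, map_sub]; push_cast; ring
    simp_rw [e]
    rw [integral_sub (hE _) (hE _), ← key]
    ring

lemma integral_hermite_succ (n : ℕ) :
    ∫ x : ℝ, (Polynomial.aeval x (Polynomial.hermite (n + 1)) : ℝ) ∂(gaussianReal 0 1) = 0 := by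
  have h := integral_hermite_mul_cexp (n + 1) 0
  simp only [zero_mul, Complex.ofReal_zero, Complex.exp_zero, mul_one, pow_succ, mul_zero] at h
  rw [integral_complex_ofReal] at h
  exact_mod_cast h

lemma integral_sq_gaussianReal : ∫ x, x ^ 2 ∂(gaussianReal 0 1) = 1 := by
  have h := integral_hermite_succ 1
  have e : ∀ x : ℝ, (Polynomial.aeval x (Polynomial.hermite (1 + 1)) : ℝ) = x ^ 2 - 1 := by
    intro x; simp [Polynomial.hermite_succ]; ring
  simp_rw [e] at h
  rw [integral_sub (allMoments_gaussianReal.pow 2).integrable (integrable_const _)] at h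
  simp at h; linarith

lemma integral_pow_three_gaussianReal : ∫ x, x ^ 3 ∂(gaussianReal 0 1) = 0 := by
  have h := integral_hermite_succ 2
  have e : ∀ x : ℝ, (Polynomial.aeval x (Polynomial.hermite (2 + 1)) : ℝ) = x ^ 3 - 3 * x := by
    intro x; simp [Polynomial.hermite_succ]; ring
  simp_rw [e] at h
  rw [integral_sub (allMoments_gaussianReal.pow 3).integrable
    (allMoments_gaussianReal.integrable.const_mul _), integral_const_mul,
    integral_id_gaussianReal] at h
  linarith

lemma integral_pow_four_gaussianReal : ∫ x, x ^ 4 ∂(gaussianReal 0 1) = 3 := by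
  have h := integral_hermite_succ 3
  have e : ∀ x : ℝ, (Polynomial.aeval x (Polynomial.hermite (3 + 1)) : ℝ)
      = x ^ 4 - (6 * x ^ 2 - 3) := by
    intro x; simp [Polynomial.hermite_succ]; ring
  simp_rw [e] at h
  have h2 := (allMoments_gaussianReal.pow 2).integrable.const_mul 6
  rw [integral_sub (g := fun x => 6 * x ^ 2 - 3) (allMoments_gaussianReal.pow 4).integrable
    (h2.sub (integrable_const _)), integral_sub h2 (integrable_const _), integral_const_mul,
    integral_sq_gaussianReal] at h
  simp at h; linarith

/-- The squared Euclidean norm of a frequency vector. -/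
def nsq {d : ℕ} (t : Fin d → ℝ) : ℝ := ∑ j, t j ^ 2

lemma nsq_nonneg {d : ℕ} (t : Fin d → ℝ) : 0 ≤ nsq t := Finset.sum_nonneg fun _ _ => sq_nonneg _

lemma sum_occ {d l : ℕ} (α : Fin l → Fin d) : ∑ j, occ α j = l := by
  have := Finset.card_eq_sum_card_fiberwise (s := (Finset.univ : Finset (Fin l)))
    (t := Finset.univ) (f := α) (by simp)
  simpa [occ] using this.symm

lemma mono_eq_prod {d l : ℕ} (α : Fin l → Fin d) (z : Fin d → ℝ) :
    mono α z = ∏ i, z (α i) := by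
  have := Finset.prod_comp z α (s := Finset.univ)
  rw [this]
  unfold mono occ
  symm
  refine Finset.prod_subset (Finset.subset_univ _) fun j _ hj => ?_
  have : (Finset.univ.filter fun i => α i = j) = ∅ := by
    ext i; simp at hj ⊢; exact hj i
  simp [this]

lemma mono_append {d k l : ℕ} (α : Fin k → Fin d) (β : Fin l → Fin d) (z : Fin d → ℝ) :
    mono (Fin.append α β) z = mono α z * mono β z := by
  simp_rw [mono_eq_prod, Fin.prod_univ_add, Fin.append_left, Fin.append_right]

lemma sum_mono_mul_mono {d : ℕ} (l : ℕ) (z t : Fin d → ℝ) :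
    ∑ β : Fin l → Fin d, mono β z * mono β t = (t ⬝ᵥ z) ^ l := by
  rw [dotProduct, Fintype.sum_pow]
  refine Finset.sum_congr rfl fun β _ => ?_
  rw [mono_eq_prod, mono_eq_prod, ← Finset.prod_mul_distrib]
  exact Finset.prod_congr rfl fun _ _ => mul_comm _ _

lemma cexp_dotProduct {d : ℕ} (t y : Fin d → ℝ) :
    Complex.exp (((t ⬝ᵥ y : ℝ) : ℂ) * Complex.I)
      = ∏ j, Complex.exp (((t j * y j : ℝ) : ℂ) * Complex.I) := by
  rw [← Complex.exp_sum, ← Finset.sum_mul, dotProduct]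
  push_cast; rfl

lemma integral_hermiteMulti_mul_cexp {d l : ℕ} (α : Fin l → Fin d) (t : Fin d → ℝ) :
    ∫ y, (hermiteMulti α y : ℂ) * Complex.exp (((t ⬝ᵥ y : ℝ) : ℂ) * Complex.I) ∂(stdGauss d)
      = Complex.I ^ l * (mono α t : ℂ) * Real.exp (-nsq t / 2) := by
  have h := integral_fintype_prod_eq_prod (𝕜 := ℂ) (E := fun _ : Fin d => ℝ)
    (f := fun j (x : ℝ) => ((Polynomial.aeval x (Polynomial.hermite (occ α j)) : ℝ) : ℂ)
        * Complex.exp (((t j * x : ℝ) : ℂ) * Complex.I)) (μ := fun _ => gaussianReal 0 1)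
  simp_rw [integral_hermite_mul_cexp] at h
  simp_rw [cexp_dotProduct, hermiteMulti, Complex.ofReal_prod, ← Finset.prod_mul_distrib]
  rw [stdGauss, h, Finset.prod_mul_distrib, mono, ← Complex.ofReal_prod, ← Real.exp_sum]
  simp_rw [mul_pow]
  rw [Finset.prod_mul_distrib, Finset.prod_pow_eq_pow_sum, sum_occ, nsq, Complex.ofReal_prod]
  simp_rw [Complex.ofReal_pow, ← Finset.sum_div, Finset.sum_neg_distrib]
  ring

/-! ### Characteristic functions of the coefficients -/

lemma norm_cexp_mul_I_sub_sum_le (u : ℝ) {n : ℕ} (hn : 0 < n) :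
    ‖Complex.exp ((u : ℂ) * Complex.I)
      - ∑ j ∈ Finset.range n, ((u : ℂ) * Complex.I) ^ j / (j.factorial : ℂ)‖
      ≤ (n + 2) * |u| ^ n := by
  have hnorm : ‖(u : ℂ) * Complex.I‖ = |u| := by simp
  rcases le_total |u| 1 with h | h
  · refine (Complex.exp_bound (by rw [hnorm]; exact h) hn).trans ?_
    rw [hnorm, mul_comm]
    refine mul_le_mul_of_nonneg_right ?_ (by positivity)
    have h1 : (1 : ℝ) ≤ n.factorial * n := by
      exact_mod_cast Nat.mul_pos (Nat.factorial_pos n) hn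
    have h2 : ((n.factorial : ℝ) * n)⁻¹ ≤ 1 := inv_le_one_of_one_le₀ h1
    calc ((n.succ : ℕ) : ℝ) * ((n.factorial : ℝ) * n)⁻¹ ≤ (n.succ : ℕ) * 1 := by gcongr
      _ ≤ n + 2 := by push_cast; linarith
  · have h1 : ∀ j ∈ Finset.range n,
        ‖((u : ℂ) * Complex.I) ^ j / (j.factorial : ℂ)‖ ≤ |u| ^ n := by
      intro j hj
      rw [norm_div, norm_pow, hnorm, Complex.norm_natCast]
      have : (1 : ℝ) ≤ j.factorial := by exact_mod_cast Nat.factorial_pos j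
      exact (div_le_self (by positivity) this).trans
        (pow_le_pow_right₀ h (Finset.mem_range.1 hj).le)
    have h2 : (1 : ℝ) ≤ |u| ^ n := one_le_pow₀ h
    calc _ ≤ ‖Complex.exp ((u : ℂ) * Complex.I)‖
          + ‖∑ j ∈ Finset.range n, ((u : ℂ) * Complex.I) ^ j / (j.factorial : ℂ)‖ := norm_sub_le _ _
      _ ≤ 1 + ∑ _j ∈ Finset.range n, |u| ^ n := by
          rw [Complex.norm_exp_ofReal_mul_I]
          gcongr
          exact (norm_sum_le _ _).trans (Finset.sum_le_sum h1)
      _ ≤ _ := by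
          simp only [Finset.sum_const, Finset.card_range, nsmul_eq_mul]
          nlinarith

/-- The characteristic function of the random variable `X`. -/
noncomputable def chf {Ω : Type*} [MeasurableSpace Ω] (μ : Measure Ω) (X : Ω → ℝ) (s : ℝ) : ℂ :=
  ∫ ω, Complex.exp (((s * X ω : ℝ) : ℂ) * Complex.I) ∂μ

section chf

variable {Ω : Type*} [MeasurableSpace Ω] {μ : Measure Ω} [IsProbabilityMeasure μ] {X : Ω → ℝ}

lemma norm_chf_le_one (s : ℝ) : ‖chf μ X s‖ ≤ 1 := by
  refine (norm_integral_le_of_norm_le_const (C := 1)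
    (Filter.Eventually.of_forall fun ω => (Complex.norm_exp_ofReal_mul_I _).le)).trans ?_
  simp

lemma norm_chf_sub_sum_le (hX : AllMoments μ X) {n : ℕ} (hn : 0 < n) (s : ℝ) :
    ‖chf μ X s - ∑ j ∈ Finset.range n,
      ((s : ℂ) * Complex.I) ^ j / (j.factorial : ℂ) * ((∫ ω, X ω ^ j ∂μ : ℝ) : ℂ)‖
      ≤ (n + 2) * |s| ^ n * ∫ ω, |X ω| ^ n ∂μ := by
  have hm : AEMeasurable X μ := (hX 0).aestronglyMeasurable.aemeasurable
  have h1 : Integrable (fun ω => Complex.exp (((s * X ω : ℝ) : ℂ) * Complex.I)) μ := by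
    simpa using integrable_ofReal_mul_cexp (f := fun _ => 1) (integrable_const _)
      (hm.const_mul s)
  have h2 : ∀ j ∈ Finset.range n, Integrable (fun ω => ((s : ℂ) * Complex.I) ^ j
      / (j.factorial : ℂ) * ((X ω ^ j : ℝ) : ℂ)) μ :=
    fun j _ => (hX.pow j).integrable.ofReal.const_mul _
  have h3 : ∑ j ∈ Finset.range n,
      ((s : ℂ) * Complex.I) ^ j / (j.factorial : ℂ) * ((∫ ω, X ω ^ j ∂μ : ℝ) : ℂ)
      = ∫ ω, ∑ j ∈ Finset.range n, ((s : ℂ) * Complex.I) ^ j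
      / (j.factorial : ℂ) * ((X ω ^ j : ℝ) : ℂ) ∂μ := by
    rw [integral_finsetSum _ h2]
    refine Finset.sum_congr rfl fun j _ => ?_
    rw [integral_const_mul, integral_complex_ofReal]
  rw [h3, chf, ← integral_sub h1 (integrable_finsetSum _ h2), ← integral_const_mul]
  refine norm_integral_le_of_norm_le ((hX.abs.pow n).integrable.const_mul _)
    (Filter.Eventually.of_forall fun ω => ?_)
  have h4 := norm_cexp_mul_I_sub_sum_le (s * X ω) hn
  rw [abs_mul, mul_pow, ← mul_assoc] at h4
  refine le_of_eq_of_le (congrArg norm (congrArg₂ _ rfl (Finset.sum_congr rfl fun j _ => ?_))) h4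
  push_cast; ring

end chf

/-- A random variable of mean zero and variance one with all moments finite, whose absolute
moments of order three to six are at most `K`. -/
structure Standardized {Ω : Type*} [MeasurableSpace Ω] (μ : Measure Ω) (K : ℝ) (X : Ω → ℝ) :
    Prop where
  allMoments : AllMoments μ X
  mean : ∫ ω, X ω ∂μ = 0
  var : ∫ ω, X ω ^ 2 ∂μ = 1
  moment_le : ∀ j, 3 ≤ j → j ≤ 6 → ∫ ω, |X ω| ^ j ∂μ ≤ K

/-- The `j`-th moment. -/
noncomputable def mom {Ω : Type*} [MeasurableSpace Ω] (μ : Measure Ω) (X : Ω → ℝ) (j : ℕ) : ℝ :=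
  ∫ ω, X ω ^ j ∂μ

namespace Standardized

variable {Ω : Type*} [MeasurableSpace Ω] {μ : Measure Ω} {X : Ω → ℝ} {K : ℝ}

lemma abs_mom_le (h : Standardized μ K X) {j : ℕ} (h3 : 3 ≤ j) (h6 : j ≤ 6) :
    |mom μ X j| ≤ K := by
  refine (abs_integral_le_integral_abs).trans ?_
  simp_rw [abs_pow]
  exact h.moment_le j h3 h6

variable [IsProbabilityMeasure μ]

lemma one_le (h : Standardized μ K X) : 1 ≤ K := by
  have h1 : ∫ ω, X ω ^ 2 ∂μ ≤ ∫ ω, (1 / 2 + |X ω| ^ 4 / 2) ∂μ := by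
    refine integral_mono (h.allMoments.pow 2).integrable
      ((integrable_const _).add ((h.allMoments.abs.pow 4).integrable.div_const _)) fun ω => ?_
    have : |X ω| ^ 4 = (X ω ^ 2) ^ 2 := by
      rw [show (4 : ℕ) = 2 * 2 by norm_num, pow_mul, sq_abs]
    simp only [this]
    nlinarith [sq_nonneg (X ω ^ 2 - 1)]
  rw [integral_add (integrable_const _) ((h.allMoments.abs.pow 4).integrable.div_const _),
    h.var] at h1
  have h2 := h.moment_le 4 (by norm_num) (by norm_num)
  have h3 := integral_div (μ := μ) (2 : ℝ) fun ω => |X ω| ^ 4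
  rw [integral_const, probReal_univ, one_smul] at h1
  linarith

lemma norm_chf_sub_quadratic_le (h : Standardized μ K X) (s : ℝ) :
    ‖chf μ X s - ((1 - s ^ 2 / 2 : ℝ) : ℂ)‖ ≤ 5 * K * |s| ^ 3 := by
  have h1 := norm_chf_sub_sum_le h.allMoments (n := 3) (by norm_num) s
  have h2 := h.moment_le 3 le_rfl (by norm_num)
  simp only [Finset.sum_range_succ, Finset.sum_range_zero, pow_zero, pow_one, h.mean, h.var] at h1
  have e : (((1 - s ^ 2 / 2 : ℝ)) : ℂ) = 0 + 1 / (Nat.factorial 0 : ℂ) * ((∫ _ : Ω, (1 : ℝ) ∂μ : ℝ) : ℂ)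
      + ((s : ℂ) * Complex.I) / (Nat.factorial 1 : ℂ) * ((0 : ℝ) : ℂ)
      + ((s : ℂ) * Complex.I) ^ 2 / (Nat.factorial 2 : ℂ) * ((1 : ℝ) : ℂ) := by
    simp [mul_pow, Nat.factorial]; ring
  rw [e]
  refine h1.trans ?_
  norm_num
  have : 0 ≤ |s| ^ 3 := by positivity
  nlinarith

/-- Gaussian decay of the characteristic function near the origin. Products of such factors give the
bound at medium frequencies. -/
lemma norm_chf_le (h : Standardized μ K X) {s : ℝ} (hs : 20 * K * |s| ≤ 1) :
    ‖chf μ X s‖ ≤ Real.exp (-s ^ 2 / 4) := by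
  have hK := h.one_le
  have h1 := h.norm_chf_sub_quadratic_le s
  have hs1 : |s| ≤ 1 := by nlinarith [abs_nonneg s]
  have hs2 : s ^ 2 ≤ 1 := by rw [← sq_abs]; nlinarith [abs_nonneg s]
  have h2 : ‖((1 - s ^ 2 / 2 : ℝ) : ℂ)‖ = 1 - s ^ 2 / 2 := by
    rw [Complex.norm_real, Real.norm_of_nonneg (by linarith)]
  have h3 : ‖chf μ X s‖ ≤ ‖chf μ X s - ((1 - s ^ 2 / 2 : ℝ) : ℂ)‖ + ‖((1 - s ^ 2 / 2 : ℝ) : ℂ)‖ := by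
    have := norm_add_le (chf μ X s - ((1 - s ^ 2 / 2 : ℝ) : ℂ)) ((1 - s ^ 2 / 2 : ℝ) : ℂ)
    rwa [sub_add_cancel] at this
  have h4 : 5 * K * |s| ^ 3 ≤ s ^ 2 / 4 := by
    rw [← sq_abs s]; nlinarith [sq_nonneg |s|]
  have h5 := Real.add_one_le_exp (-s ^ 2 / 4)
  linarith

lemma norm_chf_sub_quintic_le (h : Standardized μ K X) (s : ℝ) :
    ‖chf μ X s - (1 - (s : ℂ) ^ 2 / 2 - Complex.I * mom μ X 3 * s ^ 3 / 6
        + mom μ X 4 * s ^ 4 / 24 + Complex.I * mom μ X 5 * s ^ 5 / 120)‖ ≤ 8 * K * s ^ 6 := by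
  have h1 := norm_chf_sub_sum_le h.allMoments (n := 6) (by norm_num) s
  have h2 := h.moment_le 6 (by norm_num) le_rfl
  simp only [Finset.sum_range_succ, Finset.sum_range_zero, pow_zero, pow_one, h.mean, h.var] at h1
  have e : (1 - (s : ℂ) ^ 2 / 2 - Complex.I * mom μ X 3 * s ^ 3 / 6
        + mom μ X 4 * s ^ 4 / 24 + Complex.I * mom μ X 5 * s ^ 5 / 120)
      = 0 + 1 / (Nat.factorial 0 : ℂ) * ((∫ _ : Ω, (1 : ℝ) ∂μ : ℝ) : ℂ)
      + ((s : ℂ) * Complex.I) / (Nat.factorial 1 : ℂ) * ((0 : ℝ) : ℂ)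
      + ((s : ℂ) * Complex.I) ^ 2 / (Nat.factorial 2 : ℂ) * ((1 : ℝ) : ℂ)
      + ((s : ℂ) * Complex.I) ^ 3 / (Nat.factorial 3 : ℂ) * ((∫ ω, X ω ^ 3 ∂μ : ℝ) : ℂ)
      + ((s : ℂ) * Complex.I) ^ 4 / (Nat.factorial 4 : ℂ) * ((∫ ω, X ω ^ 4 ∂μ : ℝ) : ℂ)
      + ((s : ℂ) * Complex.I) ^ 5 / (Nat.factorial 5 : ℂ) * ((∫ ω, X ω ^ 5 ∂μ : ℝ) : ℂ) := by
    have i3 : Complex.I ^ 3 = -Complex.I := Complex.I_pow_three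
    have i5 : Complex.I ^ 5 = Complex.I := by rw [pow_succ, Complex.I_pow_four, one_mul]
    simp [mul_pow, Nat.factorial, i3, i5, mom]; ring
  rw [e]
  refine h1.trans ?_
  have e6 : |s| ^ 6 = s ^ 6 := by
    rw [show (6 : ℕ) = 2 * 3 by norm_num, pow_mul, pow_mul, sq_abs]
  rw [e6]
  norm_num
  have : 0 ≤ s ^ 6 := by positivity
  nlinarith

end Standardized

/-- The exponent of the model `exp (-s²/2 - i m₃ s³/6 + (m₄ - 3) s⁴/24 + i (m₅ - 10 m₃) s⁵/120)`
of a characteristic function: its logarithm up to terms of order six. -/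
noncomputable def cumulantPoly (m₃ m₄ m₅ s : ℝ) : ℂ :=
  -(s : ℂ) ^ 2 / 2 - Complex.I * m₃ * s ^ 3 / 6 + (m₄ - 3) * s ^ 4 / 24
    + Complex.I * (m₅ - 10 * m₃) * s ^ 5 / 120

/-- The exponential of the cumulant polynomial has the same Taylor polynomial of degree five as the
characteristic function. -/
lemma norm_cexp_cumulantPoly_sub_le {K m₃ m₄ m₅ s : ℝ} (hK : 1 ≤ K) (h3 : |m₃| ≤ K)
    (h4 : |m₄| ≤ K) (h5 : |m₅| ≤ K) (hs : |s| ≤ 1) :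
    ‖Complex.exp (cumulantPoly m₃ m₄ m₅ s) - (1 - (s : ℂ) ^ 2 / 2 - Complex.I * m₃ * s ^ 3 / 6
        + m₄ * s ^ 4 / 24 + Complex.I * m₅ * s ^ 5 / 120)‖
      ≤ (8 * K ^ 3 * Real.exp (2 * K) + 3 * K ^ 2) * s ^ 6 := by
  set w := cumulantPoly m₃ m₄ m₅ s with hw
  set r₀ : ℂ := -Complex.I * m₃ / 6 + (m₄ - 3) * s / 24 + Complex.I * (m₅ - 10 * m₃) * s ^ 2 / 120
    with hr₀
  set v : ℂ := (m₄ - 3) / 48 + Complex.I * (m₅ - 10 * m₃) * s / 240 with hv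
  have hs0 := abs_nonneg s
  have n4 : ‖((m₄ : ℂ) - 3)‖ ≤ 4 * K := by
    refine (norm_sub_le _ _).trans ?_
    simp only [Complex.norm_real, Real.norm_eq_abs, Complex.norm_ofNat]
    linarith
  have n5 : ‖((m₅ : ℂ) - 10 * m₃)‖ ≤ 11 * K := by
    refine (norm_sub_le _ _).trans ?_
    simp only [Complex.norm_real, Real.norm_eq_abs, norm_mul, Complex.norm_ofNat]
    linarith
  have hs2 : |s| ^ 2 ≤ 1 := pow_le_one₀ hs0 hs
  have b4 : ‖((m₄ : ℂ) - 3)‖ * |s| ≤ 4 * K := by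
    nlinarith [norm_nonneg ((m₄ : ℂ) - 3)]
  have b5 : ‖((m₅ : ℂ) - 10 * m₃)‖ * |s| ≤ 11 * K := by
    nlinarith [norm_nonneg ((m₅ : ℂ) - 10 * m₃)]
  have b5' : ‖((m₅ : ℂ) - 10 * m₃)‖ * |s| ^ 2 ≤ 11 * K := by
    nlinarith [norm_nonneg ((m₅ : ℂ) - 10 * m₃)]
  have nr : ‖r₀‖ ≤ K := by
    refine (norm_add₃_le).trans ?_
    simp only [norm_div, norm_mul, norm_neg, Complex.norm_I, Complex.norm_real, Real.norm_eq_abs,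
      norm_pow, Complex.norm_ofNat, one_mul]
    linarith
  have nv : ‖v‖ ≤ K := by
    refine (norm_add_le _ _).trans ?_
    simp only [norm_div, norm_mul, Complex.norm_I, Complex.norm_real, Real.norm_eq_abs,
      Complex.norm_ofNat, one_mul]
    linarith
  have ew : w = (s : ℂ) ^ 2 * (-1 / 2 + s * r₀) := by
    rw [hw, cumulantPoly, hr₀]; ring
  have nw : ‖w‖ ≤ 2 * K * |s| ^ 2 := by
    rw [ew, norm_mul, norm_pow, Complex.norm_real, Real.norm_eq_abs, mul_comm]
    refine mul_le_mul_of_nonneg_right ((norm_add_le _ _).trans ?_) (by positivity)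
    simp only [norm_div, norm_mul, norm_neg, norm_one, Complex.norm_real, Real.norm_eq_abs,
      Complex.norm_ofNat]
    nlinarith [norm_nonneg r₀]
  have h6 := Complex.norm_exp_sub_sum_le_norm_mul_exp w 3
  have e : Complex.exp w - (1 - (s : ℂ) ^ 2 / 2 - Complex.I * m₃ * s ^ 3 / 6
        + m₄ * s ^ 4 / 24 + Complex.I * m₅ * s ^ 5 / 120)
      = (Complex.exp w - ∑ m ∈ Finset.range 3, w ^ m / (m.factorial : ℂ))
        + (s : ℂ) ^ 6 * (r₀ ^ 2 / 2 - v) := by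
    simp only [Finset.sum_range_succ, Finset.sum_range_zero, pow_zero, pow_one, Nat.factorial]
    have : w ^ 2 = (s : ℂ) ^ 4 * (-1 / 2 + s * r₀) ^ 2 := by rw [ew]; ring
    rw [this, hw, cumulantPoly, hr₀, hv]
    push_cast; ring
  rw [e]
  refine (norm_add_le _ _).trans ?_
  have e6 : |s| ^ 6 = s ^ 6 := by
    rw [show (6 : ℕ) = 2 * 3 by norm_num, pow_mul, pow_mul, sq_abs]
  have h7 : ‖w‖ ^ 3 * Real.exp ‖w‖ ≤ 8 * K ^ 3 * Real.exp (2 * K) * s ^ 6 := by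
    have : ‖w‖ ≤ 2 * K := nw.trans (by nlinarith)
    calc ‖w‖ ^ 3 * Real.exp ‖w‖ ≤ (2 * K * |s| ^ 2) ^ 3 * Real.exp (2 * K) := by gcongr
      _ = 8 * K ^ 3 * Real.exp (2 * K) * |s| ^ 6 := by ring
      _ = _ := by rw [e6]
  have h8 : ‖(s : ℂ) ^ 6 * (r₀ ^ 2 / 2 - v)‖ ≤ 3 * K ^ 2 * s ^ 6 := by
    rw [norm_mul, norm_pow, Complex.norm_real, Real.norm_eq_abs, e6, mul_comm]
    refine mul_le_mul_of_nonneg_right ((norm_sub_le _ _).trans ?_) (by positivity)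
    simp only [norm_div, norm_pow, Complex.norm_ofNat]
    have : ‖r₀‖ ^ 2 ≤ K ^ 2 := by gcongr
    nlinarith
  linarith

lemma norm_cexp_cumulantPoly_le_one {K m₃ m₄ m₅ s : ℝ} (h4 : |m₄| ≤ K)
    (hs : K * s ^ 2 ≤ 1) : ‖Complex.exp (cumulantPoly m₃ m₄ m₅ s)‖ ≤ 1 := by
  rw [Complex.norm_exp, Real.exp_le_one_iff]
  have : (cumulantPoly m₃ m₄ m₅ s).re = -s ^ 2 / 2 + (m₄ - 3) * s ^ 4 / 24 := by
    have e : cumulantPoly m₃ m₄ m₅ s = ((-s ^ 2 / 2 + (m₄ - 3) * s ^ 4 / 24 : ℝ) : ℂ)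
        + ((-m₃ * s ^ 3 / 6 + (m₅ - 10 * m₃) * s ^ 5 / 120 : ℝ) : ℂ) * Complex.I := by
      rw [cumulantPoly]; push_cast; ring
    rw [e, Complex.add_re, Complex.re_ofReal_mul, Complex.ofReal_re, Complex.I_re, mul_zero,
      add_zero]
  rw [this]
  have h := le_of_abs_le h4
  have e : s ^ 4 = s ^ 2 * s ^ 2 := by ring
  have h1 : m₄ * s ^ 2 ≤ 1 := by nlinarith [sq_nonneg s]
  rw [e]
  nlinarith [sq_nonneg s, mul_nonneg (sq_nonneg s) (sq_nonneg s)]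

/-- Telescoping: products of numbers in the unit disc differ by at most the sum of the differences. -/
lemma norm_prod_sub_prod_le {ι : Type*} (s : Finset ι) {a b : ι → ℂ} (ha : ∀ i ∈ s, ‖a i‖ ≤ 1)
    (hb : ∀ i ∈ s, ‖b i‖ ≤ 1) : ‖∏ i ∈ s, a i - ∏ i ∈ s, b i‖ ≤ ∑ i ∈ s, ‖a i - b i‖ := by
  classical
  induction s using Finset.induction_on with
  | empty => simp
  | insert j s hj ih =>
    rw [Finset.prod_insert hj, Finset.prod_insert hj, Finset.sum_insert hj]
    have h1 := ih (fun i hi => ha i (by simp [hi])) (fun i hi => hb i (by simp [hi]))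
    have h2 : ‖∏ i ∈ s, a i‖ ≤ 1 := by
      rw [norm_prod]
      exact Finset.prod_le_one (fun _ _ => norm_nonneg _) fun i hi => ha i (by simp [hi])
    have e : a j * ∏ i ∈ s, a i - b j * ∏ i ∈ s, b i
        = (a j - b j) * ∏ i ∈ s, a i + b j * (∏ i ∈ s, a i - ∏ i ∈ s, b i) := by ring
    rw [e]
    refine (norm_add_le _ _).trans ?_
    rw [norm_mul, norm_mul]
    have h3 := hb j (by simp)
    nlinarith [norm_nonneg (a j - b j), norm_nonneg (b j),
      norm_nonneg (∏ i ∈ s, a i - ∏ i ∈ s, b i)]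

/-- The characteristic function of a weighted sum of independent copies of `X`, against the
exponential of the sum of the truncated cumulant expansions. -/
lemma norm_prod_chf_sub_le {Ω : Type*} [MeasurableSpace Ω] {μ : Measure Ω}
    [IsProbabilityMeasure μ] {X : Ω → ℝ} {K : ℝ} (h : Standardized μ K X) (s : Finset ℕ)
    (f : ℕ → ℝ) (hf : ∀ k ∈ s, K * f k ^ 2 ≤ 1) :
    ‖∏ k ∈ s, chf μ X (f k)
        - Complex.exp (∑ k ∈ s, cumulantPoly (mom μ X 3) (mom μ X 4) (mom μ X 5) (f k))‖
      ≤ (8 * K + (8 * K ^ 3 * Real.exp (2 * K) + 3 * K ^ 2)) * ∑ k ∈ s, f k ^ 6 := by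
  have hK := h.one_le
  rw [Complex.exp_sum, Finset.mul_sum]
  refine (norm_prod_sub_prod_le s (fun k _ => norm_chf_le_one _) fun k hk =>
    norm_cexp_cumulantPoly_le_one (h.abs_mom_le (by norm_num) (by norm_num)) (hf k hk)).trans ?_
  refine Finset.sum_le_sum fun k hk => ?_
  have hs : |f k| ≤ 1 := by
    rw [← sq_le_one_iff_abs_le_one]
    nlinarith [hf k hk, sq_nonneg (f k)]
  have h1 := h.norm_chf_sub_quintic_le (f k)
  have h2 := norm_cexp_cumulantPoly_sub_le hK (h.abs_mom_le (j := 3) (by norm_num) (by norm_num))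
    (h.abs_mom_le (j := 4) (by norm_num) (by norm_num))
    (h.abs_mom_le (j := 5) (by norm_num) (by norm_num)) hs
  rw [norm_sub_rev] at h2
  refine (norm_sub_le_norm_sub_add_norm_sub _ _ _).trans ((add_le_add h1 h2).trans_eq ?_)
  ring

lemma abs_cos_sub_le (b : ℝ) : |Real.cos b - (1 - b ^ 2 / 2)| ≤ 6 * b ^ 4 := by
  have h := norm_cexp_mul_I_sub_sum_le b (n := 4) (by norm_num)
  have h2 := (Complex.abs_re_le_norm _).trans h
  have e : (Complex.exp ((b : ℂ) * Complex.I)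
      - ∑ j ∈ Finset.range 4, ((b : ℂ) * Complex.I) ^ j / (j.factorial : ℂ)).re
      = Real.cos b - (1 - b ^ 2 / 2) := by
    have e2 : ∑ j ∈ Finset.range 4, ((b : ℂ) * Complex.I) ^ j / (j.factorial : ℂ)
        = ((1 - b ^ 2 / 2 : ℝ) : ℂ) + ((b - b ^ 3 / 6 : ℝ) : ℂ) * Complex.I := by
      simp only [Finset.sum_range_succ, Finset.sum_range_zero, mul_pow, Complex.I_pow_three,
        Complex.I_sq, Nat.factorial]
      push_cast; ring
    rw [e2, Complex.sub_re, Complex.exp_ofReal_mul_I_re, Complex.add_re, Complex.re_ofReal_mul,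
      Complex.ofReal_re, Complex.I_re, mul_zero, add_zero]
  rw [e] at h2
  have e4 : |b| ^ 4 = b ^ 4 := by
    rw [show (4 : ℕ) = 2 * 2 by norm_num, pow_mul, pow_mul, sq_abs]
  rw [e4] at h2
  norm_num at h2
  linarith

lemma abs_exp_sub_one_sub_le (a : ℝ) : |Real.exp a - 1 - a| ≤ a ^ 2 * Real.exp |a| := by
  have h := Complex.norm_exp_sub_sum_le_norm_mul_exp (a : ℂ) 2
  simp only [Finset.sum_range_succ, Finset.sum_range_zero, pow_zero, pow_one, Nat.factorial] at h
  have e : Complex.exp a - (0 + 1 / ((1 : ℕ) : ℂ) + (a : ℂ) / ((0 + 1) * 1 : ℕ))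
      = ((Real.exp a - 1 - a : ℝ) : ℂ) := by push_cast; simp; ring
  rw [e, Complex.norm_real, Complex.norm_real, Real.norm_eq_abs, Real.norm_eq_abs, sq_abs] at h
  exact h

/-- Second order expansion of `exp a * cos (b₀ + b₁)` for `a, b₀² = O(θ)` and
`b₀ b₁, b₁² = O(θ²)`. -/
lemma abs_exp_mul_cos_sub_le {C θ a b₀ b₁ : ℝ} (hC : 0 ≤ C) (hθ : 0 ≤ θ) (hθ1 : θ ≤ 1)
    (ha : |a| ≤ C * θ) (hb₀ : b₀ ^ 2 ≤ C * θ) (hb₁ : b₁ ^ 2 ≤ C * θ ^ 2)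
    (hb : |b₀ * b₁| ≤ C * θ ^ 2) :
    |Real.exp a * Real.cos (b₀ + b₁) - (1 + a - b₀ ^ 2 / 2)|
      ≤ (C ^ 2 * Real.exp C + 96 * C ^ 2 * (1 + C) + 2 * C + 2 * C ^ 2) * θ ^ 2 := by
  set b := b₀ + b₁ with hbd
  have hθ2 : θ ^ 2 ≤ θ := by nlinarith
  have hCθ : C * θ ≤ C := by nlinarith
  have hb2 : b ^ 2 ≤ 4 * C * θ := by
    have : b ^ 2 ≤ 2 * b₀ ^ 2 + 2 * b₁ ^ 2 := by rw [hbd]; nlinarith [sq_nonneg (b₀ - b₁)]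
    have : C * θ ^ 2 ≤ C * θ := by gcongr
    linarith
  have ha2 : a ^ 2 ≤ C ^ 2 * θ ^ 2 := by
    rw [← sq_abs, ← mul_pow]; gcongr
  have h1 : |Real.exp a - 1 - a| ≤ C ^ 2 * Real.exp C * θ ^ 2 := by
    refine (abs_exp_sub_one_sub_le a).trans ?_
    calc a ^ 2 * Real.exp |a| ≤ C ^ 2 * θ ^ 2 * Real.exp C := by
          gcongr; linarith
      _ = _ := by ring
  have h2 : |Real.cos b - (1 - b ^ 2 / 2)| ≤ 96 * C ^ 2 * θ ^ 2 := by
    refine (abs_cos_sub_le b).trans ?_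
    have : b ^ 4 ≤ (4 * C * θ) ^ 2 := by
      rw [show b ^ 4 = (b ^ 2) ^ 2 by ring]; gcongr
    nlinarith
  have h3 : |1 + a| ≤ 1 + C := by
    refine (abs_add_le _ _).trans ?_
    rw [abs_one]; linarith
  have h4 : |-(2 * (b₀ * b₁) + b₁ ^ 2) / 2 - a * b ^ 2 / 2| ≤ (2 * C + 2 * C ^ 2) * θ ^ 2 := by
    have h5 : |a * b ^ 2 / 2| ≤ 2 * C ^ 2 * θ ^ 2 := by
      rw [abs_div, abs_mul, abs_of_nonneg (sq_nonneg b)]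
      have : |a| * b ^ 2 ≤ (C * θ) * (4 * C * θ) := by gcongr
      norm_num
      linarith
    have h6 : |-(2 * (b₀ * b₁) + b₁ ^ 2) / 2| ≤ 2 * C * θ ^ 2 := by
      have h7 := abs_le.1 hb
      have h8 : 0 ≤ C * θ ^ 2 := by positivity
      rw [abs_le]; constructor <;> linarith [h7.1, h7.2, sq_nonneg b₁]
    refine (abs_sub _ _).trans ?_
    linarith
  have e : Real.exp a * Real.cos b - (1 + a - b₀ ^ 2 / 2)
      = (Real.exp a - 1 - a) * Real.cos b + (1 + a) * (Real.cos b - (1 - b ^ 2 / 2))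
        + (-(2 * (b₀ * b₁) + b₁ ^ 2) / 2 - a * b ^ 2 / 2) := by
    rw [hbd]; ring
  rw [e]
  refine (abs_add_three _ _ _).trans ?_
  rw [abs_mul, abs_mul]
  have h9 : |Real.exp a - 1 - a| * |Real.cos b| ≤ C ^ 2 * Real.exp C * θ ^ 2 * 1 := by
    gcongr; exact Real.abs_cos_le_one b
  have h10 : |1 + a| * |Real.cos b - (1 - b ^ 2 / 2)| ≤ (1 + C) * (96 * C ^ 2 * θ ^ 2) := by
    gcongr
  linarith

/-! ### Weighted sums of independent copies -/

section weightedSum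

variable {Ω : Type*} [MeasurableSpace Ω] {μ : Measure Ω}

lemma chf_eq_of_identDistrib {X Y : Ω → ℝ} (h : IdentDistrib X Y μ μ) (s : ℝ) :
    chf μ X s = chf μ Y s :=
  (h.comp (u := fun x : ℝ => Complex.exp (((s * x : ℝ) : ℂ) * Complex.I))
    (by fun_prop)).integral_eq

lemma AllMoments.of_identDistrib {X Y : Ω → ℝ} (h : IdentDistrib X Y μ μ)
    (hY : AllMoments μ Y) : AllMoments μ X := fun p => h.memLp_iff.2 (hY p)

variable {ξ : ℕ → Ω → ℝ}

/-- The characteristic function of a weighted sum of independent copies factorizes. -/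
lemma integral_cexp_sum_eq_prod (hind : iIndepFun ξ μ)
    (hid : ∀ i, IdentDistrib (ξ i) (ξ 0) μ μ) (s : Finset ℕ) (f : ℕ → ℝ) :
    ∫ ω, Complex.exp (((∑ k ∈ s, f k * ξ k ω : ℝ) : ℂ) * Complex.I) ∂μ
      = ∏ k ∈ s, chf μ (ξ 0) (f k) := by
  have h := (hind.precomp (g := ((↑) : s → ℕ)) Subtype.val_injective).integral_fun_prod_comp
    (f := fun (i : s) (x : ℝ) => Complex.exp (((f i * x : ℝ) : ℂ) * Complex.I))
    (fun i => (hid i).aemeasurable_fst) (fun i => by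
      exact (by fun_prop : Measurable _).aestronglyMeasurable)
  have e : ∀ ω, Complex.exp (((∑ k ∈ s, f k * ξ k ω : ℝ) : ℂ) * Complex.I)
      = ∏ i : s, Complex.exp (((f i * ξ i ω : ℝ) : ℂ) * Complex.I) := by
    intro ω
    rw [← Complex.exp_sum, ← Finset.sum_mul, Finset.univ_eq_attach,
      Finset.sum_attach s (fun k => ((f k * ξ k ω : ℝ) : ℂ))]
    push_cast; rfl
  simp_rw [e]
  refine h.trans ?_
  rw [Finset.univ_eq_attach, Finset.prod_attach s (fun k => ∫ ω, (fun x : ℝ =>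
    Complex.exp (((f k * x : ℝ) : ℂ) * Complex.I)) (ξ k ω) ∂μ)]
  exact Finset.prod_congr rfl fun k _ => chf_eq_of_identDistrib (hid k) (f k)

lemma allMoments_sum_mul (hid : ∀ i, IdentDistrib (ξ i) (ξ 0) μ μ) (h0 : AllMoments μ (ξ 0))
    (s : Finset ℕ) (f : ℕ → ℝ) : AllMoments μ (fun ω => ∑ k ∈ s, f k * ξ k ω) :=
  AllMoments.sum s fun k _ => (AllMoments.of_identDistrib (hid k) h0).const_mul _

variable [IsProbabilityMeasure μ]

/-- Even moments of a weighted sum of independent copies of a centred variable: adding one more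
summand `f ξ` multiplies `1 + 𝔼 S^M` by at most `1 + 2^M K f²`. -/
lemma one_add_integral_sum_pow_le (hind : iIndepFun ξ μ)
    (hid : ∀ i, IdentDistrib (ξ i) (ξ 0) μ μ) (h0 : AllMoments μ (ξ 0))
    (hmean : ∫ ω, ξ 0 ω ∂μ = 0) {M : ℕ} (hM : Even M) (hM0 : 0 < M) {K : ℝ} (hK : 0 ≤ K)
    (hmom : ∀ j, j ≤ M → ∫ ω, |ξ 0 ω| ^ j ∂μ ≤ K) (s : Finset ℕ) (f : ℕ → ℝ)
    (hf : ∀ k ∈ s, |f k| ≤ 1) :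
    1 + ∫ ω, (∑ k ∈ s, f k * ξ k ω) ^ M ∂μ ≤ Real.exp (2 ^ M * K * ∑ k ∈ s, f k ^ 2) := by
  classical
  induction s using Finset.induction_on with
  | empty => simp [hM0.ne']
  | insert a s ha ih =>
    have ih := ih fun k hk => hf k (by simp [hk])
    have hfa := hf a (by simp)
    set T : Ω → ℝ := fun ω => ∑ k ∈ s, f k * ξ k ω with hT
    set X : Ω → ℝ := fun ω => f a * ξ a ω with hX
    have hTm : AllMoments μ T := allMoments_sum_mul hid h0 s f
    have hξa : AllMoments μ (ξ a) := AllMoments.of_identDistrib (hid a) h0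
    have hXm : AllMoments μ X := hξa.const_mul _
    have hTX : IndepFun T X μ := by
      have h1 := (hind.comp (g := fun k (x : ℝ) => f k * x) fun k => by
        fun_prop).indepFun_finsetSum_of_notMem₀
        (fun i => ((hid i).aemeasurable_fst.const_mul _)) ha
      have eT : T = ∑ k ∈ s, (fun x : ℝ => f k * x) ∘ ξ k := by funext ω; simp [hT]
      rw [eT]
      exact h1
    have hmomX : ∀ i, 2 ≤ i → i ≤ M → |∫ ω, X ω ^ i ∂μ| ≤ K * f a ^ 2 := by
      intro i h2 hi
      have e : ∀ ω, X ω ^ i = f a ^ i * ξ a ω ^ i := fun ω => by rw [hX, mul_pow]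
      simp_rw [e]
      rw [integral_const_mul, abs_mul, mul_comm]
      refine mul_le_mul ?_ ?_ (abs_nonneg _) hK
      · refine abs_integral_le_integral_abs.trans (le_of_eq_of_le ?_ (hmom i hi))
        have := ((hid a).comp (u := fun x : ℝ => |x| ^ i) (by fun_prop)).integral_eq
        simpa [Function.comp_def, abs_pow] using this
      · rw [abs_pow, ← sq_abs (f a)]
        exact pow_le_pow_of_le_one (abs_nonneg _) hfa h2
    have hmeanX : ∫ ω, X ω ∂μ = 0 := by
      rw [hX, integral_const_mul, (hid a).integral_eq, hmean, mul_zero]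
    have hTM : ∀ ω, 0 ≤ T ω ^ M := fun ω => hM.pow_nonneg _
    have hTM0 : 0 ≤ ∫ ω, T ω ^ M ∂μ := integral_nonneg hTM
    have hmomT : ∀ j, j ≤ M → |∫ ω, T ω ^ j ∂μ| ≤ 1 + ∫ ω, T ω ^ M ∂μ := by
      intro j hj
      refine abs_integral_le_integral_abs.trans ?_
      have h1 : (1 : ℝ) + ∫ ω, T ω ^ M ∂μ = ∫ ω, (1 + T ω ^ M) ∂μ := by
        rw [integral_add (integrable_const _) (hTm.pow M).integrable]; simp
      rw [h1]
      refine integral_mono (hTm.pow j).abs.integrable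
        ((integrable_const _).add (hTm.pow M).integrable) fun ω => ?_
      simp only [abs_pow]
      rw [← hM.pow_abs]
      rcases le_total |T ω| 1 with h | h
      · have := pow_le_one₀ (n := j) (abs_nonneg _) h
        have : 0 ≤ |T ω| ^ M := by positivity
        linarith
      · have := pow_le_pow_right₀ h hj
        linarith
    have hexp : ∫ ω, (∑ k ∈ insert a s, f k * ξ k ω) ^ M ∂μ
        = ∑ j ∈ Finset.range (M + 1), (∫ ω, T ω ^ j ∂μ) * (∫ ω, X ω ^ (M - j) ∂μ) * M.choose j := by
      simp_rw [Finset.sum_insert ha]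
      have e : ∀ ω, (f a * ξ a ω + ∑ k ∈ s, f k * ξ k ω) ^ M
          = ∑ j ∈ Finset.range (M + 1), T ω ^ j * X ω ^ (M - j) * M.choose j := fun ω => by
        rw [add_comm]; exact add_pow _ _ _
      simp_rw [e]
      rw [integral_finsetSum _ fun j _ => (((hTm.pow j).mul (hXm.pow _)).integrable.mul_const _)]
      refine Finset.sum_congr rfl fun j _ => ?_
      rw [integral_mul_const]
      congr 1
      exact (hTX.comp (φ := fun x : ℝ => x ^ j) (ψ := fun x : ℝ => x ^ (M - j)) (by fun_prop)
        (by fun_prop)).integral_fun_mul_eq_mul_integral (hTm.pow j).integrable.aestronglyMeasurable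
        (hXm.pow _).integrable.aestronglyMeasurable
    have hbound : ∀ j ∈ Finset.range M, (∫ ω, T ω ^ j ∂μ) * (∫ ω, X ω ^ (M - j) ∂μ) * M.choose j
        ≤ (1 + ∫ ω, T ω ^ M ∂μ) * (K * f a ^ 2) * M.choose j := by
      intro j hj
      have hj := Finset.mem_range.1 hj
      refine mul_le_mul_of_nonneg_right ?_ (by positivity)
      rcases Nat.lt_or_ge (M - j) 2 with h | h
      · have h1 : M - j = 1 := by omega
        rw [h1]; simp_rw [pow_one]; rw [hmeanX, mul_zero]; positivity
      · refine (le_abs_self _).trans ?_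
        rw [abs_mul]
        have := hmomT j hj.le
        have := hmomX (M - j) h (by omega)
        gcongr
    have hchoose : ∑ j ∈ Finset.range M, (M.choose j : ℝ) ≤ 2 ^ M := by
      have h1 : ∑ j ∈ Finset.range (M + 1), (M.choose j : ℝ) = 2 ^ M := by
        exact_mod_cast Nat.sum_range_choose M
      rw [← h1, Finset.sum_range_succ]
      linarith [(Nat.cast_nonneg (M.choose M) : (0 : ℝ) ≤ _)]
    rw [hexp, Finset.sum_range_succ, Nat.sub_self, Nat.choose_self, Finset.sum_insert ha]
    have h5 := Finset.sum_le_sum hbound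
    rw [← Finset.mul_sum] at h5
    have h6 : (1 + ∫ ω, T ω ^ M ∂μ) * (K * f a ^ 2) * ∑ j ∈ Finset.range M, (M.choose j : ℝ)
        ≤ (1 + ∫ ω, T ω ^ M ∂μ) * (K * f a ^ 2) * 2 ^ M := by gcongr
    have h7 : (∫ ω, X ω ^ 0 ∂μ) = 1 := by simp
    rw [h7, Nat.cast_one, mul_one, mul_one, mul_add, Real.exp_add]
    have h8 := Real.add_one_le_exp (2 ^ M * K * f a ^ 2)
    calc _ ≤ (2 ^ M * K * f a ^ 2 + 1) * (1 + ∫ ω, T ω ^ M ∂μ) := by linarith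
      _ ≤ _ := by gcongr

end weightedSum

/-! ### The Poisson weights of the Weyl polynomial -/

/-- The normalized coefficient `e^{-x²/2} x^k / √(k!)`; its square is the mass at `k` of the Poisson
law of parameter `x²`. -/
noncomputable def wcoef (x : ℝ) (k : ℕ) : ℝ :=
  Real.exp (-x ^ 2 / 2) * x ^ k / Real.sqrt (Nat.factorial k : ℝ)

/-- The standardized index `(k - x²) / x`. -/
noncomputable def dev (x : ℝ) (k : ℕ) : ℝ := k / x - x

lemma wcoef_pos {x : ℝ} (hx : 0 < x) (k : ℕ) : 0 < wcoef x k := by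
  unfold wcoef
  have : (0 : ℝ) < Nat.factorial k := by exact_mod_cast Nat.factorial_pos k
  positivity

lemma wcoef_sq (x : ℝ) (k : ℕ) :
    wcoef x k ^ 2 = Real.exp (-x ^ 2) * ((x ^ 2) ^ k / (Nat.factorial k : ℝ)) := by
  unfold wcoef
  rw [div_pow, mul_pow, Real.sq_sqrt (by positivity), ← Real.exp_nat_mul, ← pow_mul, ← pow_mul,
    mul_comm k 2, mul_div_assoc]
  congr 2; push_cast; ring

lemma hasSum_pow_div_factorial (r : ℝ) :
    HasSum (fun k : ℕ => r ^ k / (Nat.factorial k : ℝ)) (Real.exp r) := by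
  rw [Real.exp_eq_exp_ℝ]; exact NormedSpace.expSeries_div_hasSum_exp r

lemma hasSum_mul_pow_div_factorial (r : ℝ) :
    HasSum (fun k : ℕ => (k : ℝ) * (r ^ k / (Nat.factorial k : ℝ))) (r * Real.exp r) := by
  rw [← hasSum_nat_add_iff' 1]
  simp only [Finset.sum_range_one, Nat.cast_zero, zero_mul, sub_zero]
  refine ((hasSum_pow_div_factorial r).mul_left r).congr_fun ?_
  intro k
  have : (Nat.factorial k : ℝ) ≠ 0 := by exact_mod_cast Nat.factorial_ne_zero k
  rw [Nat.factorial_succ]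
  push_cast
  field_simp
  ring

lemma hasSum_mul_pred_mul_pow_div_factorial (r : ℝ) :
    HasSum (fun k : ℕ => (k : ℝ) * (k - 1) * (r ^ k / (Nat.factorial k : ℝ)))
      (r ^ 2 * Real.exp r) := by
  rw [← hasSum_nat_add_iff' 2]
  simp only [Finset.sum_range_succ, Finset.sum_range_zero, Nat.cast_zero, zero_mul, sub_zero,
    Nat.cast_one, sub_self, mul_zero, add_zero]
  refine ((hasSum_pow_div_factorial r).mul_left (r ^ 2)).congr_fun ?_
  intro k
  have : (Nat.factorial k : ℝ) ≠ 0 := by exact_mod_cast Nat.factorial_ne_zero k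
  rw [Nat.factorial_succ, Nat.factorial_succ]
  push_cast
  have h1 : (k : ℝ) + 1 ≠ 0 := by positivity
  have h2 : (k : ℝ) + 1 + 1 ≠ 0 := by positivity
  field_simp
  ring

lemma hasSum_wcoef_sq (x : ℝ) : HasSum (fun k => wcoef x k ^ 2) 1 := by
  have h := (hasSum_pow_div_factorial (x ^ 2)).mul_left (Real.exp (-x ^ 2))
  rw [← Real.exp_add] at h
  simp_rw [wcoef_sq]
  rwa [neg_add_cancel, Real.exp_zero] at h

lemma hasSum_wcoef_sq_mul_dev {x : ℝ} (hx : 0 < x) :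
    HasSum (fun k => wcoef x k ^ 2 * dev x k) 0 := by
  have h1 := (hasSum_mul_pow_div_factorial (x ^ 2)).mul_left (Real.exp (-x ^ 2) / x)
  have h := h1.sub ((hasSum_wcoef_sq x).mul_left x)
  have e : Real.exp (-x ^ 2) / x * (x ^ 2 * Real.exp (x ^ 2)) - x * 1 = 0 := by
    rw [Real.exp_neg]; field_simp; ring
  rw [e] at h
  refine h.congr_fun ?_
  intro k
  rw [wcoef_sq, dev]; field_simp

lemma hasSum_wcoef_sq_mul_dev_sq {x : ℝ} (hx : 0 < x) :
    HasSum (fun k => wcoef x k ^ 2 * dev x k ^ 2) 1 := by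
  have h1 := (hasSum_mul_pow_div_factorial (x ^ 2)).mul_left (Real.exp (-x ^ 2) * (1 / x ^ 2 - 2))
  have h2 := (hasSum_mul_pred_mul_pow_div_factorial (x ^ 2)).mul_left (Real.exp (-x ^ 2) / x ^ 2)
  have h := (h1.add h2).add ((hasSum_wcoef_sq x).mul_left (x ^ 2))
  have e : Real.exp (-x ^ 2) * (1 / x ^ 2 - 2) * (x ^ 2 * Real.exp (x ^ 2))
      + Real.exp (-x ^ 2) / x ^ 2 * ((x ^ 2) ^ 2 * Real.exp (x ^ 2)) + x ^ 2 * 1 = 1 := by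
    rw [Real.exp_neg]; field_simp; ring
  rw [e] at h
  refine h.congr_fun ?_
  intro k
  rw [wcoef_sq, dev]; field_simp; ring

/-- Chernoff-type bound: the exponential moments of the standardized Poisson law. -/
lemma hasSum_wcoef_sq_mul_exp {x : ℝ} (hx : 0 < x) (a : ℝ) :
    HasSum (fun k => wcoef x k ^ 2 * Real.exp (a * dev x k))
      (Real.exp (x ^ 2 * (Real.exp (a / x) - 1 - a / x))) := by
  have h := (hasSum_pow_div_factorial (x ^ 2 * Real.exp (a / x))).mul_left
    (Real.exp (-x ^ 2 - a * x))
  rw [← Real.exp_add] at h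
  have e : -x ^ 2 - a * x + x ^ 2 * Real.exp (a / x)
      = x ^ 2 * (Real.exp (a / x) - 1 - a / x) := by field_simp; ring
  rw [e] at h
  refine h.congr_fun ?_
  intro k
  rw [wcoef_sq, dev, mul_pow, ← Real.exp_nat_mul, sub_eq_add_neg (-x ^ 2), Real.exp_add]
  have : Real.exp (a * (k / x - x)) = Real.exp (-(a * x)) * Real.exp (k * (a / x)) := by
    rw [← Real.exp_add]; congr 1; ring
  rw [this]; ring

lemma sum_wcoef_sq_mul_exp_abs_le {x : ℝ} (hx : 1 ≤ x) (s : Finset ℕ) :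
    ∑ k ∈ s, wcoef x k ^ 2 * Real.exp |dev x k| ≤ 6 := by
  have hx0 : 0 < x := by linarith
  have key : ∀ a : ℝ, |a| ≤ 1 → ∑ k ∈ s, wcoef x k ^ 2 * Real.exp (a * dev x k) ≤ Real.exp 1 := by
    intro a ha
    refine (sum_le_hasSum s (fun k _ => by positivity) (hasSum_wcoef_sq_mul_exp hx0 a)).trans ?_
    rw [Real.exp_le_exp]
    have h1 : |a / x| ≤ 1 := by
      rw [abs_div, abs_of_pos hx0, div_le_one hx0]; linarith
    have h2 := (abs_le.1 (Real.abs_exp_sub_one_sub_id_le h1)).2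
    have h3 : a ^ 2 ≤ 1 := (sq_le_one_iff_abs_le_one a).2 ha
    calc x ^ 2 * (Real.exp (a / x) - 1 - a / x) ≤ x ^ 2 * (a / x) ^ 2 := by gcongr
      _ = a ^ 2 := by field_simp
      _ ≤ 1 := h3
  have h1 := key 1 (by simp)
  have h2 := key (-1) (by simp)
  have h3 : ∑ k ∈ s, wcoef x k ^ 2 * Real.exp |dev x k|
      ≤ ∑ k ∈ s, (wcoef x k ^ 2 * Real.exp (1 * dev x k)
        + wcoef x k ^ 2 * Real.exp (-1 * dev x k)) := by
    refine Finset.sum_le_sum fun k _ => ?_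
    rw [← mul_add]
    refine mul_le_mul_of_nonneg_left ?_ (sq_nonneg _)
    rcases abs_cases (dev x k) with ⟨h, _⟩ | ⟨h, _⟩ <;> rw [h]
    · rw [one_mul]; linarith [Real.exp_pos (-1 * dev x k)]
    · rw [neg_one_mul]; linarith [Real.exp_pos (1 * dev x k)]
  rw [Finset.sum_add_distrib] at h3
  have := Real.exp_one_lt_d9
  linarith

lemma wcoef_sq_mul_exp_abs_le {x : ℝ} (hx : 1 ≤ x) (k : ℕ) :
    wcoef x k ^ 2 * Real.exp |dev x k| ≤ 6 := by
  simpa using sum_wcoef_sq_mul_exp_abs_le hx {k}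

/-- The Poisson masses are `O(1 / x)`. -/
lemma wcoef_sq_le {x : ℝ} (hx : 1 ≤ x) (k : ℕ) : wcoef x k ^ 2 ≤ 8 / x := by
  have hx0 : 0 < x := by linarith
  rcases lt_or_ge (k : ℝ) (x ^ 2 / 4) with hk | hk
  · -- far from the mode the exponential moments suffice
    have h1 := wcoef_sq_mul_exp_abs_le hx k
    have h2 : 3 / 4 * x ≤ |dev x k| := by
      rw [dev, abs_sub_comm]
      refine le_trans ?_ (le_abs_self _)
      have : k / x ≤ x / 4 := by rw [div_le_iff₀ hx0]; nlinarith
      linarith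
    have h3 := Real.add_one_le_exp |dev x k|
    have h4 : 3 / 4 * x ≤ Real.exp |dev x k| := by linarith
    have h5 : wcoef x k ^ 2 * (3 / 4 * x) ≤ 6 :=
      (mul_le_mul_of_nonneg_left h4 (sq_nonneg _)).trans h1
    rw [le_div_iff₀ hx0]; linarith
  · have hk0 : (0 : ℝ) < k := lt_of_lt_of_le (by positivity) hk
    have h1 := Stirling.le_factorial_stirling k
    have h2 : Real.exp (-x ^ 2) * (x ^ 2) ^ k ≤ (k / Real.exp 1) ^ k := by
      -- `log u ≤ u - 1` at `u = x² / k`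
      have h3 : x ^ 2 / k ≤ Real.exp (x ^ 2 / k - 1) := by
        linarith [Real.add_one_le_exp (x ^ 2 / k - 1)]
      have h4 : (x ^ 2 / k) ^ k ≤ Real.exp (x ^ 2 - k) := by
        refine (pow_le_pow_left₀ (by positivity) h3 k).trans_eq ?_
        rw [← Real.exp_nat_mul]; congr 1; field_simp
      rw [div_pow, div_le_iff₀ (by positivity)] at h4
      rw [div_pow, le_div_iff₀ (by positivity), ← Real.exp_nat_mul]
      calc _ = Real.exp (-x ^ 2) * Real.exp (k * 1) * (x ^ 2) ^ k := by ring
        _ ≤ Real.exp (-x ^ 2) * Real.exp (k * 1) * (Real.exp (x ^ 2 - k) * k ^ k) := by gcongr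
        _ = Real.exp (-x ^ 2 + k * 1 + (x ^ 2 - k)) * k ^ k := by
            rw [Real.exp_add, Real.exp_add]; ring
        _ = k ^ k := by
            rw [show -x ^ 2 + k * 1 + (x ^ 2 - k) = 0 by ring]; simp
    have hf : (0 : ℝ) < Nat.factorial k := by exact_mod_cast Nat.factorial_pos k
    have h5 : x ≤ Real.sqrt (2 * Real.pi * k) := by
      refine Real.le_sqrt_of_sq_le ?_
      nlinarith [Real.pi_gt_three]
    rw [wcoef_sq, ← mul_div_assoc, div_le_div_iff₀ hf hx0]
    calc Real.exp (-x ^ 2) * (x ^ 2) ^ k * x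
        ≤ (k / Real.exp 1) ^ k * Real.sqrt (2 * Real.pi * k) := by gcongr
      _ ≤ Nat.factorial k := by rw [mul_comm]; exact h1
      _ ≤ _ := by linarith

lemma pow_le_mul_exp {z : ℝ} (hz : 0 ≤ z) (j : ℕ) (c : ℝ) (hc : 0 < c) :
    (1 + z) ^ j ≤ (Nat.factorial j : ℝ) / c ^ j * Real.exp c * Real.exp (c * z) := by
  have h := Real.pow_div_factorial_le_exp (c * (1 + z)) (by positivity) j
  have hf : (0 : ℝ) < Nat.factorial j := by exact_mod_cast Nat.factorial_pos j
  rw [mul_pow, div_le_iff₀ hf] at h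
  rw [mul_assoc, ← Real.exp_add, div_mul_eq_mul_div, le_div_iff₀ (by positivity)]
  have e : c + c * z = c * (1 + z) := by ring
  rw [e]; linarith

/-! ### Powers against powers and exponentials -/

lemma eventually_mul_rpow_le (A : ℝ) {a b : ℝ} (h : a < b) :
    ∀ᶠ N : ℝ in atTop, A * N ^ a ≤ N ^ b := by
  filter_upwards [(tendsto_rpow_atTop (sub_pos.2 h)).eventually_ge_atTop A,
    eventually_gt_atTop 0] with N h1 h2
  have : N ^ b = N ^ (b - a) * N ^ a := by rw [← Real.rpow_add h2]; congr 1; ring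
  rw [this]
  gcongr

lemma eventually_mul_rpow_mul_exp_le (A a : ℝ) {b c η : ℝ} (hb : 0 < b) (hc : 0 < c)
    (hη : 0 < η) : ∀ᶠ N : ℝ in atTop, A * N ^ a * Real.exp (-(c * N ^ b)) ≤ η := by
  have h1 := ((tendsto_rpow_mul_exp_neg_mul_atTop_nhds_zero (a / b) c hc).comp
    (tendsto_rpow_atTop hb)).const_mul A
  rw [mul_zero] at h1
  filter_upwards [h1.eventually_lt_const hη, eventually_gt_atTop 0] with N h2 h3
  simp only [Function.comp_apply] at h2
  rw [← Real.rpow_mul h3.le, mul_div_cancel₀ _ hb.ne', ← mul_assoc, neg_mul] at h2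
  exact h2.le

/-! ### Sums of step values -/

/-- The linear functional `(p, q)` of the step vector at `x`. -/
noncomputable def stepVal (x p q : ℝ) (k : ℕ) : ℝ := wcoef x k * (p + q * dev x k)

lemma sq_add_mul_le (p q z : ℝ) : (p + q * z) ^ 2 ≤ (p ^ 2 + q ^ 2) * (1 + |z|) ^ 2 := by
  have h : z ^ 2 = |z| ^ 2 := (sq_abs z).symm
  have h0 := abs_nonneg z
  nlinarith [sq_nonneg (p * z - q), mul_nonneg (add_nonneg (sq_nonneg p) (sq_nonneg q)) h0]

lemma stepVal_sq_le (x p q : ℝ) (k : ℕ) :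
    stepVal x p q k ^ 2 ≤ (p ^ 2 + q ^ 2) * (wcoef x k ^ 2 * (1 + |dev x k|) ^ 2) := by
  rw [stepVal, mul_pow]
  have := sq_add_mul_le p q (dev x k)
  nlinarith [sq_nonneg (wcoef x k)]

lemma exp_half_lt : Real.exp (1 / 2) < 1.65 := by
  have h : Real.exp (1 / 2) ^ 2 = Real.exp 1 := by
    rw [← Real.exp_nat_mul]; norm_num
  have := Real.exp_one_lt_d9
  by_contra hc
  push Not at hc
  nlinarith

lemma sum_wcoef_sq_mul_sq_mul_exp_le {x : ℝ} (hx : 1 ≤ x) (s : Finset ℕ) :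
    ∑ k ∈ s, wcoef x k ^ 2 * (1 + |dev x k|) ^ 2 * Real.exp (|dev x k| / 2) ≤ 80 := by
  have h1 : ∀ k ∈ s, wcoef x k ^ 2 * (1 + |dev x k|) ^ 2 * Real.exp (|dev x k| / 2)
      ≤ 13.2 * (wcoef x k ^ 2 * Real.exp |dev x k|) := by
    intro k _
    have h2 := pow_le_mul_exp (abs_nonneg (dev x k)) 2 (1 / 2) (by norm_num)
    have h3 : Real.exp |dev x k| = Real.exp (1 / 2 * |dev x k|) * Real.exp (|dev x k| / 2) := by
      rw [← Real.exp_add]; congr 1; ring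
    rw [h3]
    have h4 : (1 + |dev x k|) ^ 2 ≤ 13.2 * Real.exp (1 / 2 * |dev x k|) := by
      refine h2.trans ?_
      have := exp_half_lt
      gcongr
      norm_num [Nat.factorial] at this ⊢
      linarith
    calc _ ≤ wcoef x k ^ 2 * (13.2 * Real.exp (1 / 2 * |dev x k|)) * Real.exp (|dev x k| / 2) := by
          gcongr
      _ = _ := by ring
  refine (Finset.sum_le_sum h1).trans ?_
  rw [← Finset.mul_sum]
  have := sum_wcoef_sq_mul_exp_abs_le hx s
  linarith

lemma sum_tail_le {x R : ℝ} (hx : 1 ≤ x) (s : Finset ℕ) (hs : ∀ k ∈ s, R ≤ |dev x k|) :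
    ∑ k ∈ s, wcoef x k ^ 2 * (1 + |dev x k|) ^ 2 ≤ 80 * Real.exp (-R / 2) := by
  have h1 : ∀ k ∈ s, wcoef x k ^ 2 * (1 + |dev x k|) ^ 2
      ≤ (wcoef x k ^ 2 * (1 + |dev x k|) ^ 2 * Real.exp (|dev x k| / 2)) * Real.exp (-R / 2) := by
    intro k hk
    rw [mul_assoc, ← Real.exp_add]
    refine le_mul_of_one_le_right (by positivity) (Real.one_le_exp ?_)
    linarith [hs k hk]
  refine (Finset.sum_le_sum h1).trans ?_
  rw [← Finset.sum_mul]
  exact mul_le_mul_of_nonneg_right (sum_wcoef_sq_mul_sq_mul_exp_le hx s) (Real.exp_pos _).le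

lemma hasSum_stepVal_sq {x : ℝ} (hx : 0 < x) (p q : ℝ) :
    HasSum (fun k => stepVal x p q k ^ 2) (p ^ 2 + q ^ 2) := by
  have h := (((hasSum_wcoef_sq x).mul_left (p ^ 2)).add
    ((hasSum_wcoef_sq_mul_dev hx).mul_left (2 * p * q))).add
    ((hasSum_wcoef_sq_mul_dev_sq hx).mul_left (q ^ 2))
  rw [mul_one, mul_zero, mul_one, add_zero] at h
  refine h.congr_fun ?_
  intro k
  rw [stepVal]; ring

/-- The truncated sum of squares is the full one up to the exponential tail of the Poisson law. -/
lemma abs_sum_stepVal_sq_sub_le {x R : ℝ} (hx : 1 ≤ x) (p q : ℝ) (s : Finset ℕ)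
    (hs : ∀ k ∉ s, R ≤ |dev x k|) :
    |∑ k ∈ s, stepVal x p q k ^ 2 - (p ^ 2 + q ^ 2)|
      ≤ 80 * Real.exp (-R / 2) * (p ^ 2 + q ^ 2) := by
  classical
  have h := hasSum_stepVal_sq (by linarith : 0 < x) p q
  rw [abs_sub_comm, abs_of_nonneg (sub_nonneg.2 (sum_le_hasSum s (fun _ _ => sq_nonneg _) h)),
    sub_le_iff_le_add]
  refine le_of_tendsto h ?_
  filter_upwards [Filter.eventually_ge_atTop s] with t ht
  rw [← Finset.sum_sdiff ht]
  gcongr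
  calc ∑ k ∈ t \ s, stepVal x p q k ^ 2
      ≤ ∑ k ∈ t \ s, (p ^ 2 + q ^ 2) * (wcoef x k ^ 2 * (1 + |dev x k|) ^ 2) :=
        Finset.sum_le_sum fun k _ => stepVal_sq_le x p q k
    _ ≤ (p ^ 2 + q ^ 2) * (80 * Real.exp (-R / 2)) := by
        rw [← Finset.mul_sum]
        exact mul_le_mul_of_nonneg_left
          (sum_tail_le hx _ fun k hk => hs k (Finset.mem_sdiff.1 hk).2) (by positivity)
    _ = _ := by ring

lemma sum_wcoef_sq_mul_pow_le {x : ℝ} (hx : 1 ≤ x) (s : Finset ℕ) (j : ℕ) :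
    ∑ k ∈ s, wcoef x k ^ 2 * (1 + |dev x k|) ^ j ≤ 17 * (Nat.factorial j : ℝ) := by
  have h1 : ∀ k ∈ s, wcoef x k ^ 2 * (1 + |dev x k|) ^ j
      ≤ (Nat.factorial j * Real.exp 1) * (wcoef x k ^ 2 * Real.exp |dev x k|) := by
    intro k _
    have h2 := pow_le_mul_exp (abs_nonneg (dev x k)) j 1 one_pos
    rw [one_pow, div_one, one_mul] at h2
    calc _ ≤ wcoef x k ^ 2 * (Nat.factorial j * Real.exp 1 * Real.exp |dev x k|) := by gcongr
      _ = _ := by ring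
  refine (Finset.sum_le_sum h1).trans ?_
  rw [← Finset.mul_sum]
  have h3 := sum_wcoef_sq_mul_exp_abs_le hx s
  have h4 := Real.exp_one_lt_d9
  have h5 : (0 : ℝ) ≤ Nat.factorial j := by positivity
  calc _ ≤ ((Nat.factorial j : ℝ) * (17 / 6)) * 6 := by gcongr; linarith
    _ = _ := by ring

lemma sum_stepVal_pow_four_le {x : ℝ} (hx : 1 ≤ x) (p q : ℝ) (s : Finset ℕ) :
    ∑ k ∈ s, stepVal x p q k ^ 4 ≤ 3264 / x * (p ^ 2 + q ^ 2) ^ 2 := by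
  have hx0 : 0 < x := by linarith
  have h1 : ∀ k ∈ s, stepVal x p q k ^ 4
      ≤ 8 / x * (p ^ 2 + q ^ 2) ^ 2 * (wcoef x k ^ 2 * (1 + |dev x k|) ^ 4) := by
    intro k _
    have h2 := wcoef_sq_le hx k
    calc stepVal x p q k ^ 4 = wcoef x k ^ 2 * (wcoef x k ^ 2 * ((p + q * dev x k) ^ 2) ^ 2) := by
          rw [stepVal]; ring
      _ ≤ 8 / x * (wcoef x k ^ 2 * ((p ^ 2 + q ^ 2) * (1 + |dev x k|) ^ 2) ^ 2) := by
          gcongr; exact sq_add_mul_le _ _ _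
      _ = _ := by ring
  refine (Finset.sum_le_sum h1).trans ?_
  rw [← Finset.mul_sum]
  have h3 := sum_wcoef_sq_mul_pow_le hx s 4
  norm_num [Nat.factorial] at h3
  calc _ ≤ 8 / x * (p ^ 2 + q ^ 2) ^ 2 * 408 := by gcongr
    _ = _ := by ring

lemma sum_stepVal_pow_six_le {x : ℝ} (hx : 1 ≤ x) (p q : ℝ) (s : Finset ℕ) :
    ∑ k ∈ s, stepVal x p q k ^ 6 ≤ 783360 / x ^ 2 * (p ^ 2 + q ^ 2) ^ 3 := by
  have hx0 : 0 < x := by linarith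
  have h1 : ∀ k ∈ s, stepVal x p q k ^ 6
      ≤ (8 / x) ^ 2 * (p ^ 2 + q ^ 2) ^ 3 * (wcoef x k ^ 2 * (1 + |dev x k|) ^ 6) := by
    intro k _
    have h2 := wcoef_sq_le hx k
    calc stepVal x p q k ^ 6
        = (wcoef x k ^ 2) ^ 2 * (wcoef x k ^ 2 * ((p + q * dev x k) ^ 2) ^ 3) := by
          rw [stepVal]; ring
      _ ≤ (8 / x) ^ 2 * (wcoef x k ^ 2 * ((p ^ 2 + q ^ 2) * (1 + |dev x k|) ^ 2) ^ 3) := by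
          gcongr; exact sq_add_mul_le _ _ _
      _ = _ := by ring
  refine (Finset.sum_le_sum h1).trans ?_
  rw [← Finset.mul_sum]
  have h3 := sum_wcoef_sq_mul_pow_le hx s 6
  norm_num [Nat.factorial] at h3
  calc _ ≤ (8 / x) ^ 2 * (p ^ 2 + q ^ 2) ^ 3 * 12240 := by gcongr
    _ = _ := by ring

/-- Steps at two separated points are almost orthogonal: every index is far from the window of one
of them. -/
lemma abs_sum_stepVal_mul_stepVal_le {x y R : ℝ} (hx : 1 ≤ x) (hy : 1 ≤ y) (p q p' q' : ℝ)
    (s : Finset ℕ) (hs : ∀ k, R ≤ |dev x k| ∨ R ≤ |dev y k|) :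
    |∑ k ∈ s, stepVal x p q k * stepVal y p' q' k|
      ≤ 80 * Real.exp (-R / 4) * ((p ^ 2 + q ^ 2) + (p' ^ 2 + q' ^ 2)) := by
  set U : ℝ → ℕ → ℝ := fun x k => wcoef x k ^ 2 * (1 + |dev x k|) ^ 2 with hU
  have hU0 : ∀ x k, 0 ≤ U x k := fun x k => by positivity
  have key : ∀ x y p q p' q' : ℝ, ∀ k, R ≤ |dev x k| →
      |stepVal x p q k * stepVal y p' q' k| ≤ Real.exp (-R / 4) *
        ((p ^ 2 + q ^ 2) * (U x k * Real.exp (|dev x k| / 2))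
          + (p' ^ 2 + q' ^ 2) * (U y k * Real.exp (|dev y k| / 2))) := by
    intro x y p q p' q' k hk
    have h1 := stepVal_sq_le x p q k
    have h2 := stepVal_sq_le y p' q' k
    have e1 : Real.exp (R / 4) * Real.exp (-R / 4) = 1 := by
      rw [← Real.exp_add, show R / 4 + -R / 4 = 0 by ring, Real.exp_zero]
    have h3 : |stepVal x p q k * stepVal y p' q' k|
        ≤ Real.exp (R / 4) * stepVal x p q k ^ 2 + Real.exp (-R / 4) * stepVal y p' q' k ^ 2 := by
      rw [abs_mul, ← sq_abs (stepVal x p q k), ← sq_abs (stepVal y p' q' k)]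
      set a := |stepVal x p q k|
      set b := |stepVal y p' q' k|
      have ha : 0 ≤ a := abs_nonneg _
      have hb : 0 ≤ b := abs_nonneg _
      have h4 : 0 ≤ Real.exp (-R / 4) * (Real.exp (R / 4) * a - b) ^ 2 := by positivity
      have h5 : Real.exp (-R / 4) * (Real.exp (R / 4) * a - b) ^ 2
          = Real.exp (R / 4) * a ^ 2 + Real.exp (-R / 4) * b ^ 2 - 2 * (a * b) := by
        linear_combination (Real.exp (R / 4) * a ^ 2 - 2 * a * b) * e1
      nlinarith [mul_nonneg ha hb]
    have h6 : Real.exp (R / 4) ≤ Real.exp (-R / 4) * Real.exp (|dev x k| / 2) := by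
      rw [← Real.exp_add, Real.exp_le_exp]; linarith
    have h7 : 1 ≤ Real.exp (|dev y k| / 2) := Real.one_le_exp (by positivity)
    refine h3.trans ?_
    calc _ ≤ (Real.exp (-R / 4) * Real.exp (|dev x k| / 2)) * ((p ^ 2 + q ^ 2) * U x k)
          + Real.exp (-R / 4) * ((p' ^ 2 + q' ^ 2) * U y k * Real.exp (|dev y k| / 2)) := by
          gcongr
          refine h2.trans (le_mul_of_one_le_right ?_ h7)
          have := hU0 y k
          positivity
      _ = _ := by ring
  refine (Finset.abs_sum_le_sum_abs _ _).trans ?_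
  have h8 : ∀ k ∈ s, |stepVal x p q k * stepVal y p' q' k| ≤ Real.exp (-R / 4) *
        ((p ^ 2 + q ^ 2) * (U x k * Real.exp (|dev x k| / 2))
          + (p' ^ 2 + q' ^ 2) * (U y k * Real.exp (|dev y k| / 2))) := by
    intro k _
    rcases hs k with h | h
    · exact key x y p q p' q' k h
    · have := key y x p' q' p q k h
      rw [mul_comm (stepVal y p' q' k), add_comm] at this
      exact this
  refine (Finset.sum_le_sum h8).trans ?_
  rw [← Finset.mul_sum, Finset.sum_add_distrib, ← Finset.mul_sum, ← Finset.mul_sum]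
  have h9 := sum_wcoef_sq_mul_sq_mul_exp_le hx s
  have h10 := sum_wcoef_sq_mul_sq_mul_exp_le hy s
  calc _ ≤ Real.exp (-R / 4) * ((p ^ 2 + q ^ 2) * 80 + (p' ^ 2 + q' ^ 2) * 80) := by gcongr
    _ = _ := by ring

/-- Far from the window of `x` the step values are exponentially small, whatever `p` and `q` of
polynomial size. -/
lemma abs_stepVal_le {x : ℝ} (hx : 1 ≤ x) (p q : ℝ) (k : ℕ) :
    |stepVal x p q k| ≤ 9 * Real.sqrt (p ^ 2 + q ^ 2) * Real.exp (-|dev x k| / 4) := by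
  have h1 := sum_wcoef_sq_mul_sq_mul_exp_le hx {k}
  rw [Finset.sum_singleton] at h1
  have h2 := stepVal_sq_le x p q k
  refine abs_le_of_sq_le_sq ?_ (by positivity)
  rw [mul_pow, mul_pow, Real.sq_sqrt (by positivity), ← Real.exp_nat_mul]
  refine h2.trans ?_
  have e : Real.exp (|dev x k| / 2) * Real.exp (((2 : ℕ) : ℝ) * (-|dev x k| / 4)) = 1 := by
    rw [← Real.exp_add]; simp; ring
  have h3 : wcoef x k ^ 2 * (1 + |dev x k|) ^ 2
      ≤ 80 * Real.exp (((2 : ℕ) : ℝ) * (-|dev x k| / 4)) := by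
    calc _ = wcoef x k ^ 2 * (1 + |dev x k|) ^ 2 * Real.exp (|dev x k| / 2)
          * Real.exp (((2 : ℕ) : ℝ) * (-|dev x k| / 4)) := by rw [mul_assoc, e, mul_one]
      _ ≤ _ := by gcongr
  have h4 : (0 : ℝ) ≤ p ^ 2 + q ^ 2 := by positivity
  have h5 := Real.exp_pos (((2 : ℕ) : ℝ) * (-|dev x k| / 4))
  calc _ ≤ (p ^ 2 + q ^ 2) * (80 * Real.exp (((2 : ℕ) : ℝ) * (-|dev x k| / 4))) := by gcongr
    _ ≤ _ := by nlinarith [mul_nonneg h4 h5.le]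

lemma wcoef_succ_sq {x : ℝ} (k : ℕ) :
    wcoef x (k + 1) ^ 2 * (k + 1) = wcoef x k ^ 2 * x ^ 2 := by
  rw [wcoef_sq, wcoef_sq, Nat.factorial_succ]
  have h1 : (Nat.factorial k : ℝ) ≠ 0 := by exact_mod_cast Nat.factorial_ne_zero k
  have h2 : (k : ℝ) + 1 ≠ 0 := by positivity
  push_cast
  field_simp
  ring

/-- The weights decay slowly to the right of the mode. -/
lemma wcoef_sq_add_ge {x V : ℝ} (hx : 0 < x) (hV : 0 ≤ V) (K j : ℕ)
    (h : (K : ℝ) + j ≤ x ^ 2 + V) (hj : 2 * (j * V) ≤ x ^ 2) :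
    wcoef x K ^ 2 / 2 ≤ wcoef x (K + j) ^ 2 := by
  have hx2 : 0 < x ^ 2 := by positivity
  have key : ∀ i : ℕ, i ≤ j → wcoef x K ^ 2 * (1 - i * (V / x ^ 2)) ≤ wcoef x (K + i) ^ 2 := by
    intro i hi
    induction i with
    | zero => simp
    | succ i ih =>
      have ih := ih (by omega)
      have h1 := wcoef_succ_sq (x := x) (K + i)
      have hij : ((i : ℝ) + 1) ≤ j := by exact_mod_cast hi
      have h2 : ((K + i : ℕ) : ℝ) + 1 ≤ x ^ 2 + V := by push_cast; linarith
      set u := V / x ^ 2 with hu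
      have hVu : V = u * x ^ 2 := by rw [hu]; field_simp
      have hu0 : 0 ≤ u := by positivity
      have h4 : wcoef x (K + i) ^ 2 ≤ wcoef x (K + i + 1) ^ 2 * (1 + u) := by
        have h5 : wcoef x (K + i) ^ 2 * x ^ 2 ≤ wcoef x (K + i + 1) ^ 2 * (x ^ 2 + V) := by
          rw [← h1]; gcongr
        rw [hVu] at h5
        have : wcoef x (K + i) ^ 2 * x ^ 2 ≤ (wcoef x (K + i + 1) ^ 2 * (1 + u)) * x ^ 2 := by
          linarith
        exact le_of_mul_le_mul_right this hx2
      have h6 : 0 ≤ 1 - i * u - u := by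
        have : ((i : ℝ) + 1) * V ≤ x ^ 2 := by nlinarith
        rw [hVu] at this
        have : (((i : ℝ) + 1) * u) * x ^ 2 ≤ 1 * x ^ 2 := by linarith
        have := le_of_mul_le_mul_right this hx2
        linarith
      have h7 := sq_nonneg (wcoef x K)
      have h8 : wcoef x K ^ 2 * (1 - i * u - u) * (1 + u)
          ≤ wcoef x (K + i + 1) ^ 2 * (1 + u) := by
        refine le_trans ?_ (ih.trans h4)
        rw [mul_assoc]
        refine mul_le_mul_of_nonneg_left ?_ h7
        nlinarith [mul_nonneg (Nat.cast_nonneg (α := ℝ) i) (mul_nonneg hu0 hu0)]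
      have h9 := le_of_mul_le_mul_right h8 (by linarith : 0 < 1 + u)
      rw [← add_assoc]
      push_cast
      linarith
  refine le_trans ?_ (key j le_rfl)
  have : j * (V / x ^ 2) ≤ 1 / 2 := by
    rw [← mul_div_assoc, div_le_iff₀ hx2]; linarith
  nlinarith [sq_nonneg (wcoef x K)]

/-- A linear function on `4r` consecutive integers stays at least half as large as at the origin
on the first or on the last quarter. -/
lemma exists_finset_half_le (l σ : ℝ) (r : ℕ) :
    ∃ g : Finset ℕ, r ≤ g.card ∧ (∀ j ∈ g, 1 ≤ j ∧ j ≤ 4 * r) ∧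
      ∀ j ∈ g, |l| / 2 ≤ |l + j * σ| := by
  rcases le_or_gt (r * |σ|) (|l| / 2) with h | h
  · refine ⟨Finset.Icc 1 r, by simp, fun j hj => ?_, fun j hj => ?_⟩
    · simp at hj; omega
    · have hj := (Finset.mem_Icc.1 hj).2
      have h1 : |(j : ℝ) * σ| ≤ |l| / 2 := by
        rw [abs_mul, Nat.abs_cast]
        refine le_trans ?_ h
        gcongr
      have h2 : |l| ≤ |l + j * σ| + |(j : ℝ) * σ| := by
        simpa using abs_sub (l + j * σ) (j * σ)
      linarith
  · refine ⟨Finset.Icc (3 * r + 1) (4 * r), by simp; omega, fun j hj => ?_, fun j hj => ?_⟩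
    · simp at hj; omega
    · have hj : 3 * r ≤ j := by have := (Finset.mem_Icc.1 hj).1; omega
      have hj' : (3 : ℝ) * r ≤ j := by exact_mod_cast hj
      have h1 : 3 * (|l| / 2) ≤ |(j : ℝ) * σ| := by
        rw [abs_mul, Nat.abs_cast]
        calc 3 * (|l| / 2) ≤ 3 * (r * |σ|) := by linarith
          _ = 3 * r * |σ| := by ring
          _ ≤ _ := by gcongr
      have h2 : |(j : ℝ) * σ| ≤ |l + j * σ| + |l| := by
        simpa using abs_sub (l + j * σ) l
      linarith

/-- If the step values exceed `θ` at all, then just beyond the last index where they do so there are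
many indices at which they lie between `θ / 4` and `θ`. -/
lemma exists_finset_moderate {x B θ p q : ℝ} {r n ι k₁ : ℕ} (hx : 1 ≤ x) (hB : 0 ≤ B)
    (hfar : ∀ k, B ≤ |dev x k| → |stepVal x p q k| ≤ θ)
    (hr : 2 * ((4 * r : ℕ) * (B * x + (4 * r : ℕ))) ≤ x ^ 2)
    (hn : x ^ 2 + B * x + (4 * r : ℕ) ≤ n) (hk₁ : k₁ ∈ Finset.Icc ι n)
    (hbig : θ < |stepVal x p q k₁|) :
    ∃ g ⊆ Finset.Icc ι n, r ≤ g.card ∧ ∀ k ∈ g, |dev x k| ≤ B + (4 * r : ℕ) / x ∧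
      θ / 4 ≤ |stepVal x p q k| ∧ |stepVal x p q k| ≤ θ := by
  classical
  have hx0 : 0 < x := by linarith
  -- `K` is the last index with a step value above `θ`; all later values are at most `θ`.
  set S := (Finset.Icc ι n).filter fun k => θ < |stepVal x p q k| with hS
  have hne : S.Nonempty := ⟨k₁, Finset.mem_filter.2 ⟨hk₁, hbig⟩⟩
  set K := S.max' hne with hK
  obtain ⟨hKm, hKbig⟩ := Finset.mem_filter.1 (S.max'_mem hne)
  rw [← hK] at hKm hKbig
  have hKdev : |dev x K| < B := by
    by_contra hc
    push Not at hc
    exact absurd (hfar K hc) (not_le.2 hKbig)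
  have hKle : (K : ℝ) ≤ x ^ 2 + B * x := by
    have h1 := (abs_lt.1 hKdev).2
    have h2 : (K : ℝ) / x < B + x := by rw [dev] at h1; linarith
    rw [div_lt_iff₀ hx0] at h2
    nlinarith
  obtain ⟨g, hg1, hg2, hg3⟩ := exists_finset_half_le (p + q * dev x K) (q / x) r
  have hmem : ∀ j ∈ g, K + j ∈ Finset.Icc ι n := by
    intro j hj
    have h1 := (Finset.mem_Icc.1 hKm).1
    have h2 := (hg2 j hj).2
    have h2' : (j : ℝ) ≤ (4 * r : ℕ) := by exact_mod_cast h2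
    refine Finset.mem_Icc.2 ⟨by omega, ?_⟩
    have : ((K + j : ℕ) : ℝ) ≤ n := by push_cast at h2' hn ⊢; linarith
    exact_mod_cast this
  refine ⟨g.image fun j => K + j, ?_, ?_, ?_⟩
  · intro k hk
    obtain ⟨j, hj, rfl⟩ := Finset.mem_image.1 hk
    exact hmem j hj
  · rwa [Finset.card_image_of_injective _ (add_right_injective K)]
  · intro k hk
    obtain ⟨j, hj, rfl⟩ := Finset.mem_image.1 hk
    have hj2 : (j : ℝ) ≤ (4 * r : ℕ) := by exact_mod_cast (hg2 j hj).2
    have hdev : dev x (K + j) = dev x K + j / x := by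
      rw [dev, dev]; push_cast; ring
    refine ⟨?_, ?_, ?_⟩
    · rw [hdev]
      refine (abs_add_le _ _).trans ?_
      have : |(j : ℝ) / x| ≤ (4 * r : ℕ) / x := by
        rw [abs_of_nonneg (by positivity)]; gcongr
      linarith
    · have h1 := wcoef_sq_add_ge hx0 (V := B * x + (4 * r : ℕ)) (by positivity) K j
        (by linarith) (by
          refine le_trans ?_ hr
          gcongr)
      have h2 : wcoef x K / 2 ≤ wcoef x (K + j) := by
        have h0 := wcoef_pos hx0 K
        refine (sq_le_sq₀ (by positivity) (wcoef_pos hx0 _).le).1 ?_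
        rw [div_pow]; linarith [sq_nonneg (wcoef x K)]
      have h3 := hg3 j hj
      have e : p + q * dev x (K + j) = p + q * dev x K + j * (q / x) := by rw [hdev]; ring
      rw [stepVal, e, abs_mul, abs_of_pos (wcoef_pos hx0 _)]
      rw [stepVal, abs_mul, abs_of_pos (wcoef_pos hx0 _)] at hKbig
      calc θ / 4 ≤ wcoef x K * |p + q * dev x K| / 4 := by linarith
        _ = (wcoef x K / 2) * (|p + q * dev x K| / 2) := by ring
        _ ≤ _ := by
            have := wcoef_pos hx0 K
            have := wcoef_pos hx0 (K + j)
            gcongr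
    · by_contra hc
      push Not at hc
      have := S.le_max' (K + j) (Finset.mem_filter.2 ⟨hmem j hj, hc⟩)
      have := (hg2 j hj).1
      omega

/-! ### The step vectors form an almost tight frame -/

/-- The step vectors `ω k`, `k ∈ s`, form an almost tight frame of many small vectors: their
covariance is the identity up to `A / N²`, and their fourth and sixth moments have the size expected
of `N` vectors of length `N^{-1/2}`. -/
structure IsFrame {d : ℕ} (A N : ℝ) (s : Finset ℕ) (ω : ℕ → Fin d → ℝ) : Prop where
  sq : ∀ t, |∑ k ∈ s, (t ⬝ᵥ ω k) ^ 2 - nsq t| ≤ A / N ^ 2 * nsq t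
  four : ∀ t, ∑ k ∈ s, (t ⬝ᵥ ω k) ^ 4 ≤ A / N * nsq t ^ 2
  six : ∀ t, ∑ k ∈ s, (t ⬝ᵥ ω k) ^ 6 ≤ A / N ^ 2 * nsq t ^ 3

/-- The values `t ⬝ᵥ ω k` of size at most `η` carry a large sum of squares, for all frequencies `t`
with `1 + |t|²` between `N ^ (1 / 64)` and `N ^ D`. -/
def IsSpread {d : ℕ} (D η N : ℝ) (s : Finset ℕ) (ω : ℕ → Fin d → ℝ) : Prop :=
  ∀ t : Fin d → ℝ, N ^ (1 / 64 : ℝ) ≤ 1 + nsq t → 1 + nsq t ≤ N ^ D →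
    N ^ (1 / 100 : ℝ) ≤ ∑ k ∈ s.filter (fun k => |t ⬝ᵥ ω k| ≤ η), (t ⬝ᵥ ω k) ^ 2

/-- The step vectors `(b_k(x), b_k'(x)) / √N`. -/
noncomputable def uvec (x : ℝ) (k : ℕ) : Fin 2 → ℝ := ![wcoef x k, wcoef x k * dev x k]

/-- The step vectors `(b_k(x), b_k'(x), b_k(y), b_k'(y)) / √N`. -/
noncomputable def vvec (x y : ℝ) (k : ℕ) : Fin 4 → ℝ :=
  ![wcoef x k, wcoef x k * dev x k, wcoef y k, wcoef y k * dev y k]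

lemma dotProduct_uvec (t : Fin 2 → ℝ) (x : ℝ) (k : ℕ) :
    t ⬝ᵥ uvec x k = stepVal x (t 0) (t 1) k := by
  simp [dotProduct, uvec, stepVal, Fin.sum_univ_two]; ring

lemma dotProduct_vvec (t : Fin 4 → ℝ) (x y : ℝ) (k : ℕ) :
    t ⬝ᵥ vvec x y k = stepVal x (t 0) (t 1) k + stepVal y (t 2) (t 3) k := by
  simp [dotProduct, vvec, stepVal, Fin.sum_univ_four]; ring

lemma nsq_two (t : Fin 2 → ℝ) : nsq t = t 0 ^ 2 + t 1 ^ 2 := by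
  simp [nsq, Fin.sum_univ_two]

lemma nsq_four (t : Fin 4 → ℝ) : nsq t = (t 0 ^ 2 + t 1 ^ 2) + (t 2 ^ 2 + t 3 ^ 2) := by
  simp [nsq, Fin.sum_univ_four]; ring

/-- Indices outside the range of summation are far from the window of `x`. -/
lemma le_abs_dev_of_notMem {c₁ c₂ N x : ℝ} {ι n : ℕ} (hN : 0 < N) (hc₁ : 0 < c₁) (hι : ι ≤ 1)
    (hn : c₂ * N ≤ Real.sqrt n - N) (hx : x ∈ Set.Icc (c₁ * N) (c₂ * N)) (k : ℕ)
    (hk : k ∉ Finset.Icc ι n) : min c₁ 1 * N ≤ |dev x k| := by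
  have hx0 : 0 < x := lt_of_lt_of_le (by positivity) hx.1
  rw [Finset.mem_Icc, not_and_or, not_le, not_le] at hk
  rcases hk with hk | hk
  · have hk0 : k = 0 := by omega
    rw [hk0, dev]
    simp only [Nat.cast_zero, zero_div, zero_sub, abs_neg]
    rw [abs_of_pos hx0]
    refine le_trans ?_ hx.1
    gcongr; exact min_le_left _ _
  · have h1 : x + N ≤ Real.sqrt n := by linarith [hx.2]
    have h2 : (x + N) ^ 2 ≤ n := by
      rw [← Real.sq_sqrt (Nat.cast_nonneg n)]; gcongr
    have h3 : (n : ℝ) ≤ k := by exact_mod_cast hk.le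
    have h4 : x + N ≤ k / x := by
      rw [le_div_iff₀ hx0]; nlinarith
    rw [dev]
    refine le_trans ?_ (le_abs_self _)
    have : min c₁ 1 * N ≤ 1 * N := by gcongr; exact min_le_right _ _
    linarith

/-- The range of summation extends beyond the window of `x`. -/
lemma le_cast_of_le_sqrt {c₂ N x : ℝ} {n : ℕ} (hN : 0 < N) (hx0 : 0 < x)
    (hn : c₂ * N ≤ Real.sqrt n - N) (hx : x ≤ c₂ * N) : x ^ 2 + 2 * N * x ≤ n := by
  have h1 : x + N ≤ Real.sqrt n := by linarith
  have h2 : (x + N) ^ 2 ≤ n := by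
    rw [← Real.sq_sqrt (Nat.cast_nonneg n)]; gcongr
  nlinarith [sq_nonneg N]

/-- The windows of two separated points are disjoint. -/
lemma le_abs_dev_or_of_separated {c₁ c₂ N x y r : ℝ} (hN : 0 < N) (hc₁ : 0 < c₁)
    (hx : x ∈ Set.Icc (c₁ * N) (c₂ * N)) (hy : y ∈ Set.Icc (c₁ * N) (c₂ * N))
    (hxy : r ≤ |x - y|) (hr : 0 ≤ r) (k : ℕ) :
    c₁ / c₂ * r ≤ |dev x k| ∨ c₁ / c₂ * r ≤ |dev y k| := by
  have hx0 : 0 < x := lt_of_lt_of_le (by positivity) hx.1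
  have hy0 : 0 < y := lt_of_lt_of_le (by positivity) hy.1
  have hcN : 0 < c₂ * N := hx0.trans_le hx.2
  have hc₂ : 0 < c₂ := pos_of_mul_pos_left hcN hN.le
  by_contra hc
  push Not at hc
  have e1 : x * dev x k = k - x ^ 2 := by rw [dev]; field_simp
  have e2 : y * dev y k = k - y ^ 2 := by rw [dev]; field_simp
  have h1 : |x * dev x k| < c₁ * N * r := by
    rw [abs_mul, abs_of_pos hx0]
    calc x * |dev x k| < x * (c₁ / c₂ * r) := by gcongr; exact hc.1
      _ ≤ (c₂ * N) * (c₁ / c₂ * r) := by gcongr; exact hx.2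
      _ = _ := by field_simp
  have h2 : |y * dev y k| < c₁ * N * r := by
    rw [abs_mul, abs_of_pos hy0]
    calc y * |dev y k| < y * (c₁ / c₂ * r) := by gcongr; exact hc.2
      _ ≤ (c₂ * N) * (c₁ / c₂ * r) := by gcongr; exact hy.2
      _ = _ := by field_simp
  have h3 : |y * dev y k - x * dev x k| = |x - y| * (x + y) := by
    have e3 : y * dev y k - x * dev x k = (x - y) * (x + y) := by rw [e1, e2]; ring
    rw [e3, abs_mul, abs_of_pos (by linarith : 0 < x + y)]
  have h4 := abs_sub (y * dev y k) (x * dev x k)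
  rw [h3] at h4
  have h5 : r * (2 * (c₁ * N)) ≤ |x - y| * (x + y) := by
    gcongr; linarith [hx.1, hy.1]
  linarith

/-- The squared weights are Poisson masses and `dev` is the standardized variable, so the covariance
of the full sequence of steps is exactly the identity; truncation costs a Poisson tail. The higher
power sums are small since each mass is `O(1 / N)`. -/
lemma isFrame_uvec {c₁ c₂ : ℝ} (hc₁ : 0 < c₁) :
    ∃ A : ℝ, 1 ≤ A ∧ ∀ᶠ N : ℝ in atTop, ∀ (ι n : ℕ) (x : ℝ), ι ≤ 1 → c₂ * N ≤ Real.sqrt n - N →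
      x ∈ Set.Icc (c₁ * N) (c₂ * N) → IsFrame A N (Finset.Icc ι n) (uvec x) := by
  refine ⟨1 + 3264 / c₁ + 783360 / c₁ ^ 2, ?_, ?_⟩
  · have : 0 ≤ 3264 / c₁ + 783360 / c₁ ^ 2 := by positivity
    linarith
  have hc : 0 < min c₁ 1 / 2 := by positivity
  filter_upwards [eventually_ge_atTop (max 1 (1 / c₁)),
    eventually_mul_rpow_mul_exp_le 80 2 one_pos hc one_pos] with N hN1 hN2 ι n x hι hn hx
  have hN : 1 ≤ N := (le_max_left _ _).trans hN1
  have hN0 : 0 < N := by linarith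
  have hx1 : 1 ≤ x := by
    have : 1 / c₁ ≤ N := (le_max_right _ _).trans hN1
    rw [div_le_iff₀ hc₁] at this
    linarith [hx.1]
  have hfrac : (0 : ℝ) ≤ 3264 / c₁ := by positivity
  have hfrac' : (0 : ℝ) ≤ 783360 / c₁ ^ 2 := by positivity
  refine ⟨fun t => ?_, fun t => ?_, fun t => ?_⟩
  · simp_rw [dotProduct_uvec]
    rw [nsq_two]
    refine (abs_sum_stepVal_sq_sub_le hx1 (t 0) (t 1) _
      (le_abs_dev_of_notMem hN0 hc₁ hι hn hx)).trans ?_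
    refine mul_le_mul_of_nonneg_right ?_ (by positivity)
    rw [Real.rpow_one, Real.rpow_ofNat] at hN2
    rw [le_div_iff₀ (by positivity)]
    have e : -(min c₁ 1 * N) / 2 = -(min c₁ 1 / 2 * N) := by ring
    rw [e]
    linarith
  · simp_rw [dotProduct_uvec]
    rw [nsq_two]
    refine (sum_stepVal_pow_four_le hx1 (t 0) (t 1) _).trans ?_
    refine mul_le_mul_of_nonneg_right ?_ (by positivity)
    calc 3264 / x ≤ 3264 / (c₁ * N) := by gcongr; exact hx.1
      _ = (3264 / c₁) / N := by rw [div_div]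
      _ ≤ _ := by gcongr; linarith
  · simp_rw [dotProduct_uvec]
    rw [nsq_two]
    refine (sum_stepVal_pow_six_le hx1 (t 0) (t 1) _).trans ?_
    refine mul_le_mul_of_nonneg_right ?_ (by positivity)
    calc 783360 / x ^ 2 ≤ 783360 / (c₁ * N) ^ 2 := by gcongr; exact hx.1
      _ = (783360 / c₁ ^ 2) / N ^ 2 := by rw [div_div, mul_pow]
      _ ≤ _ := by gcongr; linarith

lemma add_pow_four_le (a b : ℝ) : (a + b) ^ 4 ≤ 8 * (a ^ 4 + b ^ 4) := by
  nlinarith [sq_nonneg (a - b), sq_nonneg (a + b), sq_nonneg (a ^ 2 - b ^ 2),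
    mul_nonneg (sq_nonneg (a - b)) (sq_nonneg (a + b)),
    mul_nonneg (sq_nonneg (a - b)) (sq_nonneg (a - b)), sq_nonneg (a * b), sq_nonneg (a ^ 2 + b ^ 2)]

lemma add_pow_six_le (a b : ℝ) : (a + b) ^ 6 ≤ 32 * (a ^ 6 + b ^ 6) := by
  have h1 : (a + b) ^ 2 ≤ 2 * (a ^ 2 + b ^ 2) := by nlinarith [sq_nonneg (a - b)]
  have h2 : (a ^ 2 + b ^ 2) ^ 3 ≤ 4 * (a ^ 6 + b ^ 6) := by
    nlinarith [mul_nonneg (add_nonneg (sq_nonneg a) (sq_nonneg b)) (sq_nonneg (a ^ 2 - b ^ 2))]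
  calc (a + b) ^ 6 = ((a + b) ^ 2) ^ 3 := by ring
    _ ≤ (2 * (a ^ 2 + b ^ 2)) ^ 3 := by gcongr
    _ = 8 * (a ^ 2 + b ^ 2) ^ 3 := by ring
    _ ≤ _ := by linarith

/-- The two halves of the step vectors at separated points hardly interact, as the Poisson weights
have disjoint windows. -/
lemma isFrame_vvec {c₁ c₂ ε : ℝ} (hc₁ : 0 < c₁) (hc₂ : c₁ < c₂) (hε : 0 < ε) :
    ∃ A : ℝ, 1 ≤ A ∧ ∀ᶠ N : ℝ in atTop, ∀ (ι n : ℕ) (x y : ℝ), ι ≤ 1 →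
      c₂ * N ≤ Real.sqrt n - N → x ∈ Set.Icc (c₁ * N) (c₂ * N) → y ∈ Set.Icc (c₁ * N) (c₂ * N) →
      N ^ ε ≤ |x - y| → IsFrame A N (Finset.Icc ι n) (vvec x y) := by
  obtain ⟨A, hA, hev⟩ := isFrame_uvec (c₂ := c₂) hc₁
  refine ⟨32 * A + 1, by linarith, ?_⟩
  have hc : 0 < c₁ / c₂ / 4 := by have := hc₁.trans hc₂; positivity
  filter_upwards [hev, eventually_ge_atTop (max 1 (1 / c₁)),
    eventually_mul_rpow_mul_exp_le 160 2 hε hc one_pos] with N hframe hN1 hN2 ι n x y hι hn hx hy hxy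
  have hN : 1 ≤ N := (le_max_left _ _).trans hN1
  have hN0 : 0 < N := by linarith
  have h1c : 1 ≤ c₁ * N := by
    have : 1 / c₁ ≤ N := (le_max_right _ _).trans hN1
    rw [div_le_iff₀ hc₁] at this
    linarith
  have hfx := hframe ι n x hι hn hx
  have hfy := hframe ι n y hι hn hy
  have tx : ∀ t : Fin 4 → ℝ, ∀ k, stepVal x (t 0) (t 1) k = ![t 0, t 1] ⬝ᵥ uvec x k := fun t k => by
    rw [dotProduct_uvec]; rfl
  have ty : ∀ t : Fin 4 → ℝ, ∀ k, stepVal y (t 2) (t 3) k = ![t 2, t 3] ⬝ᵥ uvec y k := fun t k => by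
    rw [dotProduct_uvec]; rfl
  have nt : ∀ t : Fin 4 → ℝ, nsq t = nsq ![t 0, t 1] + nsq ![t 2, t 3] := fun t => by
    rw [nsq_two, nsq_two, nsq_four]; rfl
  refine ⟨fun t => ?_, fun t => ?_, fun t => ?_⟩
  · have h1 := hfx.sq ![t 0, t 1]
    have h2 := hfy.sq ![t 2, t 3]
    have h3 := abs_sum_stepVal_mul_stepVal_le (h1c.trans hx.1) (h1c.trans hy.1) (t 0) (t 1) (t 2)
      (t 3) (Finset.Icc ι n)
      (le_abs_dev_or_of_separated hN0 hc₁ hx hy hxy (by positivity))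
    rw [← nsq_four] at h3
    simp_rw [dotProduct_vvec]
    have e : ∑ k ∈ Finset.Icc ι n, (stepVal x (t 0) (t 1) k + stepVal y (t 2) (t 3) k) ^ 2 - nsq t
        = (∑ k ∈ Finset.Icc ι n, (![t 0, t 1] ⬝ᵥ uvec x k) ^ 2 - nsq ![t 0, t 1])
          + (∑ k ∈ Finset.Icc ι n, (![t 2, t 3] ⬝ᵥ uvec y k) ^ 2 - nsq ![t 2, t 3])
          + 2 * ∑ k ∈ Finset.Icc ι n, stepVal x (t 0) (t 1) k * stepVal y (t 2) (t 3) k := by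
      simp_rw [← tx, ← ty, nt, add_sq, Finset.sum_add_distrib, Finset.mul_sum]
      simp_rw [mul_assoc]
      ring
    rw [e]
    refine (abs_add_three _ _ _).trans ?_
    rw [abs_mul, abs_two]
    have h4 : 160 * Real.exp (-(c₁ / c₂ * N ^ ε) / 4) ≤ 1 / N ^ 2 := by
      rw [Real.rpow_ofNat] at hN2
      rw [le_div_iff₀ (by positivity)]
      have e : -(c₁ / c₂ * N ^ ε) / 4 = -(c₁ / c₂ / 4 * N ^ ε) := by ring
      rw [e]; linarith
    have h5 := mul_le_mul_of_nonneg_right h4 (nsq_nonneg t)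
    have h6 : 0 ≤ A / N ^ 2 * nsq t := mul_nonneg (by positivity) (nsq_nonneg t)
    calc _ ≤ A / N ^ 2 * nsq ![t 0, t 1] + A / N ^ 2 * nsq ![t 2, t 3] + 1 / N ^ 2 * nsq t := by
          linarith
      _ = A / N ^ 2 * nsq t + 1 / N ^ 2 * nsq t := by rw [nt t]; ring
      _ ≤ 32 * (A / N ^ 2 * nsq t) + 1 / N ^ 2 * nsq t := by linarith
      _ = _ := by ring
  · have h1 := hfx.four ![t 0, t 1]
    have h2 := hfy.four ![t 2, t 3]
    simp_rw [dotProduct_vvec]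
    have h3 : ∑ k ∈ Finset.Icc ι n, (stepVal x (t 0) (t 1) k + stepVal y (t 2) (t 3) k) ^ 4
        ≤ ∑ k ∈ Finset.Icc ι n, 8 * ((![t 0, t 1] ⬝ᵥ uvec x k) ^ 4
          + (![t 2, t 3] ⬝ᵥ uvec y k) ^ 4) :=
      Finset.sum_le_sum fun k _ => by rw [tx, ty]; exact add_pow_four_le _ _
    rw [← Finset.mul_sum, Finset.sum_add_distrib] at h3
    refine h3.trans ?_
    have h4 : nsq ![t 0, t 1] ^ 2 + nsq ![t 2, t 3] ^ 2 ≤ nsq t ^ 2 := by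
      rw [nt t]; nlinarith [nsq_nonneg ![t 0, t 1], nsq_nonneg ![t 2, t 3]]
    have h5 : 0 ≤ A / N := by positivity
    calc _ ≤ 8 * (A / N * nsq ![t 0, t 1] ^ 2 + A / N * nsq ![t 2, t 3] ^ 2) := by linarith
      _ = 8 * (A / N) * (nsq ![t 0, t 1] ^ 2 + nsq ![t 2, t 3] ^ 2) := by ring
      _ ≤ 8 * (A / N) * nsq t ^ 2 := by gcongr
      _ ≤ (32 * A + 1) / N * nsq t ^ 2 := by
          gcongr
          rw [← mul_div_assoc]
          gcongr; linarith
  · have h1 := hfx.six ![t 0, t 1]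
    have h2 := hfy.six ![t 2, t 3]
    simp_rw [dotProduct_vvec]
    have h3 : ∑ k ∈ Finset.Icc ι n, (stepVal x (t 0) (t 1) k + stepVal y (t 2) (t 3) k) ^ 6
        ≤ ∑ k ∈ Finset.Icc ι n, 32 * ((![t 0, t 1] ⬝ᵥ uvec x k) ^ 6
          + (![t 2, t 3] ⬝ᵥ uvec y k) ^ 6) :=
      Finset.sum_le_sum fun k _ => by rw [tx, ty]; exact add_pow_six_le _ _
    rw [← Finset.mul_sum, Finset.sum_add_distrib] at h3
    refine h3.trans ?_
    have h4 : nsq ![t 0, t 1] ^ 3 + nsq ![t 2, t 3] ^ 3 ≤ nsq t ^ 3 := by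
      rw [nt t]
      have ha := nsq_nonneg ![t 0, t 1]
      have hb := nsq_nonneg ![t 2, t 3]
      nlinarith [mul_nonneg ha hb, mul_nonneg (mul_nonneg ha hb) (add_nonneg ha hb)]
    have h5 : 0 ≤ A / N ^ 2 := by positivity
    calc _ ≤ 32 * (A / N ^ 2 * nsq ![t 0, t 1] ^ 3 + A / N ^ 2 * nsq ![t 2, t 3] ^ 3) := by linarith
      _ = 32 * (A / N ^ 2) * (nsq ![t 0, t 1] ^ 3 + nsq ![t 2, t 3] ^ 3) := by ring
      _ ≤ 32 * (A / N ^ 2) * nsq t ^ 3 := by gcongr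
      _ ≤ (32 * A + 1) / N ^ 2 * nsq t ^ 3 := by
          have := nsq_nonneg t
          gcongr
          rw [← mul_div_assoc]
          gcongr; linarith

/-! ### Spreading of the step values -/

lemma sqrt_le_rpow_half {a N D : ℝ} (hN : 0 < N) (h : a ≤ N ^ D) :
    Real.sqrt a ≤ N ^ (D / 2) := by
  refine (Real.sqrt_le_sqrt h).trans_eq ?_
  rw [Real.sqrt_eq_rpow, ← Real.rpow_mul hN.le]
  congr 1; ring

/-- A single step value above `θ` forces `√N` indices near the window of `x` with step values between
`θ / 4` and `θ`. -/
lemma eventually_exists_finset_moderate {c₁ c₂ ε θ : ℝ} (D : ℝ) (hc₁ : 0 < c₁) (hε : 0 < ε)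
    (hε' : ε < 1 / 2) (hθ : 0 < θ) :
    ∀ᶠ N : ℝ in atTop, ∀ (ι n k₁ : ℕ) (x p q : ℝ), c₂ * N ≤ Real.sqrt n - N →
      x ∈ Set.Icc (c₁ * N) (c₂ * N) → p ^ 2 + q ^ 2 ≤ N ^ D → k₁ ∈ Finset.Icc ι n →
      θ < |stepVal x p q k₁| →
      ∃ g ⊆ Finset.Icc ι n, N ^ (1 / 2 : ℝ) ≤ g.card ∧ ∀ k ∈ g, |dev x k| ≤ 2 * N ^ ε ∧
        θ / 4 ≤ |stepVal x p q k| ∧ |stepVal x p q k| ≤ θ := by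
  filter_upwards [eventually_ge_atTop (max 1 (1 / c₁)),
    eventually_mul_rpow_mul_exp_le 9 (D / 2) hε (by norm_num : (0 : ℝ) < 1 / 4) hθ,
    eventually_mul_rpow_le (32 * c₂ / c₁ ^ 2) (by linarith : 3 / 2 + ε < 2),
    eventually_mul_rpow_le (256 / c₁ ^ 2) (by norm_num : (1 : ℝ) < 2),
    eventually_mul_rpow_le (8 / c₁) (by norm_num : (1 / 2 : ℝ) < 1),
    eventually_mul_rpow_le 8 (by norm_num : (1 / 2 : ℝ) < 1)]
    with N hN1 hfar h32 h256 h8c h8 ι n k₁ x p q hn hx hpq hk₁ hbig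
  have hN : 1 ≤ N := (le_max_left _ _).trans hN1
  have hN0 : 0 < N := by linarith
  have hx1 : 1 ≤ x := by
    have : 1 / c₁ ≤ N := (le_max_right _ _).trans hN1
    rw [div_le_iff₀ hc₁] at this
    linarith [hx.1]
  have hx0 : 0 < x := by linarith
  -- blocks of `4 √N` indices are short against the scale `N / N ^ ε` on which the weights vary
  set r : ℕ := ⌈N ^ (1 / 2 : ℝ)⌉₊ with hr
  have hh1 : 1 ≤ N ^ (1 / 2 : ℝ) := Real.one_le_rpow hN (by norm_num)
  have hr1 : N ^ (1 / 2 : ℝ) ≤ r := Nat.le_ceil _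
  have hr2 : (r : ℝ) ≤ 2 * N ^ (1 / 2 : ℝ) := by
    have := Nat.ceil_lt_add_one (by linarith : 0 ≤ N ^ (1 / 2 : ℝ))
    linarith
  have h4r : ((4 * r : ℕ) : ℝ) ≤ 8 * N ^ (1 / 2 : ℝ) := by push_cast; linarith
  rw [Real.rpow_one] at h8c h8 h256
  rw [Real.rpow_ofNat] at h32 h256
  have hB : N ^ ε ≤ N := by
    simpa using Real.rpow_le_rpow_of_exponent_le hN (by linarith : ε ≤ 1)
  have hB0 : 0 ≤ N ^ ε := by positivity
  obtain ⟨g, hg, hgc, hgk⟩ := exists_finset_moderate (r := r) (B := N ^ ε) (θ := θ) hx1 hB0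
    (fun k hk => by
      refine (abs_stepVal_le hx1 p q k).trans (le_trans ?_ hfar)
      have h1 := sqrt_le_rpow_half hN0 hpq
      have h2 : Real.exp (-|dev x k| / 4) ≤ Real.exp (-(1 / 4 * N ^ ε)) := by
        rw [Real.exp_le_exp]; linarith
      gcongr)
    (by
      have e : N ^ (3 / 2 + ε) = N ^ (1 / 2 : ℝ) * (N ^ ε * N) := by
        rw [← Real.rpow_add_one hN0.ne', ← Real.rpow_add hN0]; congr 1; ring
      have e2 : N ^ (1 / 2 : ℝ) * N ^ (1 / 2 : ℝ) = N := by
        rw [← Real.rpow_add hN0]; norm_num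
      rw [e, div_mul_eq_mul_div, div_le_iff₀ (by positivity)] at h32
      rw [div_mul_eq_mul_div, div_le_iff₀ (by positivity)] at h256
      calc _ ≤ 2 * (8 * N ^ (1 / 2 : ℝ) * (N ^ ε * (c₂ * N) + 8 * N ^ (1 / 2 : ℝ))) := by
            gcongr; exact hx.2
        _ = (32 * c₂ * (N ^ (1 / 2 : ℝ) * (N ^ ε * N))) / 2
            + 128 * (N ^ (1 / 2 : ℝ) * N ^ (1 / 2 : ℝ)) := by ring
        _ ≤ (c₁ * N) ^ 2 := by rw [e2, mul_pow]; linarith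
        _ ≤ x ^ 2 := by gcongr; exact hx.1)
    (by
      have h1 := le_cast_of_le_sqrt hN0 hx0 hn hx.2
      have h2 : N ^ ε * x ≤ N * x := by gcongr
      have h3 : N * 1 ≤ N * x := by gcongr
      linarith)
    hk₁ hbig
  refine ⟨g, hg, hr1.trans (by exact_mod_cast hgc), fun k hk => ⟨?_, (hgk k hk).2⟩⟩
  refine (hgk k hk).1.trans ?_
  have h1 : ((4 * r : ℕ) : ℝ) / x ≤ 1 := by
    rw [div_le_one hx0]
    rw [div_mul_eq_mul_div, div_le_iff₀ hc₁] at h8c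
    linarith [hx.1]
  have h2 : 1 ≤ N ^ ε := Real.one_le_rpow hN hε.le
  linarith

lemma one_half_nsq_le_sum {d : ℕ} {A N : ℝ} {s : Finset ℕ} {ω : ℕ → Fin d → ℝ}
    (h : IsFrame A N s ω) (hN : 0 < N) (hA : 2 * A ≤ N ^ 2) (t : Fin d → ℝ) :
    nsq t / 2 ≤ ∑ k ∈ s, (t ⬝ᵥ ω k) ^ 2 := by
  have h1 := (abs_le.1 (h.sq t)).1
  have h2 : A / N ^ 2 ≤ 1 / 2 := by rw [div_le_iff₀ (by positivity)]; linarith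
  have h3 := mul_le_mul_of_nonneg_right h2 (nsq_nonneg t)
  linarith

lemma eventually_isSpread_aux {η A : ℝ} (hη : 0 < η) :
    ∀ᶠ N : ℝ in atTop, 1 ≤ N ∧ 2 * A ≤ N ^ 2 ∧
      N ^ (1 / 100 : ℝ) ≤ (N ^ (1 / 64 : ℝ) - 1) / 2 ∧
      N ^ (1 / 100 : ℝ) ≤ N ^ (1 / 2 : ℝ) * (η / 16) ^ 2 := by
  filter_upwards [eventually_ge_atTop 1, eventually_mul_rpow_le (2 * A) (by norm_num : (0 : ℝ) < 2),
    eventually_mul_rpow_le 3 (by norm_num : (1 / 100 : ℝ) < 1 / 64),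
    eventually_mul_rpow_le ((η / 16) ^ 2)⁻¹ (by norm_num : (1 / 100 : ℝ) < 1 / 2)]
    with N h1 h2 h3 h4
  refine ⟨h1, ?_, ?_, ?_⟩
  · simpa using h2
  · have := Real.one_le_rpow h1 (by norm_num : (0 : ℝ) ≤ 1 / 100)
    linarith
  · rwa [inv_mul_le_iff₀ (by positivity), mul_comm] at h4

lemma le_sum_filter_sq {g s : Finset ℕ} (hgs : g ⊆ s) {f : ℕ → ℝ} {η ϑ m : ℝ} (hϑ : 0 ≤ ϑ)
    (hm : m ≤ g.card) (hg : ∀ k ∈ g, ϑ ≤ |f k| ∧ |f k| ≤ η) :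
    m * ϑ ^ 2 ≤ ∑ k ∈ s.filter (fun k => |f k| ≤ η), f k ^ 2 := by
  calc m * ϑ ^ 2 ≤ g.card * ϑ ^ 2 := by gcongr
    _ = ∑ k ∈ g, ϑ ^ 2 := by simp
    _ ≤ ∑ k ∈ g, f k ^ 2 := Finset.sum_le_sum fun k hk => by
        rw [← sq_abs (f k)]
        exact pow_le_pow_left₀ hϑ (hg k hk).1 2
    _ ≤ _ := Finset.sum_le_sum_of_subset_of_nonneg
        (fun k hk => Finset.mem_filter.2 ⟨hgs hk, (hg k hk).2⟩) fun _ _ _ => sq_nonneg _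

/-- Either all step values are at most `η`, and their squares sum to about `|t|²`, or one of them is
larger, and then there are `√N` values of size comparable to `η`. -/
lemma isSpread_uvec {c₁ c₂ η : ℝ} (D : ℝ) (hc₁ : 0 < c₁) (hη : 0 < η) :
    ∀ᶠ N : ℝ in atTop, ∀ (ι n : ℕ) (x : ℝ), ι ≤ 1 → c₂ * N ≤ Real.sqrt n - N →
      x ∈ Set.Icc (c₁ * N) (c₂ * N) → IsSpread D η N (Finset.Icc ι n) (uvec x) := by
  obtain ⟨A, hA, hev⟩ := isFrame_uvec (c₂ := c₂) hc₁
  filter_upwards [hev, eventually_isSpread_aux (A := A) hη,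
    eventually_exists_finset_moderate (c₂ := c₂) D hc₁ (by norm_num : (0 : ℝ) < 1 / 4)
      (by norm_num) hη] with N hframe ⟨hN, hAN, hlow, hmod⟩ hgood ι n x hι hn hx t ht1 ht2
  have hf := hframe ι n x hι hn hx
  by_cases hall : ∀ k ∈ Finset.Icc ι n, |t ⬝ᵥ uvec x k| ≤ η
  · rw [Finset.filter_true_of_mem hall]
    have := one_half_nsq_le_sum hf (by linarith) hAN t
    linarith
  · push Not at hall
    obtain ⟨k₁, hk₁, hbig⟩ := hall
    rw [dotProduct_uvec] at hbig
    have hpq : t 0 ^ 2 + t 1 ^ 2 ≤ N ^ D := by rw [← nsq_two]; linarith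
    obtain ⟨g, hg, hgc, hgk⟩ := hgood ι n k₁ x (t 0) (t 1) hn hx hpq hk₁ hbig
    have := le_sum_filter_sq hg (f := fun k => t ⬝ᵥ uvec x k) (η := η) (ϑ := η / 4)
      (by positivity) hgc fun k hk => by
        rw [dotProduct_uvec]; exact (hgk k hk).2
    refine hmod.trans (le_trans ?_ this)
    gcongr
    norm_num

lemma isSpread_vvec {c₁ c₂ ε η : ℝ} (D : ℝ) (hc₁ : 0 < c₁) (hc₂ : c₁ < c₂) (hε : 0 < ε)
    (hε' : ε < 1 / 2) (hη : 0 < η) :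
    ∀ᶠ N : ℝ in atTop, ∀ (ι n : ℕ) (x y : ℝ), ι ≤ 1 →
      c₂ * N ≤ Real.sqrt n - N → x ∈ Set.Icc (c₁ * N) (c₂ * N) → y ∈ Set.Icc (c₁ * N) (c₂ * N) →
      N ^ ε ≤ |x - y| → IsSpread D η N (Finset.Icc ι n) (vvec x y) := by
  obtain ⟨A, hA, hev⟩ := isFrame_vvec hc₁ hc₂ hε
  have hc₂0 := hc₁.trans hc₂
  have hc : 0 < c₁ / c₂ / 4 := by positivity
  have hη2 : 0 < η / 2 := by positivity
  filter_upwards [hev, eventually_isSpread_aux (A := A) hη, eventually_ge_atTop (1 / c₁),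
    eventually_exists_finset_moderate (c₂ := c₂) D hc₁ (by linarith : (0 : ℝ) < ε / 2)
      (by linarith) hη2,
    eventually_mul_rpow_mul_exp_le 9 (D / 2) hε hc (by positivity : 0 < η / 16),
    eventually_mul_rpow_le (3 / (c₁ / c₂)) (by linarith : ε / 2 < ε)]
    with N hframe ⟨hN, hAN, hlow, hmod⟩ hN1 hgood hsmall hsep ι n x y hι hn hx hy hxy t ht1 ht2
  have hf := hframe ι n x y hι hn hx hy hxy
  have hN0 : 0 < N := by linarith
  have h1c : 1 ≤ c₁ * N := by rw [div_le_iff₀ hc₁] at hN1; linarith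
  have hpq : t 0 ^ 2 + t 1 ^ 2 ≤ N ^ D := by
    have := nsq_four t
    nlinarith [sq_nonneg (t 2), sq_nonneg (t 3)]
  have hpq' : t 2 ^ 2 + t 3 ^ 2 ≤ N ^ D := by
    have := nsq_four t
    nlinarith [sq_nonneg (t 0), sq_nonneg (t 1)]
  -- near the window of one point, the step values at the other point are negligible
  have key : ∀ x y p q p' q' : ℝ, x ∈ Set.Icc (c₁ * N) (c₂ * N) → y ∈ Set.Icc (c₁ * N) (c₂ * N) →
      N ^ ε ≤ |x - y| → p ^ 2 + q ^ 2 ≤ N ^ D → p' ^ 2 + q' ^ 2 ≤ N ^ D →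
      ∀ k₁ ∈ Finset.Icc ι n, η / 2 < |stepVal x p q k₁| →
      ∃ g ⊆ Finset.Icc ι n, N ^ (1 / 2 : ℝ) ≤ g.card ∧ ∀ k ∈ g,
        η / 16 ≤ |stepVal x p q k + stepVal y p' q' k| ∧
        |stepVal x p q k + stepVal y p' q' k| ≤ η := by
    intro x y p q p' q' hx hy hxy h1 h2 k₁ hk₁ hbig
    obtain ⟨g, hg, hgc, hgk⟩ := hgood ι n k₁ x p q hn hx h1 hk₁ hbig
    refine ⟨g, hg, hgc, fun k hk => ?_⟩
    obtain ⟨hdev, hlo, hhi⟩ := hgk k hk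
    have hy' : c₁ / c₂ * N ^ ε ≤ |dev y k| := by
      rcases le_abs_dev_or_of_separated hN0 hc₁ hx hy hxy (by positivity) k with h | h
      · rw [div_mul_eq_mul_div, div_le_iff₀ (by positivity)] at hsep
        have : 0 < N ^ (ε / 2) := by positivity
        linarith
      · exact h
    have hβ : |stepVal y p' q' k| ≤ η / 16 := by
      refine (abs_stepVal_le (h1c.trans hy.1) p' q' k).trans (le_trans ?_ hsmall)
      have h3 := sqrt_le_rpow_half hN0 h2
      have h4 : Real.exp (-|dev y k| / 4) ≤ Real.exp (-(c₁ / c₂ / 4 * N ^ ε)) := by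
        rw [Real.exp_le_exp]; linarith
      gcongr
    constructor
    · have := abs_sub (stepVal x p q k + stepVal y p' q' k) (stepVal y p' q' k)
      rw [add_sub_cancel_right] at this
      linarith
    · refine (abs_add_le _ _).trans ?_
      linarith
  by_cases hall : ∀ k ∈ Finset.Icc ι n, |t ⬝ᵥ vvec x y k| ≤ η
  · rw [Finset.filter_true_of_mem hall]
    have := one_half_nsq_le_sum hf hN0 hAN t
    linarith
  · push Not at hall
    obtain ⟨k₁, hk₁, hbig⟩ := hall
    rw [dotProduct_vvec] at hbig
    have hor : η / 2 < |stepVal x (t 0) (t 1) k₁| ∨ η / 2 < |stepVal y (t 2) (t 3) k₁| := by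
      by_contra hc
      push Not at hc
      have := abs_add_le (stepVal x (t 0) (t 1) k₁) (stepVal y (t 2) (t 3) k₁)
      linarith [hc.1, hc.2]
    have hg : ∃ g ⊆ Finset.Icc ι n, N ^ (1 / 2 : ℝ) ≤ g.card ∧ ∀ k ∈ g,
        η / 16 ≤ |t ⬝ᵥ vvec x y k| ∧ |t ⬝ᵥ vvec x y k| ≤ η := by
      simp_rw [dotProduct_vvec]
      rcases hor with h | h
      · exact key x y (t 0) (t 1) (t 2) (t 3) hx hy hxy hpq hpq' k₁ hk₁ h
      · rw [abs_sub_comm] at hxy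
        simp_rw [add_comm (stepVal x _ _ _)]
        exact key y x (t 2) (t 3) (t 0) (t 1) hy hx hxy hpq' hpq k₁ hk₁ h
    obtain ⟨g, hg, hgc, hgk⟩ := hg
    exact hmod.trans (le_sum_filter_sq hg (by positivity) hgc hgk)

/-! ### Comparison of characteristic functions -/

/-- The Fourier transform of the second order Edgeworth density at a frequency of squared norm `q`
at which the steps take the values `f k`. -/
noncomputable def edgeFT (m₃ m₄ : ℝ) (s : Finset ℕ) (f : ℕ → ℝ) (q : ℝ) : ℝ :=
  Real.exp (-q / 2) * (1 + (m₄ - 3) / 24 * ∑ k ∈ s, f k ^ 4 - m₃ ^ 2 / 72 * (∑ k ∈ s, f k ^ 3) ^ 2)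

/-- Size bounds on the power sums of the step values. -/
structure PowerSums (A N q : ℝ) (s : Finset ℕ) (f : ℕ → ℝ) : Prop where
  q_nonneg : 0 ≤ q
  sq : |∑ k ∈ s, f k ^ 2 - q| ≤ A / N ^ 2 * q
  four : ∑ k ∈ s, f k ^ 4 ≤ A / N * q ^ 2
  six : ∑ k ∈ s, f k ^ 6 ≤ A / N ^ 2 * q ^ 3

lemma IsFrame.powerSums {d : ℕ} {A N : ℝ} {s : Finset ℕ} {ω : ℕ → Fin d → ℝ}
    (h : IsFrame A N s ω) (t : Fin d → ℝ) : PowerSums A N (nsq t) s fun k => t ⬝ᵥ ω k :=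
  ⟨nsq_nonneg t, h.sq t, h.four t, h.six t⟩

namespace PowerSums

variable {A N q : ℝ} {s : Finset ℕ} {f : ℕ → ℝ}

lemma sq_le (h : PowerSums A N q s f) (hN : 1 ≤ N) (hAN : A ≤ N) :
    ∑ k ∈ s, f k ^ 2 ≤ 2 * q := by
  have h1 := (abs_le.1 h.sq).2
  have h2 : A / N ^ 2 ≤ 1 := by
    rw [div_le_one (by positivity)]; nlinarith
  have := mul_le_mul_of_nonneg_right h2 h.q_nonneg
  linarith

/-- Cauchy–Schwarz with the second and fourth power sums. -/
lemma cube_sq_le (h : PowerSums A N q s f) (hN : 1 ≤ N) (hAN : A ≤ N) :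
    (∑ k ∈ s, f k ^ 3) ^ 2 ≤ 2 * A * q ^ 3 / N := by
  have hq := h.q_nonneg
  have h1 := Finset.sum_mul_sq_le_sq_mul_sq s f (fun k => f k ^ 2)
  have h2 : ∑ k ∈ s, f k * f k ^ 2 = ∑ k ∈ s, f k ^ 3 :=
    Finset.sum_congr rfl fun k _ => by ring
  have h3 : ∑ k ∈ s, (f k ^ 2) ^ 2 = ∑ k ∈ s, f k ^ 4 :=
    Finset.sum_congr rfl fun k _ => by ring
  rw [h2, h3] at h1
  have h4 := h.sq_le hN hAN
  have h5 := h.four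
  have h6 : 0 ≤ ∑ k ∈ s, f k ^ 4 := Finset.sum_nonneg fun k _ => by positivity
  calc _ ≤ (2 * q) * (A / N * q ^ 2) := h1.trans (by gcongr)
    _ = _ := by ring

/-- Cauchy–Schwarz with the fourth and sixth power sums. -/
lemma quint_sq_le (h : PowerSums A N q s f) (hN : 1 ≤ N) (hA : 0 ≤ A) :
    (∑ k ∈ s, f k ^ 5) ^ 2 ≤ A ^ 2 * q ^ 5 / N ^ 3 := by
  have hq := h.q_nonneg
  have h1 := Finset.sum_mul_sq_le_sq_mul_sq s (fun k => f k ^ 2) (fun k => f k ^ 3)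
  have h2 : ∑ k ∈ s, f k ^ 2 * f k ^ 3 = ∑ k ∈ s, f k ^ 5 :=
    Finset.sum_congr rfl fun k _ => by ring
  have h3 : ∑ k ∈ s, (f k ^ 2) ^ 2 = ∑ k ∈ s, f k ^ 4 :=
    Finset.sum_congr rfl fun k _ => by ring
  have h3' : ∑ k ∈ s, (f k ^ 3) ^ 2 = ∑ k ∈ s, f k ^ 6 :=
    Finset.sum_congr rfl fun k _ => by ring
  rw [h2, h3, h3'] at h1
  have h4 := h.four
  have h5 := h.six
  have h6 : 0 ≤ ∑ k ∈ s, f k ^ 4 := Finset.sum_nonneg fun k _ => by positivity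
  have h7 : 0 ≤ ∑ k ∈ s, f k ^ 6 := Finset.sum_nonneg fun k _ => by positivity
  calc _ ≤ (A / N * q ^ 2) * (A / N ^ 2 * q ^ 3) := h1.trans (by gcongr)
    _ = A ^ 2 * q ^ 5 / (N * N ^ 2) := by ring
    _ = _ := by congr 1; ring

/-- The individual step values are small at low frequencies. -/
lemma mul_sq_le_one {K : ℝ} (h : PowerSums A N q s f) (hK : 0 ≤ K) (hN : 1 ≤ N)
    (hAN : K ^ 3 * A ≤ N) (hq : (1 + q) ^ 3 ≤ N) : ∀ k ∈ s, K * f k ^ 2 ≤ 1 := by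
  intro k hk
  have hN0 : 0 < N := by linarith
  have hq0 := h.q_nonneg
  have h0 : q ^ 3 ≤ N := (pow_le_pow_left₀ hq0 (by linarith) 3).trans hq
  have h1 : f k ^ 6 ≤ ∑ k ∈ s, f k ^ 6 :=
    Finset.single_le_sum (f := fun k => f k ^ 6) (fun k _ => by positivity) hk
  have h3 := h1.trans h.six
  have hA : 0 ≤ A / N ^ 2 * q ^ 3 := le_trans (by positivity) h3
  have h2 : (K * f k ^ 2) ^ 3 ≤ 1 ^ 3 := by
    have h4 : K ^ 3 * (A / N ^ 2 * q ^ 3) = (K ^ 3 * A) * q ^ 3 / N ^ 2 := by ring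
    have h5 : (K ^ 3 * A) * q ^ 3 ≤ N * N := by
      gcongr
    calc (K * f k ^ 2) ^ 3 = K ^ 3 * f k ^ 6 := by ring
      _ ≤ K ^ 3 * (A / N ^ 2 * q ^ 3) := by gcongr
      _ ≤ 1 ^ 3 := by
        rw [h4, one_pow, div_le_one (by positivity), pow_two N]; exact h5
  exact le_of_pow_le_pow_left₀ (by norm_num) zero_le_one h2

end PowerSums

/-- The odd cumulants enter the real part only through a cosine. -/
lemma re_exp_sum_cumulantPoly (m₃ m₄ m₅ : ℝ) (s : Finset ℕ) (f : ℕ → ℝ) :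
    (Complex.exp (∑ k ∈ s, cumulantPoly m₃ m₄ m₅ (f k))).re
      = Real.exp (-((∑ k ∈ s, f k ^ 2) / 2)) * (Real.exp ((m₄ - 3) / 24 * ∑ k ∈ s, f k ^ 4)
        * Real.cos (-m₃ / 6 * ∑ k ∈ s, f k ^ 3 + (m₅ - 10 * m₃) / 120 * ∑ k ∈ s, f k ^ 5)) := by
  have hexp : ∑ k ∈ s, cumulantPoly m₃ m₄ m₅ (f k)
      = ((-((∑ k ∈ s, f k ^ 2) / 2) + (m₄ - 3) / 24 * ∑ k ∈ s, f k ^ 4 : ℝ) : ℂ)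
        + ((-m₃ / 6 * ∑ k ∈ s, f k ^ 3 + (m₅ - 10 * m₃) / 120 * ∑ k ∈ s, f k ^ 5 : ℝ) : ℂ)
          * Complex.I := by
    simp only [cumulantPoly]
    push_cast
    simp only [Finset.mul_sum, Finset.sum_mul, Finset.sum_div, ← Finset.sum_neg_distrib,
      ← Finset.sum_add_distrib, add_mul]
    refine Finset.sum_congr rfl fun k _ => ?_
    ring
  rw [hexp, Complex.exp_add, ← Complex.ofReal_exp, Complex.re_ofReal_mul,
    Complex.exp_ofReal_mul_I_re, Real.exp_add, mul_assoc]

lemma abs_exp_neg_sub_exp_neg_le {u v : ℝ} (hu : 0 ≤ u) (hv : 0 ≤ v) :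
    |Real.exp (-u) - Real.exp (-v)| ≤ |u - v| := by
  wlog h : u ≤ v generalizing u v
  · rw [abs_sub_comm, abs_sub_comm u]
    exact this hv hu (by linarith)
  · rw [abs_of_nonneg (sub_nonneg.2 (Real.exp_le_exp.2 (by linarith))), abs_of_nonpos (by linarith)]
    have h1 : Real.exp (-v) = Real.exp (-u) * Real.exp (u - v) := by
      rw [← Real.exp_add]; congr 1; ring
    have h2 := Real.add_one_le_exp (u - v)
    have h3 : Real.exp (-u) ≤ 1 := Real.exp_le_one_iff.2 (by linarith)
    have h4 := Real.exp_pos (-u)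
    rw [h1]
    nlinarith

set_option maxHeartbeats 1000000 in
/-- Low frequencies: the characteristic function is given by the cumulant expansion; the terms of
order `N^{-1/2}` and `N^{-3/2}` are purely imaginary and disappear in the real part. -/
lemma abs_re_prod_chf_sub_edgeFT_le {Ω : Type*} [MeasurableSpace Ω] {μ : Measure Ω}
    [IsProbabilityMeasure μ] {X : Ω → ℝ} {K A N q : ℝ} {s : Finset ℕ} {f : ℕ → ℝ}
    (hX : Standardized μ K X) (hA : 1 ≤ A) (hN : 1 ≤ N) (hAN : K ^ 3 * A ≤ N)
    (hf : PowerSums A N q s f) (hq : (1 + q) ^ 3 ≤ N) :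
    |(∏ k ∈ s, chf μ X (f k)).re - edgeFT (mom μ X 3) (mom μ X 4) s f q|
      ≤ ((8 * K + (8 * K ^ 3 * Real.exp (2 * K) + 3 * K ^ 2)) * A
          + ((2 * K ^ 2 * A ^ 2) ^ 2 * Real.exp (2 * K ^ 2 * A ^ 2)
            + 96 * (2 * K ^ 2 * A ^ 2) ^ 2 * (1 + (2 * K ^ 2 * A ^ 2)) + 2 * (2 * K ^ 2 * A ^ 2)
            + 2 * (2 * K ^ 2 * A ^ 2) ^ 2) + A * (1 + 2 * (2 * K ^ 2 * A ^ 2)))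
          * ((1 + q) ^ 3 / N) ^ 2 := by
  have hK := hX.one_le
  have hq0 := hf.q_nonneg
  have hN0 : 0 < N := by linarith
  have hK3 : 1 ≤ K ^ 3 := one_le_pow₀ hK
  have hAN' : A ≤ N := by nlinarith
  set ρ := 1 + q with hρ
  have hρ1 : 1 ≤ ρ := by linarith
  have hqρ : q ≤ ρ := by linarith
  set θ := ρ ^ 3 / N with hθ
  have hθ0 : 0 ≤ θ := by positivity
  have hθ1 : θ ≤ 1 := (div_le_one hN0).2 hq
  have hθsq : θ ^ 2 = ρ ^ 6 / N ^ 2 := by rw [hθ, div_pow]; ring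
  set C := 2 * K ^ 2 * A ^ 2 with hC
  set m₃ := mom μ X 3
  set m₄ := mom μ X 4
  set m₅ := mom μ X 5
  have hm3 : |m₃| ≤ K := hX.abs_mom_le (by norm_num) (by norm_num)
  have hm4 : |m₄| ≤ K := hX.abs_mom_le (by norm_num) (by norm_num)
  have hm5 : |m₅| ≤ K := hX.abs_mom_le (by norm_num) (by norm_num)
  set σ₂ := ∑ k ∈ s, f k ^ 2 with hσ₂
  set σ₃ := ∑ k ∈ s, f k ^ 3 with hσ₃
  set σ₄ := ∑ k ∈ s, f k ^ 4 with hσ₄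
  set σ₅ := ∑ k ∈ s, f k ^ 5 with hσ₅
  set σ₆ := ∑ k ∈ s, f k ^ 6 with hσ₆
  have hσ₂0 : 0 ≤ σ₂ := Finset.sum_nonneg fun k _ => sq_nonneg _
  have hσ₄0 : 0 ≤ σ₄ := Finset.sum_nonneg fun k _ => by positivity
  have hσ₆0 : 0 ≤ σ₆ := Finset.sum_nonneg fun k _ => by positivity
  set a := (m₄ - 3) / 24 * σ₄ with ha
  set b₀ := -m₃ / 6 * σ₃ with hb₀
  set b₁ := (m₅ - 10 * m₃) / 120 * σ₅ with hb₁
  have hKA : K * A ≤ K ^ 2 * A ^ 2 := by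
    rw [← mul_pow]; nlinarith [mul_le_mul hK hA zero_le_one (by linarith)]
  have hK2A : K ^ 2 * A ≤ K ^ 2 * A ^ 2 := by gcongr; nlinarith
  have hn4 : |(m₄ - 3) / 24| ≤ K := by
    have := abs_le.1 hm4
    rw [abs_le]; constructor <;> linarith
  have hn5 : |(m₅ - 10 * m₃) / 120| ≤ K := by
    have := abs_le.1 hm3
    have := abs_le.1 hm5
    rw [abs_le]; constructor <;> linarith
  have hn3 : |-m₃ / 6| ≤ K := by
    have := abs_le.1 hm3
    rw [abs_le]; constructor <;> linarith
  have hρ23 : ρ ^ 2 ≤ ρ ^ 3 := pow_le_pow_right₀ hρ1 (by norm_num)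
  have hρ46 : ρ ^ 4 ≤ ρ ^ 6 := pow_le_pow_right₀ hρ1 (by norm_num)
  have hρ36 : ρ ^ 3 ≤ ρ ^ 6 := pow_le_pow_right₀ hρ1 (by norm_num)
  have hρ56 : ρ ^ 5 ≤ ρ ^ 6 := pow_le_pow_right₀ hρ1 (by norm_num)
  have hρ16 : ρ ≤ ρ ^ 6 := by simpa using pow_le_pow_right₀ hρ1 (show 1 ≤ 6 by norm_num)
  have hσ₄le : σ₄ ≤ A * θ := by
    refine hf.four.trans ?_
    rw [hθ, div_mul_eq_mul_div, ← mul_div_assoc]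
    gcongr
    exact (pow_le_pow_left₀ hq0 hqρ 2).trans hρ23
  have hσ₃le : σ₃ ^ 2 ≤ 2 * A * θ := by
    refine (hf.cube_sq_le hN hAN').trans ?_
    rw [hθ, ← mul_div_assoc]
    gcongr
  have hσ₅le : σ₅ ^ 2 ≤ A ^ 2 * ρ ^ 5 / N ^ 3 := by
    refine (hf.quint_sq_le hN (by linarith)).trans ?_
    gcongr
  have hσ₆le : σ₆ ≤ A * θ ^ 2 := by
    refine hf.six.trans ?_
    rw [hθsq, div_mul_eq_mul_div, ← mul_div_assoc]
    gcongr
    exact (pow_le_pow_left₀ hq0 hqρ 3).trans hρ36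
  have hac : |a| ≤ C * θ := by
    rw [ha, abs_mul, abs_of_nonneg hσ₄0]
    calc _ ≤ K * (A * θ) := by gcongr
      _ = (K * A) * θ := by ring
      _ ≤ C * θ := by gcongr; rw [hC]; nlinarith
  have hb₀c : b₀ ^ 2 ≤ C * θ := by
    rw [hb₀, mul_pow, ← sq_abs (-m₃ / 6)]
    calc _ ≤ K ^ 2 * (2 * A * θ) := by gcongr
      _ = 2 * (K ^ 2 * A) * θ := by ring
      _ ≤ C * θ := by gcongr; rw [hC]; linarith
  have hb₁5 : b₁ ^ 2 ≤ K ^ 2 * (A ^ 2 * ρ ^ 5 / N ^ 3) := by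
    rw [hb₁, mul_pow, ← sq_abs ((m₅ - 10 * m₃) / 120)]
    gcongr
  have hb₁c : b₁ ^ 2 ≤ C * θ ^ 2 := by
    refine hb₁5.trans ?_
    rw [hθsq, hC]
    calc K ^ 2 * (A ^ 2 * ρ ^ 5 / N ^ 3) ≤ K ^ 2 * (A ^ 2 * ρ ^ 6 / N ^ 2) := by
          gcongr
          norm_num
      _ = (K ^ 2 * A ^ 2) * (ρ ^ 6 / N ^ 2) := by ring
      _ ≤ _ := by
          have : 0 ≤ K ^ 2 * A ^ 2 := by positivity
          exact mul_le_mul_of_nonneg_right (by linarith) (by positivity)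
  have hbb : |b₀ * b₁| ≤ C * θ ^ 2 := by
    refine abs_le_of_sq_le_sq ?_ (by positivity)
    have hb₀' : b₀ ^ 2 ≤ 2 * K ^ 2 * A * (ρ ^ 3 / N) := by
      rw [hb₀, mul_pow, ← sq_abs (-m₃ / 6)]
      calc _ ≤ K ^ 2 * (2 * A * θ) := by gcongr
        _ = _ := by rw [hθ]; ring
    rw [mul_pow, hθsq]
    calc b₀ ^ 2 * b₁ ^ 2 ≤ (2 * K ^ 2 * A * (ρ ^ 3 / N)) * (K ^ 2 * (A ^ 2 * ρ ^ 5 / N ^ 3)) := by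
          gcongr
      _ = 2 * K ^ 4 * A ^ 3 * (ρ ^ 4) ^ 2 / N ^ 4 := by field_simp
      _ ≤ 4 * K ^ 4 * A ^ 4 * (ρ ^ 6) ^ 2 / N ^ 4 := by
          gcongr ?_ * ?_ ^ 2 / _
          have : A ^ 3 ≤ A ^ 4 := pow_le_pow_right₀ hA (by norm_num)
          have : 0 ≤ K ^ 4 * A ^ 4 := by positivity
          nlinarith [pow_nonneg (by linarith : 0 ≤ K) 4]
      _ = _ := by rw [hC]; field_simp; ring
  -- smallness of the individual step values
  have hsmall : ∀ k ∈ s, K * f k ^ 2 ≤ 1 :=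
    hf.mul_sq_le_one (by linarith) hN hAN hq
  have h1 := norm_prod_chf_sub_le hX s f hsmall
  have hre : (Complex.exp (∑ k ∈ s, cumulantPoly m₃ m₄ m₅ (f k))).re
      = Real.exp (-(σ₂ / 2)) * (Real.exp a * Real.cos (b₀ + b₁)) :=
    re_exp_sum_cumulantPoly _ _ _ s f
  have h2 : |(∏ k ∈ s, chf μ X (f k)).re
      - Real.exp (-(σ₂ / 2)) * (Real.exp a * Real.cos (b₀ + b₁))|
      ≤ (8 * K + (8 * K ^ 3 * Real.exp (2 * K) + 3 * K ^ 2)) * (A * θ ^ 2) := by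
    rw [← hre, ← Complex.sub_re]
    refine (Complex.abs_re_le_norm _).trans (h1.trans ?_)
    gcongr
  have h3 := abs_exp_mul_cos_sub_le (C := C) (θ := θ) (by positivity) hθ0 hθ1 hac hb₀c hb₁c hbb
  have h4 : |Real.exp (-(σ₂ / 2)) - Real.exp (-(q / 2))| ≤ A * θ ^ 2 := by
    refine (abs_exp_neg_sub_exp_neg_le (by positivity) (by positivity)).trans ?_
    rw [← sub_div, abs_div, abs_two]
    have h5 : A / N ^ 2 * q ≤ A * θ ^ 2 := by
      rw [hθsq, div_mul_eq_mul_div, ← mul_div_assoc]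
      gcongr
      exact hqρ.trans hρ16
    have := hf.sq
    have : 0 ≤ |σ₂ - q| := abs_nonneg _
    linarith
  have h5 : |1 + a - b₀ ^ 2 / 2| ≤ 1 + 2 * C := by
    have hCθ : C * θ ≤ C := mul_le_of_le_one_right (by positivity) hθ1
    have := abs_le.1 hac
    have := sq_nonneg b₀
    rw [abs_le]; constructor <;> linarith
  have e : edgeFT m₃ m₄ s f q = Real.exp (-(q / 2)) * (1 + a - b₀ ^ 2 / 2) := by
    rw [edgeFT, ha, hb₀, neg_div]; ring
  rw [e]
  have e2 : (∏ k ∈ s, chf μ X (f k)).re - Real.exp (-(q / 2)) * (1 + a - b₀ ^ 2 / 2)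
      = ((∏ k ∈ s, chf μ X (f k)).re
        - Real.exp (-(σ₂ / 2)) * (Real.exp a * Real.cos (b₀ + b₁)))
      + Real.exp (-(σ₂ / 2)) * (Real.exp a * Real.cos (b₀ + b₁) - (1 + a - b₀ ^ 2 / 2))
      + (Real.exp (-(σ₂ / 2)) - Real.exp (-(q / 2))) * (1 + a - b₀ ^ 2 / 2) := by ring
  rw [e2]
  refine (abs_add_three _ _ _).trans ?_
  rw [abs_mul, abs_mul, abs_of_pos (Real.exp_pos _)]
  have h6 : Real.exp (-(σ₂ / 2)) ≤ 1 := Real.exp_le_one_iff.2 (by linarith)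
  have h7 := mul_le_mul h6 h3 (abs_nonneg _) zero_le_one
  have h8 := mul_le_mul h4 h5 (abs_nonneg _) (by positivity)
  rw [one_mul] at h7
  linarith

/-- Medium frequencies: the steps of moderate size make the characteristic function small. -/
lemma norm_prod_chf_le {Ω : Type*} [MeasurableSpace Ω] {μ : Measure Ω}
    [IsProbabilityMeasure μ] {X : Ω → ℝ} {K : ℝ} (hX : Standardized μ K X) (s : Finset ℕ)
    (f : ℕ → ℝ) : ‖∏ k ∈ s, chf μ X (f k)‖
      ≤ Real.exp (-(∑ k ∈ s.filter (fun k => |f k| ≤ 1 / (20 * K)), f k ^ 2) / 4) := by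
  have hK := hX.one_le
  rw [norm_prod, ← Finset.prod_filter_mul_prod_filter_not s (fun k => |f k| ≤ 1 / (20 * K))]
  have h1 : ∏ k ∈ s.filter (fun k => |f k| ≤ 1 / (20 * K)), ‖chf μ X (f k)‖
      ≤ ∏ k ∈ s.filter (fun k => |f k| ≤ 1 / (20 * K)), Real.exp (-f k ^ 2 / 4) := by
    refine Finset.prod_le_prod (fun _ _ => norm_nonneg _) fun k hk => hX.norm_chf_le ?_
    have := (Finset.mem_filter.1 hk).2
    rwa [le_div_iff₀ (by positivity), mul_comm] at this
  have h2 : ∏ k ∈ s.filter (fun k => ¬ |f k| ≤ 1 / (20 * K)), ‖chf μ X (f k)‖ ≤ 1 :=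
    Finset.prod_le_one (fun _ _ => norm_nonneg _) fun _ _ => norm_chf_le_one _
  refine (mul_le_mul h1 h2 (Finset.prod_nonneg fun _ _ => norm_nonneg _)
    (Finset.prod_nonneg fun _ _ => (Real.exp_pos _).le)).trans_eq ?_
  rw [mul_one, ← Real.exp_sum, neg_div, Finset.sum_div, ← Finset.sum_neg_distrib]
  simp_rw [neg_div]

/-- The Edgeworth correction is of order `1 / N`. -/
lemma abs_edgeFT_sub_le {A N q K m₃ m₄ : ℝ} {s : Finset ℕ} {f : ℕ → ℝ} (hK : 1 ≤ K)
    (hm3 : |m₃| ≤ K) (hm4 : |m₄| ≤ K) (hA : 1 ≤ A) (hN : 1 ≤ N) (hAN : A ≤ N)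
    (hf : PowerSums A N q s f) :
    |edgeFT m₃ m₄ s f q - Real.exp (-q / 2)|
      ≤ 2 * K ^ 2 * A * (1 + q) ^ 3 / N * Real.exp (-q / 2) := by
  have hq := hf.q_nonneg
  have hN0 : 0 < N := by linarith
  have hm := abs_le.1 hm4
  have h1 : |(m₄ - 3) / 24| ≤ K ^ 2 := by
    rw [abs_le]; constructor <;> nlinarith
  have h2 : m₃ ^ 2 ≤ K ^ 2 := by rw [← sq_abs]; gcongr
  have h3 : 0 ≤ ∑ k ∈ s, f k ^ 4 := Finset.sum_nonneg fun k _ => by positivity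
  have h4 := hf.cube_sq_le hN hAN
  have h5 := hf.four
  have e : edgeFT m₃ m₄ s f q - Real.exp (-q / 2)
      = ((m₄ - 3) / 24 * ∑ k ∈ s, f k ^ 4 - m₃ ^ 2 / 72 * (∑ k ∈ s, f k ^ 3) ^ 2)
        * Real.exp (-q / 2) := by rw [edgeFT]; ring
  rw [e, abs_mul, abs_of_pos (Real.exp_pos (-q / 2))]
  refine mul_le_mul_of_nonneg_right ?_ (Real.exp_pos _).le
  refine (abs_sub _ _).trans ?_
  rw [abs_mul, abs_mul, abs_of_nonneg h3, abs_of_nonneg (sq_nonneg (∑ k ∈ s, f k ^ 3)),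
    abs_of_nonneg (by positivity : 0 ≤ m₃ ^ 2 / 72)]
  have h6 : q ^ 2 ≤ (1 + q) ^ 3 :=
    (pow_le_pow_left₀ hq (by linarith) 2).trans (pow_le_pow_right₀ (by linarith) (by norm_num))
  have h7 : q ^ 3 ≤ (1 + q) ^ 3 := pow_le_pow_left₀ hq (by linarith) 3
  have h8 : |(m₄ - 3) / 24| * ∑ k ∈ s, f k ^ 4 ≤ K ^ 2 * (A / N * (1 + q) ^ 3) := by
    gcongr; exact h5.trans (by gcongr)
  have h9 : m₃ ^ 2 / 72 * (∑ k ∈ s, f k ^ 3) ^ 2 ≤ K ^ 2 / 72 * (2 * A * (1 + q) ^ 3 / N) := by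
    gcongr; exact h4.trans (by gcongr)
  have h10 : 0 ≤ K ^ 2 * (A / N * (1 + q) ^ 3) := by positivity
  calc _ ≤ K ^ 2 * (A / N * (1 + q) ^ 3) + K ^ 2 / 72 * (2 * A * (1 + q) ^ 3 / N) := add_le_add h8 h9
    _ = (1 + 1 / 36) * (K ^ 2 * (A / N * (1 + q) ^ 3)) := by ring
    _ ≤ 2 * (K ^ 2 * (A / N * (1 + q) ^ 3)) := by gcongr; norm_num
    _ = _ := by ring

/-! ### Uniform control of the Fourier difference -/

/-- The shape of the bounds on differences of Fourier transforms: a small integrable part, and a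
growing part that is small on account of the frequency cutoff `N ^ D`. -/
noncomputable def freqBound {d : ℕ} (r D N : ℝ) (t : Fin d → ℝ) : ℝ :=
  N ^ (-r) * (∏ j, (1 + t j ^ 2))⁻¹ + N ^ (-(D / 4)) * (∏ j, (1 + t j ^ 2)) ^ (1 / 4 : ℝ)

lemma one_le_prod_one_add_sq {d : ℕ} (t : Fin d → ℝ) : 1 ≤ ∏ j, (1 + t j ^ 2) :=
  Finset.prod_induction _ (fun x : ℝ => 1 ≤ x) (fun _ _ => one_le_mul_of_one_le_of_one_le) le_rfl
    fun j _ => by linarith [sq_nonneg (t j)]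

lemma one_add_nsq_le_prod {d : ℕ} (t : Fin d → ℝ) : 1 + nsq t ≤ ∏ j, (1 + t j ^ 2) := by
  unfold nsq
  refine Finset.induction_on (Finset.univ : Finset (Fin d)) (by simp) fun j s hj ih => ?_
  rw [Finset.sum_insert hj, Finset.prod_insert hj]
  have h1 : 0 ≤ ∑ i ∈ s, t i ^ 2 := Finset.sum_nonneg fun i _ => sq_nonneg _
  nlinarith [sq_nonneg (t j), mul_le_mul_of_nonneg_left ih (by positivity : 0 ≤ 1 + t j ^ 2)]

lemma prod_le_one_add_nsq_pow {d : ℕ} (hd : d ≤ 4) (t : Fin d → ℝ) :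
    ∏ j, (1 + t j ^ 2) ≤ (1 + nsq t) ^ 4 := by
  have h : ∏ j, (1 + t j ^ 2) ≤ ∏ _j : Fin d, (1 + nsq t) := by
    refine Finset.prod_le_prod (fun j _ => by positivity) fun j _ => ?_
    have := Finset.single_le_sum (f := fun j => t j ^ 2) (fun j _ => sq_nonneg (t j))
      (Finset.mem_univ j)
    simpa [nsq] using this
  refine h.trans ?_
  rw [Finset.prod_const, Finset.card_univ, Fintype.card_fin]
  exact pow_le_pow_right₀ (by linarith [nsq_nonneg t]) hd

lemma freqBound_nonneg {d : ℕ} {r D N : ℝ} (hN : 0 ≤ N) (t : Fin d → ℝ) :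
    0 ≤ freqBound r D N t := by
  have := one_le_prod_one_add_sq t
  have := Real.rpow_nonneg hN (-r)
  have := Real.rpow_nonneg hN (-(D / 4))
  unfold freqBound
  positivity

/-- A bound that decays like `|t| ^ (-8)` is absorbed by the integrable part of `freqBound`. -/
lemma le_freqBound_of_le {d : ℕ} (hd : d ≤ 4) {r D N c : ℝ} (hN : 0 ≤ N) {t : Fin d → ℝ}
    (h : c * (1 + nsq t) ^ 4 ≤ N ^ (-r)) : c ≤ freqBound r D N t := by
  have h1 := one_le_prod_one_add_sq t
  have h2 := prod_le_one_add_nsq_pow hd t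
  have h3 : 0 < 1 + nsq t := by linarith [nsq_nonneg t]
  have h4 : 0 ≤ N ^ (-(D / 4)) * (∏ j, (1 + t j ^ 2)) ^ (1 / 4 : ℝ) :=
    mul_nonneg (Real.rpow_nonneg hN _) (Real.rpow_nonneg (by linarith) _)
  have h5 : c ≤ N ^ (-r) * ((1 + nsq t) ^ 4)⁻¹ := by
    rw [← div_eq_mul_inv, le_div_iff₀ (by positivity)]; exact h
  have h6 : N ^ (-r) * ((1 + nsq t) ^ 4)⁻¹ ≤ N ^ (-r) * (∏ j, (1 + t j ^ 2))⁻¹ := by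
    have := Real.rpow_nonneg hN (-r)
    gcongr
  unfold freqBound
  linarith

/-- Beyond the cutoff the growing part of `freqBound` exceeds the trivial bound of a characteristic
function. -/
lemma one_le_freqBound {d : ℕ} {r D N : ℝ} (hN : 0 < N) {t : Fin d → ℝ}
    (h : N ^ D ≤ 1 + nsq t) : 1 ≤ freqBound r D N t := by
  have h1 := one_le_prod_one_add_sq t
  have h2 := h.trans (one_add_nsq_le_prod t)
  have h3 : N ^ (D / 4) ≤ (∏ j, (1 + t j ^ 2)) ^ (1 / 4 : ℝ) := by
    rw [div_eq_mul_one_div, Real.rpow_mul hN.le]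
    exact Real.rpow_le_rpow (by positivity) h2 (by norm_num)
  have h4 : 1 ≤ N ^ (-(D / 4)) * (∏ j, (1 + t j ^ 2)) ^ (1 / 4 : ℝ) := by
    calc (1 : ℝ) = N ^ (-(D / 4)) * N ^ (D / 4) := by
          rw [← Real.rpow_add hN, neg_add_cancel, Real.rpow_zero]
      _ ≤ _ := by gcongr
  have h5 : 0 ≤ N ^ (-r) * (∏ j, (1 + t j ^ 2))⁻¹ := by positivity
  unfold freqBound
  linarith

lemma freqBound_mono {d : ℕ} {r r' D N : ℝ} (hN : 1 ≤ N) (hr : r' ≤ r) (t : Fin d → ℝ) :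
    freqBound r D N t ≤ freqBound r' D N t := by
  have h1 := one_le_prod_one_add_sq t
  have : N ^ (-r) ≤ N ^ (-r') := Real.rpow_le_rpow_of_exponent_le hN (by linarith)
  unfold freqBound
  gcongr

lemma one_add_pow_mul_exp_le {q : ℝ} (hq : 0 ≤ q) (m : ℕ) :
    (1 + q) ^ m * Real.exp (-q / 2) ≤ (2 * m + 1) ^ m := by
  rcases Nat.eq_zero_or_pos m with rfl | hm
  · simpa using by linarith
  have hm' : (0 : ℝ) < m := by exact_mod_cast hm
  have h1 : 1 + q ≤ (2 * m + 1) * Real.exp (q / (2 * m)) := by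
    have h2 := Real.add_one_le_exp (q / (2 * m))
    have h3 : 0 ≤ q / (2 * m) := by positivity
    calc 1 + q = 1 + (2 * m) * (q / (2 * m)) := by field_simp
      _ ≤ (2 * m + 1) * (q / (2 * m) + 1) := by nlinarith
      _ ≤ _ := by gcongr
  have h2 : (1 + q) ^ m ≤ (2 * m + 1) ^ m * Real.exp (q / 2) := by
    calc (1 + q) ^ m ≤ ((2 * m + 1) * Real.exp (q / (2 * m))) ^ m := by gcongr
      _ = _ := by
        rw [mul_pow, ← Real.exp_nat_mul]; congr 2; field_simp
  calc (1 + q) ^ m * Real.exp (-q / 2)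
      ≤ ((2 * m + 1) ^ m * Real.exp (q / 2)) * Real.exp (-q / 2) := by gcongr
    _ = _ := by rw [mul_assoc, ← Real.exp_add, neg_div, add_neg_cancel, Real.exp_zero, mul_one]

lemma abs_edgeFT_le {A N q K m₃ m₄ : ℝ} {s : Finset ℕ} {f : ℕ → ℝ} (hK : 1 ≤ K)
    (hm3 : |m₃| ≤ K) (hm4 : |m₄| ≤ K) (hA : 1 ≤ A) (hN : 1 ≤ N) (hAN : A ≤ N)
    (hf : PowerSums A N q s f) :
    |edgeFT m₃ m₄ s f q| ≤ 3 * K ^ 2 * A * (1 + q) ^ 3 * Real.exp (-q / 2) := by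
  have h := abs_edgeFT_sub_le hK hm3 hm4 hA hN hAN hf
  have hq := hf.q_nonneg
  have h1 : 2 * K ^ 2 * A * (1 + q) ^ 3 / N ≤ 2 * K ^ 2 * A * (1 + q) ^ 3 :=
    div_le_self (by positivity) hN
  have h2 : 1 ≤ K ^ 2 * A * (1 + q) ^ 3 :=
    one_le_mul_of_one_le_of_one_le
      (one_le_mul_of_one_le_of_one_le (one_le_pow₀ hK) hA) (one_le_pow₀ (by linarith))
  have hE := Real.exp_pos (-q / 2)
  have h3 := mul_le_mul_of_nonneg_right h1 hE.le
  have h4 := mul_le_mul_of_nonneg_right h2 hE.le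
  have h5 := abs_sub_abs_le_abs_sub (edgeFT m₃ m₄ s f q) (Real.exp (-q / 2))
  rw [abs_of_pos hE] at h5
  linarith

/-- Uniformly over the coefficient distributions and the frames, the Fourier transform of the walk
agrees up to its imaginary part with that of the Edgeworth density. -/
theorem exists_abs_re_prod_chf_sub_edgeFT_le {K A D : ℝ} (hK : 1 ≤ K) (hA : 1 ≤ A) :
    ∃ A', 0 ≤ A' ∧ ∀ᶠ N : ℝ in atTop, ∀ {Ω : Type w} [MeasurableSpace Ω] (μ : Measure Ω)
      [IsProbabilityMeasure μ] (X : Ω → ℝ) {d : ℕ} (s : Finset ℕ) (ω : ℕ → Fin d → ℝ), d ≤ 4 →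
      Standardized μ K X → IsFrame A N s ω → IsSpread D (1 / (20 * K)) N s ω → ∀ t,
      |(∏ k ∈ s, chf μ X (t ⬝ᵥ ω k)).re
          - edgeFT (mom μ X 3) (mom μ X 4) s (fun k => t ⬝ᵥ ω k) (nsq t)|
        ≤ A' * freqBound (7 / 4) D N t := by
  obtain ⟨B, hB0, hB⟩ : ∃ B, 0 ≤ B ∧ B = ((8 * K + (8 * K ^ 3 * Real.exp (2 * K) + 3 * K ^ 2)) * A
          + ((2 * K ^ 2 * A ^ 2) ^ 2 * Real.exp (2 * K ^ 2 * A ^ 2)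
            + 96 * (2 * K ^ 2 * A ^ 2) ^ 2 * (1 + (2 * K ^ 2 * A ^ 2)) + 2 * (2 * K ^ 2 * A ^ 2)
            + 2 * (2 * K ^ 2 * A ^ 2) ^ 2) + A * (1 + 2 * (2 * K ^ 2 * A ^ 2))) :=
    ⟨_, by positivity, rfl⟩
  have hK2A : 1 ≤ K ^ 2 * A := one_le_mul_of_one_le_of_one_le (one_le_pow₀ hK) hA
  refine ⟨B + 2 + 3 * K ^ 2 * A * 7 ^ 3, by positivity, ?_⟩
  filter_upwards [eventually_ge_atTop (1 : ℝ), eventually_ge_atTop (K ^ 3 * A),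
    eventually_mul_rpow_mul_exp_le 1 (7 / 4 + 4 * D) (b := 1 / 100) (c := 1 / 4) (η := 1)
      (by norm_num) (by norm_num) (by norm_num),
    eventually_mul_rpow_mul_exp_le (3 * K ^ 2 * A * Real.exp (1 / 2)) (7 / 4 + 7 * D) (b := 1 / 64)
      (c := 1 / 2) (η := 1) (by norm_num) (by norm_num) (by norm_num)]
    with N hN hKN h1 h2
  intro Ω _ μ _ X d s ω hd hX hF hS t
  have hN0 : 0 < N := by linarith
  have hAN : A ≤ N := by
    have : 1 ≤ K ^ 3 := one_le_pow₀ hK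
    nlinarith
  have hp := hF.powerSums t
  have hq := nsq_nonneg t
  have hm3 : |mom μ X 3| ≤ K := hX.abs_mom_le (by norm_num) (by norm_num)
  have hm4 : |mom μ X 4| ≤ K := hX.abs_mom_le (by norm_num) (by norm_num)
  have hE := abs_edgeFT_le hK hm3 hm4 hA hN hAN hp
  have hfb := freqBound_nonneg (r := 7 / 4) (D := D) hN0.le t
  have hP : |(∏ k ∈ s, chf μ X (t ⬝ᵥ ω k)).re| ≤ ‖∏ k ∈ s, chf μ X (t ⬝ᵥ ω k)‖ :=
    Complex.abs_re_le_norm _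
  set ρ := 1 + nsq t with hρ
  have hρ1 : 1 ≤ ρ := by linarith
  have hNr : N ^ (-(7 / 4) : ℝ) = 1 / N ^ (7 / 4 : ℝ) := by rw [Real.rpow_neg hN0.le, one_div]
  -- low frequencies: the error is `(ρ³ / N)²`, and `ρ` is too small to spoil the gain `N ^ (-2)`
  rcases le_or_gt ρ (N ^ (1 / 64 : ℝ)) with hlow | hlow
  · have hpow : ∀ m : ℕ, ρ ^ m ≤ N ^ ((m : ℝ) / 64) := by
      intro m
      calc ρ ^ m ≤ (N ^ (1 / 64 : ℝ)) ^ m := by gcongr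
        _ = _ := by rw [← Real.rpow_natCast, ← Real.rpow_mul hN0.le]; congr 1; ring
    have hρ3 : ρ ^ 3 ≤ N := by
      refine (hpow 3).trans ?_
      calc N ^ (((3 : ℕ) : ℝ) / 64) ≤ N ^ (1 : ℝ) :=
            Real.rpow_le_rpow_of_exponent_le hN (by norm_num)
        _ = N := Real.rpow_one N
    have h3 := abs_re_prod_chf_sub_edgeFT_le hX hA hN hKN hp hρ3
    rw [← hB] at h3
    refine h3.trans ?_
    have h4 : (ρ ^ 3 / N) ^ 2 ≤ freqBound (7 / 4) D N t := by
      refine le_freqBound_of_le hd hN0.le ?_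
      rw [← hρ]
      calc (ρ ^ 3 / N) ^ 2 * ρ ^ 4 = ρ ^ 10 / N ^ 2 := by field_simp
        _ ≤ N ^ (((10 : ℕ) : ℝ) / 64) / N ^ 2 := by gcongr; exact hpow 10
        _ ≤ N ^ (1 / 4 : ℝ) / N ^ 2 :=
            div_le_div_of_nonneg_right
              (Real.rpow_le_rpow_of_exponent_le hN (by norm_num)) (by positivity)
        _ = _ := by
            rw [← Real.rpow_natCast N 2, ← Real.rpow_sub hN0]; norm_num
    refine mul_le_mul ?_ h4 (by positivity) (by positivity)
    have : 0 ≤ 3 * K ^ 2 * A * 7 ^ 3 := by positivity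
    linarith
  -- medium frequencies: both transforms are smaller than any power of `N`; high frequencies: both
  -- are bounded
  rcases le_or_gt ρ (N ^ D) with hmed | hmed
  · have h3 := norm_prod_chf_le hX s fun k => t ⬝ᵥ ω k
    have h4 := hS t hlow.le hmed
    have h5 : ‖∏ k ∈ s, chf μ X (t ⬝ᵥ ω k)‖ ≤ Real.exp (-(1 / 4 * N ^ (1 / 100 : ℝ))) := by
      refine h3.trans (Real.exp_le_exp.2 ?_)
      linarith
    have hpow : ∀ m : ℕ, ρ ^ m ≤ N ^ (m * D) := by
      intro m
      calc ρ ^ m ≤ (N ^ D) ^ m := by gcongr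
        _ = _ := by rw [← Real.rpow_natCast, ← Real.rpow_mul hN0.le]; congr 1; ring
    have h6 : ‖∏ k ∈ s, chf μ X (t ⬝ᵥ ω k)‖ ≤ freqBound (7 / 4) D N t := by
      refine le_freqBound_of_le hd hN0.le ?_
      rw [← hρ, hNr, le_div_iff₀ (by positivity)]
      calc _ ≤ Real.exp (-(1 / 4 * N ^ (1 / 100 : ℝ))) * N ^ (((4 : ℕ) : ℝ) * D)
            * N ^ (7 / 4 : ℝ) := by gcongr; exact hpow 4
        _ = 1 * N ^ (7 / 4 + 4 * D) * Real.exp (-(1 / 4 * N ^ (1 / 100 : ℝ))) := by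
            rw [Real.rpow_add hN0]; push_cast; ring
        _ ≤ 1 := h1
    have h7 : 3 * K ^ 2 * A * ρ ^ 3 * Real.exp (-nsq t / 2) ≤ freqBound (7 / 4) D N t := by
      refine le_freqBound_of_le hd hN0.le ?_
      rw [← hρ, hNr, le_div_iff₀ (by positivity)]
      have h8 : Real.exp (-nsq t / 2)
          ≤ Real.exp (1 / 2) * Real.exp (-(1 / 2 * N ^ (1 / 64 : ℝ))) := by
        rw [← Real.exp_add]
        refine Real.exp_le_exp.2 ?_
        linarith
      calc 3 * K ^ 2 * A * ρ ^ 3 * Real.exp (-nsq t / 2) * ρ ^ 4 * N ^ (7 / 4 : ℝ)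
          = 3 * K ^ 2 * A * ρ ^ 7 * Real.exp (-nsq t / 2) * N ^ (7 / 4 : ℝ) := by ring
        _ ≤ 3 * K ^ 2 * A * N ^ (((7 : ℕ) : ℝ) * D)
            * (Real.exp (1 / 2) * Real.exp (-(1 / 2 * N ^ (1 / 64 : ℝ)))) * N ^ (7 / 4 : ℝ) := by
            gcongr; exact hpow 7
        _ = 3 * K ^ 2 * A * Real.exp (1 / 2) * N ^ (7 / 4 + 7 * D)
            * Real.exp (-(1 / 2 * N ^ (1 / 64 : ℝ))) := by
            rw [Real.rpow_add hN0]; push_cast; ring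
        _ ≤ 1 := h2
    have h9 : (2 : ℝ) ≤ B + 2 + 3 * K ^ 2 * A * 7 ^ 3 := by
      have : 0 ≤ 3 * K ^ 2 * A * 7 ^ 3 := by positivity
      linarith
    have h10 := mul_le_mul_of_nonneg_right h9 hfb
    refine (abs_sub _ _).trans ?_
    linarith
  · have h3 := one_le_freqBound (r := 7 / 4) hN0 hmed.le
    have h4 : ‖∏ k ∈ s, chf μ X (t ⬝ᵥ ω k)‖ ≤ 1 := by
      rw [norm_prod]
      exact Finset.prod_le_one (fun _ _ => norm_nonneg _) fun _ _ => norm_chf_le_one _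
    have h5 : 3 * K ^ 2 * A * ρ ^ 3 * Real.exp (-nsq t / 2) ≤ 3 * K ^ 2 * A * 7 ^ 3 := by
      have := one_add_pow_mul_exp_le hq 3
      norm_num at this
      rw [mul_assoc]
      norm_num
      gcongr
    have h6 : 0 ≤ 3 * K ^ 2 * A * 7 ^ 3 := by positivity
    have h7 := mul_le_mul_of_nonneg_left h3 (by positivity : 0 ≤ B + 2 + 3 * K ^ 2 * A * 7 ^ 3)
    refine (abs_sub _ _).trans ?_
    linarith

/-- Comparison with the Gaussian Fourier transform, without correction term. -/
theorem exists_abs_re_prod_chf_sub_exp_le {K A D : ℝ} (hK : 1 ≤ K) (hA : 1 ≤ A) :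
    ∃ A', 0 ≤ A' ∧ ∀ᶠ N : ℝ in atTop, ∀ {Ω : Type w} [MeasurableSpace Ω] (μ : Measure Ω)
      [IsProbabilityMeasure μ] (X : Ω → ℝ) {d : ℕ} (s : Finset ℕ) (ω : ℕ → Fin d → ℝ), d ≤ 4 →
      Standardized μ K X → IsFrame A N s ω → IsSpread D (1 / (20 * K)) N s ω → ∀ t,
      |(∏ k ∈ s, chf μ X (t ⬝ᵥ ω k)).re - Real.exp (-nsq t / 2)|
        ≤ A' * freqBound (3 / 4) D N t := by
  obtain ⟨A', hA', h⟩ := exists_abs_re_prod_chf_sub_edgeFT_le.{w} (D := D) hK hA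
  refine ⟨A' + 2 * K ^ 2 * A * 15 ^ 7, by positivity, ?_⟩
  filter_upwards [h, eventually_ge_atTop (1 : ℝ), eventually_ge_atTop A] with N h hN hAN
  intro Ω _ μ _ X d s ω hd hX hF hS t
  have hN0 : 0 < N := by linarith
  have h1 := h μ X s ω hd hX hF hS t
  have h2 := abs_edgeFT_sub_le hK (hX.abs_mom_le (j := 3) (by norm_num) (by norm_num))
    (hX.abs_mom_le (j := 4) (by norm_num) (by norm_num)) hA hN hAN (hF.powerSums t)
  have h3 := freqBound_mono (D := D) hN (show (3 / 4 : ℝ) ≤ 7 / 4 by norm_num) t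
  have hq := nsq_nonneg t
  have h4 : (1 + nsq t) ^ 3 / N * Real.exp (-nsq t / 2) / 15 ^ 7 ≤ freqBound (3 / 4) D N t := by
    refine le_freqBound_of_le hd hN0.le ?_
    have h5 := one_add_pow_mul_exp_le hq 7
    have h5 : (1 + nsq t) ^ 7 * Real.exp (-nsq t / 2) / 15 ^ 7 ≤ 1 := by
      rw [div_le_one (by norm_num)]; refine h5.trans ?_; norm_num
    calc _ = ((1 + nsq t) ^ 7 * Real.exp (-nsq t / 2) / 15 ^ 7) * N ^ (-1 : ℝ) := by
          rw [Real.rpow_neg_one]; field_simp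
      _ ≤ 1 * N ^ (-(3 / 4) : ℝ) := by
          gcongr
          norm_num
      _ = _ := one_mul _
  have h5 : 2 * K ^ 2 * A * (1 + nsq t) ^ 3 / N * Real.exp (-nsq t / 2)
      ≤ 2 * K ^ 2 * A * 15 ^ 7 * freqBound (3 / 4) D N t := by
    calc _ = 2 * K ^ 2 * A * 15 ^ 7 * ((1 + nsq t) ^ 3 / N * Real.exp (-nsq t / 2) / 15 ^ 7) := by
          ring
      _ ≤ _ := by gcongr
  have h6 := mul_le_mul_of_nonneg_left h3 hA'
  refine (abs_sub_le _ (edgeFT (mom μ X 3) (mom μ X 4) s (fun k => t ⬝ᵥ ω k) (nsq t)) _).trans ?_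
  linarith

/-! ### The Edgeworth density -/

/-- The density of the second order Edgeworth approximation with respect to the standard Gaussian
law, for a walk with steps `ω k` and coefficients whose third and fourth moments are `m₃`, `m₄`. -/
noncomputable def edgeWeight {d : ℕ} (m₃ m₄ : ℝ) (s : Finset ℕ) (ω : ℕ → Fin d → ℝ)
    (y : Fin d → ℝ) : ℝ :=
  1 + (1 / 24) * ∑ β : Fin 4 → Fin d, ((m₄ - 3) * ∑ k ∈ s, mono β (ω k)) * hermiteMulti β y
    + (1 / 72) * ∑ ρ : Fin 3 → Fin d, ∑ β : Fin 3 → Fin d,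
      ((m₃ * ∑ k ∈ s, mono β (ω k)) * (m₃ * ∑ k ∈ s, mono ρ (ω k)))
        * hermiteMulti (Fin.append β ρ) y

section

variable {d : ℕ}

lemma allMoments_edgeWeight (m₃ m₄ : ℝ) (s : Finset ℕ) (ω : ℕ → Fin d → ℝ) :
    AllMoments (stdGauss d) (edgeWeight m₃ m₄ s ω) :=
  ((AllMoments.const 1).add ((AllMoments.sum _ fun β _ =>
    (allMoments_hermiteMulti β).const_mul _).const_mul _)).add ((AllMoments.sum _ fun _ _ =>
      AllMoments.sum _ fun _ _ => (allMoments_hermiteMulti _).const_mul _).const_mul _)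

lemma sum_sum_mono_mul (l : ℕ) (s : Finset ℕ) (ω : ℕ → Fin d → ℝ) (t : Fin d → ℝ) :
    ∑ β : Fin l → Fin d, (∑ k ∈ s, mono β (ω k)) * mono β t = ∑ k ∈ s, (t ⬝ᵥ ω k) ^ l := by
  simp_rw [Finset.sum_mul]
  rw [Finset.sum_comm]
  exact Finset.sum_congr rfl fun k _ => sum_mono_mul_mono l (ω k) t

lemma integral_stdGauss_cexp (t : Fin d → ℝ) :
    ∫ y, Complex.exp (((t ⬝ᵥ y : ℝ) : ℂ) * Complex.I) ∂(stdGauss d)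
      = (Real.exp (-nsq t / 2) : ℂ) := by
  have h := integral_hermiteMulti_mul_cexp (d := d) (fun i : Fin 0 => i.elim0) t
  simpa [hermiteMulti, occ, mono] using h

lemma integral_sum_hermiteMulti_mul_cexp {J : Type*} [Fintype J] {l : ℕ} (c : J → ℝ)
    (α : J → Fin l → Fin d) (t : Fin d → ℝ) :
    ∫ y, ((∑ j, c j * hermiteMulti (α j) y : ℝ) : ℂ)
        * Complex.exp (((t ⬝ᵥ y : ℝ) : ℂ) * Complex.I) ∂(stdGauss d)
      = Complex.I ^ l * ((∑ j, c j * mono (α j) t : ℝ) : ℂ) * Real.exp (-nsq t / 2) := by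
  have hm : AEMeasurable (fun y : Fin d → ℝ => t ⬝ᵥ y) (stdGauss d) :=
    (continuous_const.dotProduct continuous_id).aemeasurable
  have e : ∀ y, ((∑ j, c j * hermiteMulti (α j) y : ℝ) : ℂ)
        * Complex.exp (((t ⬝ᵥ y : ℝ) : ℂ) * Complex.I)
      = ∑ j, (c j : ℂ) * ((hermiteMulti (α j) y : ℂ)
        * Complex.exp (((t ⬝ᵥ y : ℝ) : ℂ) * Complex.I)) := by
    intro y
    push_cast
    rw [Finset.sum_mul]
    exact Finset.sum_congr rfl fun j _ => by ring
  simp_rw [e]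
  rw [integral_finsetSum _ fun j _ =>
    (integrable_ofReal_mul_cexp (allMoments_hermiteMulti (α j)).integrable hm).const_mul _]
  simp_rw [integral_const_mul, integral_hermiteMulti_mul_cexp]
  push_cast
  rw [Finset.mul_sum, Finset.sum_mul]
  exact Finset.sum_congr rfl fun j _ => by ring

/-- The Fourier transform of the Edgeworth density. -/
lemma integral_edgeWeight_mul_cexp (m₃ m₄ : ℝ) (s : Finset ℕ) (ω : ℕ → Fin d → ℝ)
    (t : Fin d → ℝ) :
    ∫ y, (edgeWeight m₃ m₄ s ω y : ℂ) * Complex.exp (((t ⬝ᵥ y : ℝ) : ℂ) * Complex.I) ∂(stdGauss d)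
      = (edgeFT m₃ m₄ s (fun k => t ⬝ᵥ ω k) (nsq t) : ℂ) := by
  have hm : AEMeasurable (fun y : Fin d → ℝ => t ⬝ᵥ y) (stdGauss d) :=
    (continuous_const.dotProduct continuous_id).aemeasurable
  have hi : ∀ {J : Type} [Fintype J] {l : ℕ} (c : J → ℝ) (α : J → Fin l → Fin d),
      Integrable (fun y => ((∑ j, c j * hermiteMulti (α j) y : ℝ) : ℂ)
        * Complex.exp (((t ⬝ᵥ y : ℝ) : ℂ) * Complex.I)) (stdGauss d) := fun c α =>
    integrable_ofReal_mul_cexp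
      (AllMoments.sum _ fun j _ => (allMoments_hermiteMulti (α j)).const_mul _).integrable hm
  have h1 : Integrable (fun y => Complex.exp (((t ⬝ᵥ y : ℝ) : ℂ) * Complex.I)) (stdGauss d) := by
    simpa using integrable_ofReal_mul_cexp (integrable_const (1 : ℝ)) hm
  have h4 := hi (fun β : Fin 4 → Fin d => (m₄ - 3) / 24 * ∑ k ∈ s, mono β (ω k)) fun β => β
  have h3 := hi (fun p : (Fin 3 → Fin d) × (Fin 3 → Fin d) =>
    m₃ ^ 2 / 72 * (∑ k ∈ s, mono p.2 (ω k)) * ∑ k ∈ s, mono p.1 (ω k))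
    fun p => Fin.append p.2 p.1
  have e : ∀ y, (edgeWeight m₃ m₄ s ω y : ℂ) * Complex.exp (((t ⬝ᵥ y : ℝ) : ℂ) * Complex.I)
      = (Complex.exp (((t ⬝ᵥ y : ℝ) : ℂ) * Complex.I)
      + ((∑ β : Fin 4 → Fin d, (m₄ - 3) / 24 * (∑ k ∈ s, mono β (ω k)) * hermiteMulti β y : ℝ) : ℂ)
        * Complex.exp (((t ⬝ᵥ y : ℝ) : ℂ) * Complex.I))
      + ((∑ p : (Fin 3 → Fin d) × (Fin 3 → Fin d), m₃ ^ 2 / 72 * (∑ k ∈ s, mono p.2 (ω k))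
          * (∑ k ∈ s, mono p.1 (ω k)) * hermiteMulti (Fin.append p.2 p.1) y : ℝ) : ℂ)
        * Complex.exp (((t ⬝ᵥ y : ℝ) : ℂ) * Complex.I) := by
    intro y
    have e1 : edgeWeight m₃ m₄ s ω y = 1
        + ∑ β : Fin 4 → Fin d, (m₄ - 3) / 24 * (∑ k ∈ s, mono β (ω k)) * hermiteMulti β y
        + ∑ p : (Fin 3 → Fin d) × (Fin 3 → Fin d), m₃ ^ 2 / 72 * (∑ k ∈ s, mono p.2 (ω k))
          * (∑ k ∈ s, mono p.1 (ω k)) * hermiteMulti (Fin.append p.2 p.1) y := by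
      rw [edgeWeight, Fintype.sum_prod_type, Finset.mul_sum, Finset.mul_sum]
      congr 1
      · congr 1
        exact Finset.sum_congr rfl fun β _ => by ring
      · refine Finset.sum_congr rfl fun ρ _ => ?_
        rw [Finset.mul_sum]
        exact Finset.sum_congr rfl fun β _ => by ring
    rw [e1, Complex.ofReal_add, Complex.ofReal_add, add_mul, add_mul, Complex.ofReal_one, one_mul]
  simp_rw [e]
  have h14 : Integrable (fun y => Complex.exp (((t ⬝ᵥ y : ℝ) : ℂ) * Complex.I)
      + ((∑ β : Fin 4 → Fin d, (m₄ - 3) / 24 * (∑ k ∈ s, mono β (ω k)) * hermiteMulti β y : ℝ) : ℂ)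
        * Complex.exp (((t ⬝ᵥ y : ℝ) : ℂ) * Complex.I)) (stdGauss d) := h1.add h4
  rw [integral_add h14 h3, integral_add h1 h4, integral_sum_hermiteMulti_mul_cexp,
    integral_sum_hermiteMulti_mul_cexp, integral_stdGauss_cexp]
  have e4 : ∑ β : Fin 4 → Fin d, (m₄ - 3) / 24 * (∑ k ∈ s, mono β (ω k)) * mono β t
      = (m₄ - 3) / 24 * ∑ k ∈ s, (t ⬝ᵥ ω k) ^ 4 := by
    rw [← sum_sum_mono_mul, Finset.mul_sum]
    exact Finset.sum_congr rfl fun β _ => by ring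
  have e3 : ∑ p : (Fin 3 → Fin d) × (Fin 3 → Fin d), m₃ ^ 2 / 72 * (∑ k ∈ s, mono p.2 (ω k))
      * (∑ k ∈ s, mono p.1 (ω k)) * mono (Fin.append p.2 p.1) t
      = m₃ ^ 2 / 72 * (∑ k ∈ s, (t ⬝ᵥ ω k) ^ 3) ^ 2 := by
    rw [← sum_sum_mono_mul, pow_two (∑ β : Fin 3 → Fin d, _), Finset.sum_mul_sum,
      Fintype.sum_prod_type, Finset.mul_sum]
    refine Finset.sum_congr rfl fun ρ _ => ?_
    rw [Finset.mul_sum]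
    refine Finset.sum_congr rfl fun β _ => ?_
    rw [mono_append]; ring
  have i4 : Complex.I ^ 4 = 1 := Complex.I_pow_four
  have i6 : Complex.I ^ (3 + 3) = -1 := by
    rw [show 3 + 3 = 4 + 2 by norm_num, pow_add, i4, Complex.I_sq, one_mul]
  rw [e4, e3, i4, i6, edgeFT]
  push_cast
  ring

/-- A moment bound for the Edgeworth density that depends only on the Hermite polynomials. -/
noncomputable def edgeMajorant (d : ℕ) (y : Fin d → ℝ) : ℝ :=
  1 + 2 * ∑ β : Fin 4 → Fin d, |hermiteMulti β y|
    + ∑ ρ : Fin 3 → Fin d, ∑ β : Fin 3 → Fin d, |hermiteMulti (Fin.append β ρ) y|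

lemma allMoments_edgeMajorant (d : ℕ) : AllMoments (stdGauss d) (edgeMajorant d) :=
  ((AllMoments.const 1).add ((AllMoments.sum _ fun β _ =>
    (allMoments_hermiteMulti β).abs).const_mul _)).add (AllMoments.sum _ fun _ _ =>
      AllMoments.sum _ fun _ _ => (allMoments_hermiteMulti _).abs)

lemma nsq_single (j : Fin d) : nsq (Pi.single j (1 : ℝ)) = 1 := by
  unfold nsq
  rw [Finset.sum_eq_single j]
  · simp
  · intro i _ hi; simp [hi]
  · simp

lemma IsFrame.sum_apply_sq_le {A N : ℝ} {s : Finset ℕ} {ω : ℕ → Fin d → ℝ}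
    (h : IsFrame A N s ω) (hN : 1 ≤ N) (hAN : A ≤ N) (j : Fin d) : ∑ k ∈ s, ω k j ^ 2 ≤ 2 := by
  have := (h.powerSums (Pi.single j 1)).sq_le hN hAN
  simpa [nsq_single] using this

lemma IsFrame.abs_apply_le {A N : ℝ} {s : Finset ℕ} {ω : ℕ → Fin d → ℝ}
    (h : IsFrame A N s ω) (hN : 1 ≤ N) (hAN : A ≤ N) (j : Fin d) : ∀ k ∈ s, |ω k j| ≤ 2 := by
  intro k hk
  have h1 := h.sum_apply_sq_le hN hAN j
  have h2 := Finset.single_le_sum (f := fun k => ω k j ^ 2) (fun k _ => sq_nonneg (ω k j)) hk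
  exact abs_le_of_sq_le_sq (by norm_num; linarith) (by norm_num)

lemma IsFrame.abs_sum_mono_le {A N : ℝ} {s : Finset ℕ} {ω : ℕ → Fin d → ℝ}
    (h : IsFrame A N s ω) (hN : 1 ≤ N) (hAN : A ≤ N) {l : ℕ} (β : Fin (l + 2) → Fin d) :
    |∑ k ∈ s, mono β (ω k)| ≤ 2 ^ (l + 1) := by
  have h1 : ∀ k ∈ s, |mono β (ω k)| ≤ 2 ^ l * ((ω k (β 0) ^ 2 + ω k (β 1) ^ 2) / 2) := by
    intro k hk
    rw [mono_eq_prod, Fin.prod_univ_succ, Fin.prod_univ_succ, abs_mul, abs_mul, Finset.abs_prod]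
    have h2 : ∏ i : Fin l, |ω k (β i.succ.succ)| ≤ ∏ _i : Fin l, (2 : ℝ) :=
      Finset.prod_le_prod (fun _ _ => abs_nonneg _) fun i _ => h.abs_apply_le hN hAN _ k hk
    rw [Finset.prod_const, Finset.card_univ, Fintype.card_fin] at h2
    have h3 : |ω k (β 0)| * |ω k (β 1)| ≤ (ω k (β 0) ^ 2 + ω k (β 1) ^ 2) / 2 := by
      rw [← sq_abs (ω k (β 0)), ← sq_abs (ω k (β 1))]
      nlinarith [sq_nonneg (|ω k (β 0)| - |ω k (β 1)|)]
    rw [← mul_assoc, mul_comm]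
    exact mul_le_mul h2 h3 (by positivity) (by positivity)
  refine (Finset.abs_sum_le_sum_abs _ _).trans ((Finset.sum_le_sum h1).trans ?_)
  rw [← Finset.mul_sum, ← Finset.sum_div, Finset.sum_add_distrib, pow_succ]
  have h4 := h.sum_apply_sq_le hN hAN (β 0)
  have h5 := h.sum_apply_sq_le hN hAN (β 1)
  gcongr
  linarith

lemma abs_edgeWeight_le {A N K m₃ m₄ : ℝ} {s : Finset ℕ} {ω : ℕ → Fin d → ℝ}
    (h : IsFrame A N s ω) (hN : 1 ≤ N) (hAN : A ≤ N) (hK : 1 ≤ K) (hm3 : |m₃| ≤ K)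
    (hm4 : |m₄| ≤ K) (y : Fin d → ℝ) :
    |edgeWeight m₃ m₄ s ω y| ≤ K ^ 2 * edgeMajorant d y := by
  have h4 : |m₄ - 3| ≤ 4 * K := (abs_sub _ _).trans (by norm_num; linarith)
  have hKK : K ≤ K ^ 2 := by nlinarith
  have hb4 : ∀ β : Fin 4 → Fin d,
      |((m₄ - 3) * ∑ k ∈ s, mono β (ω k)) * hermiteMulti β y| ≤ 32 * K * |hermiteMulti β y| := by
    intro β
    rw [abs_mul, abs_mul]
    have := h.abs_sum_mono_le hN hAN (l := 2) β
    refine mul_le_mul_of_nonneg_right ?_ (abs_nonneg _)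
    calc _ ≤ (4 * K) * 2 ^ (2 + 1) := mul_le_mul h4 this (abs_nonneg _) (by linarith)
      _ = _ := by ring
  have hb3 : ∀ ρ β : Fin 3 → Fin d,
      |((m₃ * ∑ k ∈ s, mono β (ω k)) * (m₃ * ∑ k ∈ s, mono ρ (ω k)))
        * hermiteMulti (Fin.append β ρ) y| ≤ 16 * K ^ 2 * |hermiteMulti (Fin.append β ρ) y| := by
    intro ρ β
    have h5 : ∀ β : Fin 3 → Fin d, |m₃ * ∑ k ∈ s, mono β (ω k)| ≤ 4 * K := by
      intro β
      rw [abs_mul]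
      have := h.abs_sum_mono_le hN hAN (l := 1) β
      calc _ ≤ K * 2 ^ (1 + 1) := mul_le_mul hm3 this (abs_nonneg _) (by linarith)
        _ = _ := by ring
    rw [abs_mul, abs_mul]
    refine mul_le_mul_of_nonneg_right ?_ (abs_nonneg _)
    calc _ ≤ (4 * K) * (4 * K) := mul_le_mul (h5 β) (h5 ρ) (abs_nonneg _) (by linarith)
      _ = _ := by ring
  have s4 : |∑ β : Fin 4 → Fin d, ((m₄ - 3) * ∑ k ∈ s, mono β (ω k)) * hermiteMulti β y|
      ≤ 32 * K * ∑ β : Fin 4 → Fin d, |hermiteMulti β y| := by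
    rw [Finset.mul_sum]
    exact (Finset.abs_sum_le_sum_abs _ _).trans (Finset.sum_le_sum fun β _ => hb4 β)
  have s3 : |∑ ρ : Fin 3 → Fin d, ∑ β : Fin 3 → Fin d,
      ((m₃ * ∑ k ∈ s, mono β (ω k)) * (m₃ * ∑ k ∈ s, mono ρ (ω k)))
        * hermiteMulti (Fin.append β ρ) y|
      ≤ 16 * K ^ 2 * ∑ ρ : Fin 3 → Fin d, ∑ β : Fin 3 → Fin d,
        |hermiteMulti (Fin.append β ρ) y| := by
    rw [Finset.mul_sum Finset.univ]
    refine (Finset.abs_sum_le_sum_abs _ _).trans (Finset.sum_le_sum fun ρ _ => ?_)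
    refine (Finset.abs_sum_le_sum_abs _ _).trans ?_
    rw [Finset.mul_sum Finset.univ]
    exact Finset.sum_le_sum fun β _ => hb3 ρ β
  have p4 : 0 ≤ ∑ β : Fin 4 → Fin d, |hermiteMulti β y| :=
    Finset.sum_nonneg fun _ _ => abs_nonneg _
  have p3 : 0 ≤ ∑ ρ : Fin 3 → Fin d, ∑ β : Fin 3 → Fin d, |hermiteMulti (Fin.append β ρ) y| :=
    Finset.sum_nonneg fun _ _ => Finset.sum_nonneg fun _ _ => abs_nonneg _
  rw [edgeWeight, edgeMajorant]
  refine (abs_add_three _ _ _).trans ?_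
  rw [abs_mul, abs_mul, abs_one, abs_of_pos (by norm_num : (0 : ℝ) < 1 / 24),
    abs_of_pos (by norm_num : (0 : ℝ) < 1 / 72)]
  have := mul_le_mul_of_nonneg_right hKK p4
  have := mul_nonneg (sq_nonneg K) p4
  have := mul_nonneg (sq_nonneg K) p3
  nlinarith

end

lemma mono_smul {d l : ℕ} (α : Fin l → Fin d) (c : ℝ) (z : Fin d → ℝ) :
    mono α (c • z) = c ^ l * mono α z := by
  simp [mono_eq_prod, Finset.prod_mul_distrib]

lemma cAvg_smul {d l : ℕ} {Ω : Type*} [MeasurableSpace Ω] {μ : Measure Ω} (N : ℝ)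
    (s : Finset ℕ) {ξ : ℕ → Ω → ℝ} (hid : ∀ i, IdentDistrib (ξ i) (ξ 0) μ μ)
    (w : ℕ → Fin d → ℝ) (α : Fin l → Fin d) :
    cAvg μ (gaussianReal 0 1) N s (fun k ω => ξ k ω • w k) (fun k g => g • w k) α
      = (1 / N) * ((mom μ (ξ 0) l - ∫ x, x ^ l ∂(gaussianReal 0 1)) * ∑ k ∈ s, mono α (w k)) := by
  have h1 : ∀ k, ∫ ω, ξ k ω ^ l ∂μ = mom μ (ξ 0) l := fun k =>
    ((hid k).comp (u := fun x : ℝ => x ^ l) (by fun_prop)).integral_eq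
  simp_rw [cAvg, mono_smul, integral_mul_const, h1, ← sub_mul, Finset.mul_sum]

/-- The correction polynomial of the walk is the one of the Edgeworth density. -/
lemma one_add_walkGamma2_eq {d : ℕ} {Ω : Type*} [MeasurableSpace Ω] {μ : Measure Ω} {N : ℝ}
    (hN : 0 < N) (s : Finset ℕ) {ξ : ℕ → Ω → ℝ} (hid : ∀ i, IdentDistrib (ξ i) (ξ 0) μ μ)
    (ω : ℕ → Fin d → ℝ) (t : Fin d → ℝ) :
    1 + (1 / N) * walkGamma2 μ N s ξ (fun k => Real.sqrt N • ω k) t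
      = edgeWeight (mom μ (ξ 0) 3) (mom μ (ξ 0) 4) s ω t := by
  have hs : Real.sqrt N ^ 2 = N := Real.sq_sqrt hN.le
  have h4 : Real.sqrt N ^ 4 = N ^ 2 := by rw [show 4 = 2 * 2 by norm_num, pow_mul, hs]
  have h3 : (Real.sqrt N ^ 3) * (Real.sqrt N ^ 3) = N ^ 3 := by
    rw [← pow_add, show 3 + 3 = 2 * 3 by norm_num, pow_mul, hs]
  have hN' := hN.ne'
  rw [walkGamma2, Gamma2, edgeWeight]
  simp_rw [cAvg_smul N s hid, mono_smul, ← Finset.mul_sum, integral_pow_three_gaussianReal,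
    integral_pow_four_gaussianReal, sub_zero, mul_add, ← add_assoc]
  congr 1
  · congr 1
    rw [← mul_assoc, Finset.mul_sum, Finset.mul_sum]
    refine Finset.sum_congr rfl fun (β : Fin 4 → Fin d) _ => ?_
    rw [h4]
    generalize ∑ k ∈ s, mono β (ω k) = a
    field_simp
  · rw [← mul_assoc, Finset.mul_sum, Finset.mul_sum]
    refine Finset.sum_congr rfl fun (ρ : Fin 3 → Fin d) _ => ?_
    rw [Finset.mul_sum Finset.univ, Finset.mul_sum Finset.univ]
    refine Finset.sum_congr rfl fun (β : Fin 3 → Fin d) _ => ?_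
    generalize ∑ k ∈ s, mono β (ω k) = a
    generalize ∑ k ∈ s, mono ρ (ω k) = b
    have e : ∀ c : ℝ, 1 / N * (1 / 72) * (1 / N * (mom μ (ξ 0) 3 * (Real.sqrt N ^ 3 * a))
        * (1 / N * (mom μ (ξ 0) 3 * (Real.sqrt N ^ 3 * b))) * c)
        = (1 / 72) * (1 / N ^ 3) * ((Real.sqrt N ^ 3) * (Real.sqrt N ^ 3))
          * (mom μ (ξ 0) 3 * a * (mom μ (ξ 0) 3 * b) * c) := by
      intro c; field_simp
    rw [e, h3]; field_simp

/-! ### Fourier inversion for products of test functions -/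

section

variable {d : ℕ} {Ω : Type*} [MeasurableSpace Ω] {P : Measure Ω}
  {B E : ℝ} {m g : Fin d → ℝ → ℝ}

lemma ofReal_prod_eq_integral (h : ∀ j, IsCosTransform B E (m j) (g j)) (y : Fin d → ℝ) :
    ((∏ j, g j (y j) : ℝ) : ℂ)
      = ∫ t : Fin d → ℝ, ((∏ j, m j (t j) : ℝ) : ℂ)
        * Complex.exp (((t ⬝ᵥ y : ℝ) : ℂ) * Complex.I) := by
  have h1 := integral_fintype_prod_volume_eq_prod (𝕜 := ℂ) (E := fun _ : Fin d => ℝ)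
    (f := fun j (x : ℝ) => (m j x : ℂ) * Complex.exp (((x * y j : ℝ) : ℂ) * Complex.I))
  simp_rw [cexp_dotProduct, Complex.ofReal_prod, ← Finset.prod_mul_distrib]
  rw [h1]
  exact Finset.prod_congr rfl fun j _ => (h j).ofReal_eq (y j)

/-- The Fourier transform of the signed measure `w P` under the map `Y`. -/
noncomputable def wchf (P : Measure Ω) (w : Ω → ℝ) (Y : Ω → Fin d → ℝ) (t : Fin d → ℝ) : ℂ :=
  ∫ ω, (w ω : ℂ) * Complex.exp (((t ⬝ᵥ Y ω : ℝ) : ℂ) * Complex.I) ∂P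

lemma integrable_prod_cosTransform (h : ∀ j, IsCosTransform B E (m j) (g j)) :
    Integrable fun t : Fin d → ℝ => ∏ j, m j (t j) :=
  Integrable.fintype_prod (μ := fun _ => volume) fun j => (h j).integrable

lemma integrable_uncurry_inversion (h : ∀ j, IsCosTransform B E (m j) (g j)) {w : Ω → ℝ}
    (hw : Integrable w P) {Y : Ω → Fin d → ℝ} (hY : AEMeasurable Y P) :
    Integrable (Function.uncurry fun (ω : Ω) (t : Fin d → ℝ) => (w ω : ℂ)
      * (((∏ j, m j (t j) : ℝ) : ℂ) * Complex.exp (((t ⬝ᵥ Y ω : ℝ) : ℂ) * Complex.I)))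
      (P.prod volume) := by
  have h1 := (hw.ofReal (𝕜 := ℂ)).mul_prod (integrable_prod_cosTransform h).ofReal
  have hc : Continuous fun p : (Fin d → ℝ) × (Fin d → ℝ) =>
      Complex.exp (((p.2 ⬝ᵥ p.1 : ℝ) : ℂ) * Complex.I) :=
    Complex.continuous_exp.comp (((Complex.continuous_ofReal.comp
      (continuous_snd.dotProduct continuous_fst))).mul continuous_const)
  have h2 : AEStronglyMeasurable (fun p : Ω × (Fin d → ℝ) =>
      Complex.exp (((p.2 ⬝ᵥ Y p.1 : ℝ) : ℂ) * Complex.I)) (P.prod volume) :=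
    (hc.measurable.comp_aemeasurable
      (hY.comp_fst.prodMk measurable_snd.aemeasurable)).aestronglyMeasurable
  refine (h1.mul_bdd (c := 1) h2 (Filter.Eventually.of_forall fun p => ?_)).congr
    (Filter.Eventually.of_forall fun p => ?_)
  · rw [Complex.norm_exp_ofReal_mul_I]
  · simp only [Function.uncurry]; exact mul_assoc _ _ _

/-- Fourier inversion. The weight `w` and the densities `m j` are real, so only the real part of the
transform contributes. -/
lemma integral_mul_prod_eq_integral_wchf [SFinite P] (h : ∀ j, IsCosTransform B E (m j) (g j))
    {w : Ω → ℝ} (hw : Integrable w P) {Y : Ω → Fin d → ℝ} (hY : AEMeasurable Y P) :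
    (Integrable fun t : Fin d → ℝ => (∏ j, m j (t j)) * (wchf P w Y t).re)
    ∧ ∫ ω, w ω * ∏ j, g j (Y ω j) ∂P
      = ∫ t : Fin d → ℝ, (∏ j, m j (t j)) * (wchf P w Y t).re := by
  have hi := integrable_uncurry_inversion h hw hY
  have e : ∀ t : Fin d → ℝ, ∫ ω, (w ω : ℂ) * (((∏ j, m j (t j) : ℝ) : ℂ)
      * Complex.exp (((t ⬝ᵥ Y ω : ℝ) : ℂ) * Complex.I)) ∂P
      = ((∏ j, m j (t j) : ℝ) : ℂ) * wchf P w Y t := by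
    intro t
    rw [wchf, ← integral_const_mul]
    exact integral_congr_ae (Filter.Eventually.of_forall fun ω => by ring)
  have h1 : Integrable fun t : Fin d → ℝ => ((∏ j, m j (t j) : ℝ) : ℂ) * wchf P w Y t := by
    simp_rw [← e]; exact hi.integral_prod_right
  have h2 := integral_integral_swap hi
  simp_rw [e, integral_const_mul, ← ofReal_prod_eq_integral h] at h2
  have e2 : ∀ t : Fin d → ℝ, (((∏ j, m j (t j) : ℝ) : ℂ) * wchf P w Y t).re
      = (∏ j, m j (t j)) * (wchf P w Y t).re := fun t => Complex.re_ofReal_mul _ _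
  refine ⟨by simp_rw [← e2]; exact h1.re, ?_⟩
  have h3 := congrArg Complex.re h2
  simp_rw [← Complex.ofReal_mul] at h3
  rw [integral_complex_ofReal, Complex.ofReal_re] at h3
  rw [h3]
  have h4 := integral_re h1
  simp only [RCLike.re_eq_complex_re] at h4
  rw [← h4]
  simp_rw [e2]

end

/-- The mass of the majorant of the high frequencies. -/
noncomputable def tailMass : ℝ := ∫ s : ℝ, (1 + s ^ 2) ^ (-(3 / 4) : ℝ)

lemma integrable_one_add_sq_rpow : Integrable fun s : ℝ => (1 + s ^ 2) ^ (-(3 / 4) : ℝ) := by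
  have h := integrable_rpow_neg_one_add_norm_sq (E := ℝ) (μ := volume) (r := 3 / 2)
    (by simp; norm_num)
  refine h.congr (Filter.Eventually.of_forall fun s => ?_)
  simp only [Real.norm_eq_abs, sq_abs]
  norm_num

lemma tailMass_nonneg : 0 ≤ tailMass :=
  integral_nonneg fun s => Real.rpow_nonneg (by positivity) _

/-- A bound of the difference of two Fourier transforms gives a bound of the difference of the
integrals of products of test functions. -/
lemma abs_integral_sub_integral_le {d : ℕ} {Ω Ω' : Type*} [MeasurableSpace Ω] [MeasurableSpace Ω']
    {P : Measure Ω} [SFinite P] {Q : Measure Ω'} [SFinite Q] {B E : ℝ} {m g : Fin d → ℝ → ℝ}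
    (h : ∀ j, IsCosTransform B E (m j) (g j)) {w : Ω → ℝ} (hw : Integrable w P)
    {Y : Ω → Fin d → ℝ} (hY : AEMeasurable Y P) {w' : Ω' → ℝ} (hw' : Integrable w' Q)
    {Y' : Ω' → Fin d → ℝ} (hY' : AEMeasurable Y' Q) {A r D N : ℝ} (hN : 0 ≤ N) (hA : 0 ≤ A)
    (hb : ∀ t, |(wchf P w Y t).re - (wchf Q w' Y' t).re| ≤ A * freqBound r D N t) :
    |(∫ ω, w ω * ∏ j, g j (Y ω j) ∂P) - ∫ ω, w' ω * ∏ j, g j (Y' ω j) ∂Q|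
      ≤ A * (N ^ (-r) * (B * Real.pi) ^ d + N ^ (-(D / 4)) * ((B + E) * tailMass) ^ d) := by
  obtain ⟨i1, e1⟩ := integral_mul_prod_eq_integral_wchf h hw hY
  obtain ⟨i2, e2⟩ := integral_mul_prod_eq_integral_wchf h hw' hY'
  rw [e1, e2, ← integral_sub i1 i2]
  have j1 : Integrable fun t : Fin d → ℝ => ∏ j, (B * (1 + t j ^ 2)⁻¹) :=
    Integrable.fintype_prod (μ := fun _ => volume) fun _ => integrable_inv_one_add_sq.const_mul B
  have j2 : Integrable fun t : Fin d → ℝ => ∏ j, ((B + E) * (1 + t j ^ 2) ^ (-(3 / 4) : ℝ)) :=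
    Integrable.fintype_prod (μ := fun _ => volume) fun _ =>
      integrable_one_add_sq_rpow.const_mul (B + E)
  have k1 : ∫ t : Fin d → ℝ, ∏ j, (B * (1 + t j ^ 2)⁻¹) = (B * Real.pi) ^ d := by
    have := integral_fintype_prod_volume_eq_prod (𝕜 := ℝ) (E := fun _ : Fin d => ℝ)
      (f := fun _ (x : ℝ) => B * (1 + x ^ 2)⁻¹)
    rw [this, Finset.prod_const, Finset.card_univ, Fintype.card_fin, integral_const_mul,
      integral_univ_inv_one_add_sq]
  have k2 : ∫ t : Fin d → ℝ, ∏ j, ((B + E) * (1 + t j ^ 2) ^ (-(3 / 4) : ℝ))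
      = ((B + E) * tailMass) ^ d := by
    have := integral_fintype_prod_volume_eq_prod (𝕜 := ℝ) (E := fun _ : Fin d => ℝ)
      (f := fun _ (x : ℝ) => (B + E) * (1 + x ^ 2) ^ (-(3 / 4) : ℝ))
    rw [this, Finset.prod_const, Finset.card_univ, Fintype.card_fin, integral_const_mul, tailMass]
  have k3 : ∫ t : Fin d → ℝ, A * (N ^ (-r) * (∏ j, (B * (1 + t j ^ 2)⁻¹))
      + N ^ (-(D / 4)) * ∏ j, ((B + E) * (1 + t j ^ 2) ^ (-(3 / 4) : ℝ)))
      = A * (N ^ (-r) * (B * Real.pi) ^ d + N ^ (-(D / 4)) * ((B + E) * tailMass) ^ d) := by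
    rw [integral_const_mul, integral_add (j1.const_mul _) (j2.const_mul _), integral_const_mul,
      integral_const_mul, k1, k2]
  rw [← k3, ← Real.norm_eq_abs]
  refine norm_integral_le_of_norm_le (((j1.const_mul _).add (j2.const_mul _)).const_mul A)
    (Filter.Eventually.of_forall fun t => ?_)
  rw [← mul_sub, Real.norm_eq_abs, abs_mul, Finset.abs_prod]
  have hp : 0 ≤ ∏ j, |m j (t j)| := Finset.prod_nonneg fun _ _ => abs_nonneg _
  have hr := Real.rpow_nonneg hN (-r)
  have hD := Real.rpow_nonneg hN (-(D / 4))
  have b1 : (∏ j, |m j (t j)|) * (∏ j, (1 + t j ^ 2))⁻¹ ≤ ∏ j, (B * (1 + t j ^ 2)⁻¹) := by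
    rw [← Finset.prod_inv_distrib, ← Finset.prod_mul_distrib]
    refine Finset.prod_le_prod (fun j _ => by positivity) fun j _ => ?_
    exact mul_le_mul_of_nonneg_right ((h j).bound _) (by positivity)
  have b2 : (∏ j, |m j (t j)|) * (∏ j, (1 + t j ^ 2)) ^ (1 / 4 : ℝ)
      ≤ ∏ j, ((B + E) * (1 + t j ^ 2) ^ (-(3 / 4) : ℝ)) := by
    rw [← Real.finsetProd_rpow _ _ fun j _ => by positivity, ← Finset.prod_mul_distrib]
    refine Finset.prod_le_prod (fun j _ => by positivity) fun j _ => ?_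
    have h0 : 0 < 1 + t j ^ 2 := by positivity
    calc |m j (t j)| * (1 + t j ^ 2) ^ (1 / 4 : ℝ)
        ≤ ((B + E) * (1 + t j ^ 2)⁻¹) * (1 + t j ^ 2) ^ (1 / 4 : ℝ) := by
          gcongr; exact (h j).abs_le_div _
      _ = (B + E) * (1 + t j ^ 2) ^ (-(3 / 4) : ℝ) := by
          rw [mul_assoc, ← Real.rpow_neg_one, ← Real.rpow_add h0]; norm_num
  calc _ ≤ (∏ j, |m j (t j)|) * (A * freqBound r D N t) := mul_le_mul_of_nonneg_left (hb t) hp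
    _ = A * (N ^ (-r) * ((∏ j, |m j (t j)|) * (∏ j, (1 + t j ^ 2))⁻¹)
        + N ^ (-(D / 4)) * ((∏ j, |m j (t j)|) * (∏ j, (1 + t j ^ 2)) ^ (1 / 4 : ℝ))) := by
        rw [freqBound]; ring
    _ ≤ _ := by gcongr

/-! ### Test functions between cosine transforms -/

/-- The function `φ` lies, up to tails `|y| > L`, between two cosine transforms of bounded densities
that agree with it away from the points `± δ`. -/
structure IsSandwiched (B E T L δ η : ℝ) (φ : ℝ → ℝ) : Prop where
  measurable : Measurable φ
  nonneg : ∀ y, 0 ≤ φ y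
  le : ∀ y, φ y ≤ T * (1 + |y|)
  lower : ∃ m g, IsCosTransform B E m g ∧ Measurable g ∧ (∀ y, 0 ≤ g y) ∧ (∀ y, g y ≤ φ y)
    ∧ ∀ y, |y| ≤ L → η < |(|y| - δ)| → g y = φ y
  upper : ∃ m g, IsCosTransform B E m g ∧ Measurable g ∧ (∀ y, 0 ≤ g y)
    ∧ (∀ y, g y ≤ T * (1 + |y|)) ∧ (∀ y, |y| ≤ L → φ y ≤ g y)
    ∧ ∀ y, |y| ≤ L → η < |(|y| - δ)| → g y = φ y

lemma measurable_trapezoid (a b : ℝ) : Measurable (trapezoid a b) := by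
  unfold trapezoid; fun_prop

lemma measurable_tent (L : ℝ) : Measurable (tent L) := by
  unfold tent; fun_prop

lemma measurable_F (δ : ℝ) : Measurable (F δ) := by
  unfold F
  exact Measurable.ite (measurableSet_lt (by fun_prop) (by fun_prop)) (by fun_prop) (by fun_prop)

lemma trapezoid_nonneg {a b : ℝ} (h : a < b) (y : ℝ) : 0 ≤ trapezoid a b y :=
  div_nonneg (sub_nonneg.2 (max_le_max_right _ (by linarith))) (by linarith)

lemma trapezoid_le_one {a b : ℝ} (h : a < b) (y : ℝ) : trapezoid a b y ≤ 1 := by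
  unfold trapezoid
  rw [div_le_one (by linarith), sub_le_iff_le_add]
  refine max_le ?_ ?_
  · linarith [le_max_left (a - |y|) 0]
  · linarith [le_max_right (a - |y|) 0]

lemma trapezoid_eq_one {a b y : ℝ} (h : a < b) (hy : |y| ≤ a) : trapezoid a b y = 1 := by
  unfold trapezoid
  rw [max_eq_left (by linarith), max_eq_left (by linarith), div_eq_one_iff_eq (by linarith)]
  ring

lemma trapezoid_eq_zero {a b y : ℝ} (h : a < b) (hy : b ≤ |y|) : trapezoid a b y = 0 := by
  unfold trapezoid
  rw [max_eq_right (by linarith), max_eq_right (by linarith), sub_zero, zero_div]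

lemma tent_eq_abs {L y : ℝ} (hy : |y| ≤ L) : tent L y = |y| := by
  have := abs_nonneg y
  unfold tent
  rw [max_eq_left (by linarith), max_eq_left (by linarith)]
  ring

lemma tent_nonneg (L y : ℝ) : 0 ≤ tent L y := by
  have h0 := abs_nonneg y
  unfold tent
  rcases le_total L |y| with h | h
  · rw [max_eq_right (a := L - |y|) (by linarith)]
    simp
  · rw [max_eq_left (by linarith), max_eq_left (by linarith)]
    linarith

lemma tent_le_abs (L y : ℝ) : tent L y ≤ |y| := by
  have h0 := abs_nonneg y
  unfold tent
  rcases le_total L |y| with h | h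
  · rw [max_eq_right (a := L - |y|) (by linarith)]
    have : max (2 * L - |y|) 0 ≤ |y| := max_le (by linarith) h0
    linarith
  · rw [max_eq_left (by linarith), max_eq_left (by linarith)]
    linarith

lemma isSandwiched_one {L T δ η : ℝ} (hL : 1 ≤ L) (hT : 1 ≤ T) :
    IsSandwiched (3 * L ^ 2 / cosMass) (6 / cosMass) T L δ η fun _ => 1 := by
  have hκ := cosMass_pos
  obtain ⟨m, hm⟩ := isCosTransform_trapezoid (a := L) (b := 2 * L) (by linarith) (by linarith)
  have hm' : IsCosTransform (3 * L ^ 2 / cosMass) (6 / cosMass) m (trapezoid L (2 * L)) := by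
    refine hm.mono ?_ ?_
    · rw [div_le_div_iff₀ (by positivity) hκ]
      have : (L + 2 * L) ≤ 3 * L ^ 2 * 2 := by nlinarith
      nlinarith
    · rw [div_le_div_iff₀ (by nlinarith) hκ]
      nlinarith
  have hlt : L < 2 * L := by linarith
  have hone : ∀ y : ℝ, (1 : ℝ) ≤ T * (1 + |y|) := fun y =>
    one_le_mul_of_one_le_of_one_le hT (by linarith [abs_nonneg y])
  refine ⟨measurable_const, fun _ => zero_le_one, hone, ⟨m, _, hm', measurable_trapezoid _ _,
    trapezoid_nonneg hlt, trapezoid_le_one hlt, fun y hy _ => trapezoid_eq_one hlt hy⟩,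
    ⟨m, _, hm', measurable_trapezoid _ _, trapezoid_nonneg hlt,
      fun y => (trapezoid_le_one hlt y).trans (hone y), fun y hy => (trapezoid_eq_one hlt hy).ge,
      fun y hy _ => trapezoid_eq_one hlt hy⟩⟩

lemma isSandwiched_abs {L T δ η : ℝ} (hL : 1 ≤ L) (hT : 1 ≤ T) :
    IsSandwiched (3 * L ^ 2 / cosMass) (6 / cosMass) T L δ η fun y => |y| := by
  obtain ⟨m, hm⟩ := isCosTransform_tent (L := L) (by linarith)
  have hle : ∀ y : ℝ, |y| ≤ T * (1 + |y|) := fun y => by nlinarith [abs_nonneg y]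
  exact ⟨by fun_prop, abs_nonneg, hle, ⟨m, _, hm, measurable_tent L,
    tent_nonneg L, tent_le_abs L, fun y hy _ => tent_eq_abs hy⟩,
    ⟨m, _, hm, measurable_tent L, tent_nonneg L, fun y => (tent_le_abs L y).trans (hle y),
      fun y hy => (tent_eq_abs hy).ge, fun y hy _ => tent_eq_abs hy⟩⟩

/-- The normalized indicator function lies between trapezoids with slopes of width `η`. -/
lemma isSandwiched_F {L T δ η : ℝ} (hη : 0 < η) (hηδ : η ≤ δ) (hT : 1 / (2 * δ) ≤ T) :
    IsSandwiched (1 / cosMass) (1 / (cosMass * (δ * η))) T L δ η (F δ) := by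
  have hκ := cosMass_pos
  have hδ : 0 < δ := by linarith
  have hc : 0 ≤ 1 / (2 * δ) := by positivity
  obtain ⟨m₁, hm₁⟩ := isCosTransform_trapezoid (a := δ - η) (b := δ) (by linarith) (by linarith)
  obtain ⟨m₂, hm₂⟩ := isCosTransform_trapezoid (a := δ) (b := δ + η) (by linarith) (by linarith)
  have h₁ : IsCosTransform (1 / cosMass) (1 / (cosMass * (δ * η)))
      (fun s => 1 / (2 * δ) * m₁ s) (fun y => 1 / (2 * δ) * trapezoid (δ - η) δ y) := by
    refine (hm₁.const_mul hc).mono ?_ ?_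
    · rw [div_mul_div_comm, div_le_div_iff₀ (by positivity) hκ]
      nlinarith
    · rw [div_mul_div_comm, div_le_div_iff₀ (by rw [sub_sub_cancel]; positivity) (by positivity)]
      apply le_of_eq; ring
  have h₂ : IsCosTransform (1 / cosMass) (1 / (cosMass * (δ * η)))
      (fun s => 1 / (2 * δ) * m₂ s) (fun y => 1 / (2 * δ) * trapezoid δ (δ + η) y) := by
    refine (hm₂.const_mul hc).mono ?_ ?_
    · rw [div_mul_div_comm, div_le_div_iff₀ (by positivity) hκ]
      nlinarith
    · rw [div_mul_div_comm, div_le_div_iff₀ (by rw [add_sub_cancel_left]; positivity)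
        (by positivity)]
      apply le_of_eq; ring
  have l₁ : δ - η < δ := by linarith
  have l₂ : δ < δ + η := by linarith
  have hF0 : ∀ y, 0 ≤ F δ y := fun y => by unfold F; split_ifs <;> positivity
  have hTy : ∀ y : ℝ, 1 / (2 * δ) ≤ T * (1 + |y|) := fun y =>
    hT.trans (le_mul_of_one_le_right (hc.trans hT) (by linarith [abs_nonneg y]))
  have hFle : ∀ y, F δ y ≤ 1 / (2 * δ) := fun y => by
    unfold F; split_ifs
    exacts [le_rfl, hc]
  refine ⟨measurable_F δ, hF0, fun y => (hFle y).trans (hTy y),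
    ⟨_, _, h₁, (measurable_trapezoid _ _).const_mul _,
      fun y => mul_nonneg hc (trapezoid_nonneg l₁ y), fun y => ?_, fun y _ hy => ?_⟩,
    ⟨_, _, h₂, (measurable_trapezoid _ _).const_mul _,
      fun y => mul_nonneg hc (trapezoid_nonneg l₂ y),
      fun y => (mul_le_of_le_one_right hc (trapezoid_le_one l₂ y)).trans (hTy y),
      fun y _ => ?_, fun y _ hy => ?_⟩⟩
  · unfold F
    split_ifs with h
    · exact mul_le_of_le_one_right hc (trapezoid_le_one l₁ y)
    · rw [trapezoid_eq_zero l₁ (not_lt.1 h), mul_zero]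
  · unfold F
    split_ifs with h
    · rw [abs_of_neg (by linarith)] at hy
      rw [trapezoid_eq_one l₁ (by linarith), mul_one]
    · rw [trapezoid_eq_zero l₁ (not_lt.1 h), mul_zero]
  · unfold F
    split_ifs with h
    · rw [trapezoid_eq_one l₂ h.le, mul_one]
    · exact mul_nonneg hc (trapezoid_nonneg l₂ y)
  · unfold F
    split_ifs with h
    · rw [trapezoid_eq_one l₂ h.le, mul_one]
    · rw [abs_of_nonneg (by linarith [not_lt.1 h])] at hy
      rw [trapezoid_eq_zero l₂ (by linarith), mul_zero]

lemma IsSandwiched.mono {B E B' E' T L δ η : ℝ} {φ : ℝ → ℝ} (h : IsSandwiched B E T L δ η φ)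
    (hB : B ≤ B') (hE : E ≤ E') : IsSandwiched B' E' T L δ η φ := by
  obtain ⟨m, g, hm, h1⟩ := h.lower
  obtain ⟨m', g', hm', h2⟩ := h.upper
  exact ⟨h.measurable, h.nonneg, h.le, ⟨m, g, hm.mono hB hE, h1⟩, ⟨m', g', hm'.mono hB hE, h2⟩⟩

/-! ### The Gaussian mass of the exceptional set -/

open Classical in
/-- The indicator function of the set where a test function may differ from its cosine transforms. -/
noncomputable def badInd (L δ η x : ℝ) : ℝ := if |x| ≤ L ∧ η < |(|x| - δ)| then 0 else 1

lemma badInd_nonneg (L δ η x : ℝ) : 0 ≤ badInd L δ η x := by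
  unfold badInd; split_ifs <;> norm_num

lemma badInd_le_one (L δ η x : ℝ) : badInd L δ η x ≤ 1 := by
  unfold badInd; split_ifs <;> norm_num

lemma measurable_badInd (L δ η : ℝ) : Measurable (badInd L δ η) := by
  unfold badInd
  refine Measurable.ite ?_ measurable_const measurable_const
  have h1 : Measurable fun x : ℝ => |x| := by fun_prop
  have h2 : Measurable fun x : ℝ => |(|x| - δ)| := by fun_prop
  exact (measurableSet_le h1 measurable_const).inter (measurableSet_lt measurable_const h2)

lemma measureReal_gaussianReal_Icc_le {a b : ℝ} (hab : a ≤ b) :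
    (gaussianReal 0 1).real (Set.Icc a b) ≤ b - a := by
  have h : gaussianReal 0 1 (Set.Icc a b) ≤ ENNReal.ofReal (b - a) := by
    rw [gaussianReal_apply _ one_ne_zero]
    calc ∫⁻ x in Set.Icc a b, gaussianPDF 0 1 x ≤ ∫⁻ _x in Set.Icc a b, 1 := by
          refine lintegral_mono fun x => ?_
          rw [gaussianPDF, ENNReal.ofReal_le_one, gaussianPDFReal]
          have h1 : Real.exp (-(x - 0) ^ 2 / (2 * ((1 : NNReal) : ℝ))) ≤ 1 := by
            rw [Real.exp_le_one_iff]
            have := sq_nonneg (x - 0)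
            norm_num
            nlinarith [sq_nonneg x]
          have h2 : (Real.sqrt (2 * Real.pi * ((1 : NNReal) : ℝ)))⁻¹ ≤ 1 := by
            refine inv_le_one_of_one_le₀ (Real.one_le_sqrt.2 ?_)
            have := Real.pi_gt_three
            norm_num; linarith
          exact mul_le_one₀ h2 (Real.exp_pos _).le h1
      _ = ENNReal.ofReal (b - a) := by simp
  rw [measureReal_def]
  exact ENNReal.toReal_le_of_le_ofReal (by linarith) h

/-- The exceptional set consists of the tails `|x| > L` and of two intervals of length `2η`. -/
lemma integral_badInd_le {L δ η : ℝ} (hL : 0 < L) (hη : 0 ≤ η) {M : ℕ} (hM : Even M) :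
    ∫ x, badInd L δ η x ∂(gaussianReal 0 1)
      ≤ (∫ x, x ^ M ∂(gaussianReal 0 1)) / L ^ M + 4 * η := by
  have hb : ∀ x, badInd L δ η x ≤ x ^ M / L ^ M
      + ((Set.Icc (δ - η) (δ + η)).indicator (fun _ => (1 : ℝ)) x
        + (Set.Icc (-δ - η) (-δ + η)).indicator (fun _ => (1 : ℝ)) x) := by
    intro x
    have i1 : 0 ≤ (Set.Icc (δ - η) (δ + η)).indicator (fun _ => (1 : ℝ)) x :=
      Set.indicator_nonneg (fun _ _ => zero_le_one) _
    have i2 : 0 ≤ (Set.Icc (-δ - η) (-δ + η)).indicator (fun _ => (1 : ℝ)) x :=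
      Set.indicator_nonneg (fun _ _ => zero_le_one) _
    have i3 : 0 ≤ x ^ M / L ^ M := div_nonneg (hM.pow_nonneg x) (by positivity)
    unfold badInd
    split_ifs with h
    · positivity
    · rcases lt_or_ge L |x| with h1 | h1
      · have : 1 ≤ x ^ M / L ^ M := by
          rw [one_le_div (by positivity), ← hM.pow_abs x]
          exact pow_le_pow_left₀ hL.le h1.le M
        linarith
      · have h2 : |(|x| - δ)| ≤ η := by
          by_contra h3
          exact h ⟨h1, not_le.1 h3⟩
        have h3 := abs_le.1 h2
        rcases le_total 0 x with h0 | h0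
        · rw [abs_of_nonneg h0] at h3
          rw [Set.indicator_of_mem (s := Set.Icc (δ - η) (δ + η))
            (Set.mem_Icc.2 ⟨by linarith, by linarith⟩)]
          linarith
        · rw [abs_of_nonpos h0] at h3
          rw [Set.indicator_of_mem (s := Set.Icc (-δ - η) (-δ + η))
            (Set.mem_Icc.2 ⟨by linarith, by linarith⟩)]
          linarith
  have j0 : Integrable (fun x : ℝ => x ^ M / L ^ M) (gaussianReal 0 1) :=
    (allMoments_gaussianReal.pow M).integrable.div_const _
  have j1 : Integrable ((Set.Icc (δ - η) (δ + η)).indicator (fun _ => (1 : ℝ)))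
    (gaussianReal 0 1) := (integrable_const _).indicator measurableSet_Icc
  have j2 : Integrable ((Set.Icc (-δ - η) (-δ + η)).indicator (fun _ => (1 : ℝ)))
    (gaussianReal 0 1) := (integrable_const _).indicator measurableSet_Icc
  have j12 : Integrable (fun x => (Set.Icc (δ - η) (δ + η)).indicator (fun _ => (1 : ℝ)) x
        + (Set.Icc (-δ - η) (-δ + η)).indicator (fun _ => (1 : ℝ)) x) (gaussianReal 0 1) :=
    j1.add j2
  have j : Integrable (fun x => x ^ M / L ^ M
      + ((Set.Icc (δ - η) (δ + η)).indicator (fun _ => (1 : ℝ)) x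
        + (Set.Icc (-δ - η) (-δ + η)).indicator (fun _ => (1 : ℝ)) x)) (gaussianReal 0 1) :=
    j0.add j12
  refine (integral_mono_of_nonneg (Filter.Eventually.of_forall (badInd_nonneg L δ η))
    j (Filter.Eventually.of_forall hb)).trans ?_
  rw [integral_add j0 j12, integral_add j1 j2, integral_div,
    integral_indicator measurableSet_Icc, integral_indicator measurableSet_Icc]
  have k1 := measureReal_gaussianReal_Icc_le (show δ - η ≤ δ + η by linarith)
  have k2 := measureReal_gaussianReal_Icc_le (show -δ - η ≤ -δ + η by linarith)
  simp only [integral_const, MeasurableSet.univ, measureReal_restrict_apply, Set.univ_inter,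
    smul_eq_mul, mul_one]
  linarith

/-! ### Smoothing -/

section

variable {d : ℕ}

/-- Off the cube of side `L` a function of linear growth in each variable is dominated by high moments. -/
lemma prod_one_add_abs_le_of_lt {L : ℝ} (hL : 1 ≤ L) (hd : d ≤ 4) {M : ℕ} (hM : Even M)
    (hM4 : 4 ≤ M) {y : Fin d → ℝ} (hy : ∃ j, L < |y j|) :
    ∏ j, (1 + |y j|) ≤ 16 * (L ^ 4 / L ^ M) * ∑ j, y j ^ M := by
  obtain ⟨j₀, hj₀⟩ := hy
  obtain ⟨i, -, hi⟩ := Finset.exists_max_image Finset.univ (fun j => |y j|) ⟨j₀, Finset.mem_univ _⟩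
  have hLi : L < |y i| := hj₀.trans_le (hi j₀ (Finset.mem_univ _))
  have h1 : ∏ j, (1 + |y j|) ≤ ∏ _j : Fin d, (2 * |y i|) :=
    Finset.prod_le_prod (fun _ _ => by positivity) fun j hj => by linarith [hi j hj]
  rw [Finset.prod_const, Finset.card_univ, Fintype.card_fin] at h1
  have h2 : (2 * |y i|) ^ d ≤ (2 * |y i|) ^ 4 := pow_le_pow_right₀ (by linarith) hd
  have h3 : y i ^ M ≤ ∑ j, y j ^ M :=
    Finset.single_le_sum (f := fun j => y j ^ M) (fun j _ => hM.pow_nonneg _) (Finset.mem_univ i)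
  have h4 : |y i| ^ 4 ≤ (L ^ 4 / L ^ M) * |y i| ^ M := by
    obtain ⟨k, rfl⟩ := Nat.exists_eq_add_of_le hM4
    rw [pow_add, pow_add, div_mul_eq_mul_div, le_div_iff₀ (by positivity)]
    have : L ^ k ≤ |y i| ^ k := pow_le_pow_left₀ (by linarith) hLi.le k
    have h5 : 0 ≤ L ^ 4 * |y i| ^ 4 := by positivity
    nlinarith [mul_le_mul_of_nonneg_left this h5]
  rw [hM.pow_abs] at h4
  have h5 : 0 ≤ L ^ 4 / L ^ M := by positivity
  calc ∏ j, (1 + |y j|) ≤ (2 * |y i|) ^ 4 := h1.trans h2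
    _ = 16 * |y i| ^ 4 := by ring
    _ ≤ 16 * ((L ^ 4 / L ^ M) * y i ^ M) := by gcongr
    _ ≤ 16 * ((L ^ 4 / L ^ M) * ∑ j, y j ^ M) := by gcongr
    _ = _ := by ring

lemma allMoments_prod_one_add_abs {Ω : Type*} [MeasurableSpace Ω] {P : Measure Ω}
    [IsFiniteMeasure P] {Y : Ω → Fin d → ℝ} (hY : ∀ j, AllMoments P fun ω => Y ω j) :
    AllMoments P fun ω => ∏ j, (1 + |Y ω j|) :=
  AllMoments.prod _ fun j _ => (AllMoments.const 1).add (hY j).abs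

lemma aemeasurable_of_allMoments {Ω : Type*} [MeasurableSpace Ω] {P : Measure Ω}
    {Y : Ω → Fin d → ℝ} (hY : ∀ j, AllMoments P fun ω => Y ω j) : AEMeasurable Y P :=
  aemeasurable_pi_iff.2 fun j => (hY j 1).aestronglyMeasurable.aemeasurable

/-- Functions of at most linear growth in each variable have all moments. -/
lemma allMoments_prod_comp {Ω : Type*} [MeasurableSpace Ω] {P : Measure Ω}
    [IsFiniteMeasure P] {Y : Ω → Fin d → ℝ} (hY : ∀ j, AllMoments P fun ω => Y ω j)
    {g : Fin d → ℝ → ℝ} {T : ℝ} (hm : ∀ j, Measurable (g j)) (h0 : ∀ j y, 0 ≤ g j y)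
    (hT : ∀ j y, g j y ≤ T * (1 + |y|)) : AllMoments P fun ω => ∏ j, g j (Y ω j) := by
  refine AllMoments.prod _ fun j _ => ?_
  refine (((AllMoments.const 1).add (hY j).abs).const_mul T).mono
    ((hm j).comp_aemeasurable (hY j 1).aestronglyMeasurable.aemeasurable).aestronglyMeasurable ?_
  intro ω
  rw [abs_of_nonneg (h0 j _)]
  exact (hT j _).trans (le_abs_self _)

lemma prod_le_of_linear_growth {g : Fin d → ℝ → ℝ} {T : ℝ} (h0 : ∀ j y, 0 ≤ g j y)
    (hT : ∀ j y, g j y ≤ T * (1 + |y|)) (y : Fin d → ℝ) :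
    ∏ j, g j (y j) ≤ T ^ d * ∏ j, (1 + |y j|) := by
  refine (Finset.prod_le_prod (fun j _ => h0 j _) fun j _ => hT j (y j)).trans_eq ?_
  rw [Finset.prod_mul_distrib, Finset.prod_const, Finset.card_univ, Fintype.card_fin]

lemma allMoments_apply_stdGauss (j : Fin d) : AllMoments (stdGauss d) fun y => y j :=
  allMoments_gaussianReal.comp_eval j

lemma integral_sum_badInd (L δ η : ℝ) :
    Integrable (fun y : Fin d → ℝ => ∑ j, badInd L δ η (y j)) (stdGauss d)
    ∧ ∫ y, ∑ j, badInd L δ η (y j) ∂(stdGauss d)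
      = d * ∫ x, badInd L δ η x ∂(gaussianReal 0 1) := by
  have hi : Integrable (badInd L δ η) (gaussianReal 0 1) :=
    Integrable.of_bound (measurable_badInd L δ η).aestronglyMeasurable 1
      (Filter.Eventually.of_forall fun x => by
        rw [Real.norm_eq_abs, abs_of_nonneg (badInd_nonneg _ _ _ _)]; exact badInd_le_one _ _ _ _)
  have hi' : ∀ j : Fin d, Integrable (fun y : Fin d → ℝ => badInd L δ η (y j)) (stdGauss d) :=
    fun j => (measurePreserving_eval_stdGauss j).integrable_comp_of_integrable hi
  refine ⟨integrable_finsetSum _ fun j _ => hi' j, ?_⟩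
  rw [integral_finsetSum _ fun j _ => hi' j]
  have : ∀ j : Fin d, ∫ y, badInd L δ η (y j) ∂(stdGauss d)
      = ∫ x, badInd L δ η x ∂(gaussianReal 0 1) := by
    intro j
    rw [← (measurePreserving_eval_stdGauss j).map_eq, integral_map
      (measurePreserving_eval_stdGauss j).measurable.aemeasurable
      (measurable_badInd L δ η).aestronglyMeasurable]
  simp [this]

/-- On the Gaussian side two functions that agree off the exceptional set have close integrals. -/
lemma abs_integral_mul_sub_le {L δ η T ε : ℝ} (hε : 0 < ε) (hT : 0 ≤ T) {W : (Fin d → ℝ) → ℝ}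
    (hW : AllMoments (stdGauss d) W) {φ g : Fin d → ℝ → ℝ} (hφm : ∀ j, Measurable (φ j))
    (hφ0 : ∀ j y, 0 ≤ φ j y) (hφT : ∀ j y, φ j y ≤ T * (1 + |y|)) (hgm : ∀ j, Measurable (g j))
    (hg0 : ∀ j y, 0 ≤ g j y) (hgT : ∀ j y, g j y ≤ T * (1 + |y|))
    (h : ∀ j y, |y| ≤ L → η < |(|y| - δ)| → g j y = φ j y) :
    |(∫ y, W y * ∏ j, φ j (y j) ∂(stdGauss d)) - ∫ y, W y * ∏ j, g j (y j) ∂(stdGauss d)|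
      ≤ T ^ d * (ε * (∫ y, (W y * ∏ j, (1 + |y j|)) ^ 2 ∂(stdGauss d))
        + d * (∫ x, badInd L δ η x ∂(gaussianReal 0 1)) / ε) := by
  have hY : ∀ j : Fin d, AllMoments (stdGauss d) fun y => y j := allMoments_apply_stdGauss
  have i1 := (hW.mul (allMoments_prod_comp hY hφm hφ0 hφT)).integrable
  have i2 := (hW.mul (allMoments_prod_comp hY hgm hg0 hgT)).integrable
  have i3 := ((hW.mul (allMoments_prod_one_add_abs hY)).pow 2).integrable
  obtain ⟨i4, e4⟩ := integral_sum_badInd (d := d) L δ η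
  rw [← integral_sub i1 i2, ← e4, ← integral_const_mul, ← integral_div,
    ← integral_add (i3.const_mul ε) (i4.div_const ε), ← integral_const_mul, ← Real.norm_eq_abs]
  refine norm_integral_le_of_norm_le (((i3.const_mul ε).add (i4.div_const ε)).const_mul _)
    (Filter.Eventually.of_forall fun y => ?_)
  rw [Real.norm_eq_abs, ← mul_sub, abs_mul]
  have hS0 : 0 ≤ ∑ j, badInd L δ η (y j) := Finset.sum_nonneg fun j _ => badInd_nonneg _ _ _ _
  have hTd : 0 ≤ T ^ d := by positivity
  by_cases hb : ∀ j, |y j| ≤ L ∧ η < |(|y j| - δ)|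
  · have : ∏ j, g j (y j) = ∏ j, φ j (y j) :=
      Finset.prod_congr rfl fun j _ => h j _ (hb j).1 (hb j).2
    rw [this, sub_self, abs_zero, mul_zero]
    positivity
  · push Not at hb
    obtain ⟨i, hi⟩ := hb
    have h1 : 1 ≤ ∑ j, badInd L δ η (y j) := by
      have h2 := Finset.single_le_sum (f := fun j => badInd L δ η (y j))
        (fun j _ => badInd_nonneg _ _ _ _) (Finset.mem_univ i)
      have h3 : badInd L δ η (y i) = 1 := by
        unfold badInd
        rw [if_neg]
        rintro ⟨h3, h4⟩
        exact absurd h4 (not_lt.2 (hi h3))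
      simpa [h3] using h2
    have p1 := prod_le_of_linear_growth hφ0 hφT y
    have p2 := prod_le_of_linear_growth hg0 hgT y
    have q1 : 0 ≤ ∏ j, φ j (y j) := Finset.prod_nonneg fun j _ => hφ0 j _
    have q2 : 0 ≤ ∏ j, g j (y j) := Finset.prod_nonneg fun j _ => hg0 j _
    have h5 : |∏ j, φ j (y j) - ∏ j, g j (y j)| ≤ T ^ d * ∏ j, (1 + |y j|) := by
      rw [abs_le]; constructor <;> linarith
    have q3 : 0 ≤ ∏ j, (1 + |y j|) := Finset.prod_nonneg fun j _ => by positivity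
    set a := |W y| * ∏ j, (1 + |y j|) with ha
    have ha2 : (W y * ∏ j, (1 + |y j|)) ^ 2 = a ^ 2 := by rw [ha, mul_pow, mul_pow, sq_abs]
    -- a weighted inequality instead of Cauchy–Schwarz, so that no square root of the mass of the
    -- exceptional set appears
    have h6 : a ≤ ε * a ^ 2 + 1 / ε := by
      have e : ε * a ^ 2 + 1 / ε - a = ε * ((a - 1 / (2 * ε)) ^ 2 + 3 / (4 * ε ^ 2)) := by
        field_simp; ring
      have : 0 ≤ ε * ((a - 1 / (2 * ε)) ^ 2 + 3 / (4 * ε ^ 2)) := by positivity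
      linarith
    have h7 : 1 / ε ≤ (∑ j, badInd L δ η (y j)) / ε := by gcongr
    calc |W y| * |∏ j, φ j (y j) - ∏ j, g j (y j)| ≤ |W y| * (T ^ d * ∏ j, (1 + |y j|)) := by gcongr
      _ = T ^ d * a := by rw [ha]; ring
      _ ≤ _ := by rw [ha2]; gcongr; linarith

/-- Passage from Fourier transforms to test functions: if the transform of the law of `Y` is close
to that of the signed measure with Gaussian density `W`, so are the integrals of products of
sandwiched functions. -/
theorem abs_integral_prod_sub_le (hd : d ≤ 4) {Ω : Type*} [MeasurableSpace Ω] {P : Measure Ω}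
    [IsProbabilityMeasure P] {Y : Ω → Fin d → ℝ} (hY : ∀ j, AllMoments P fun ω => Y ω j)
    {W : (Fin d → ℝ) → ℝ} (hW : AllMoments (stdGauss d) W) {A r D N B E T L δ η ε : ℝ}
    (hN : 0 ≤ N) (hA : 0 ≤ A) (hε : 0 < ε) (hT : 0 ≤ T) (hL : 1 ≤ L) {M : ℕ} (hM : Even M)
    (hM4 : 4 ≤ M)
    (hb : ∀ t, |(wchf P (fun _ => 1) Y t).re - (wchf (stdGauss d) W (fun y => y) t).re|
      ≤ A * freqBound r D N t)
    {φ : Fin d → ℝ → ℝ} (hφ : ∀ j, IsSandwiched B E T L δ η (φ j)) :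
    |(∫ ω, ∏ j, φ j (Y ω j) ∂P) - ∫ y, W y * ∏ j, φ j (y j) ∂(stdGauss d)|
      ≤ A * (N ^ (-r) * (B * Real.pi) ^ d + N ^ (-(D / 4)) * ((B + E) * tailMass) ^ d)
        + T ^ d * (16 * (L ^ 4 / L ^ M) * ∑ j, ∫ ω, Y ω j ^ M ∂P)
        + T ^ d * (ε * (∫ y, (W y * ∏ j, (1 + |y j|)) ^ 2 ∂(stdGauss d))
          + d * (∫ x, badInd L δ η x ∂(gaussianReal 0 1)) / ε) := by
  have hφm := fun j => (hφ j).measurable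
  have hφ0 := fun j => (hφ j).nonneg
  have hφT := fun j => (hφ j).le
  choose m₁ g₁ hc₁ hm₁ h0₁ hle₁ heq₁ using fun j => (hφ j).lower
  choose m₂ g₂ hc₂ hm₂ h0₂ hT₂ hle₂ heq₂ using fun j => (hφ j).upper
  have hT₁ : ∀ j y, g₁ j y ≤ T * (1 + |y|) := fun j y => (hle₁ j y).trans (hφT j y)
  have hYm := aemeasurable_of_allMoments hY
  have hYG : ∀ j : Fin d, AllMoments (stdGauss d) fun y => y j := allMoments_apply_stdGauss
  have f₁ := abs_integral_sub_integral_le hc₁ (integrable_const (1 : ℝ)) hYm hW.integrable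
    aemeasurable_id hN hA hb
  have f₂ := abs_integral_sub_integral_le hc₂ (integrable_const (1 : ℝ)) hYm hW.integrable
    aemeasurable_id hN hA hb
  simp only [one_mul, id] at f₁ f₂
  have s₁ := abs_integral_mul_sub_le hε hT hW hφm hφ0 hφT hm₁ h0₁ hT₁ heq₁
  have s₂ := abs_integral_mul_sub_le hε hT hW hφm hφ0 hφT hm₂ h0₂ hT₂ heq₂
  have iφ := (allMoments_prod_comp hY hφm hφ0 hφT).integrable
  have i₁ := (allMoments_prod_comp hY hm₁ h0₁ hT₁).integrable
  have i₂ := (allMoments_prod_comp hY hm₂ h0₂ hT₂).integrable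
  have iM : ∀ j, Integrable (fun ω => Y ω j ^ M) P := fun j => ((hY j).pow M).integrable
  have l₁ : ∫ ω, ∏ j, g₁ j (Y ω j) ∂P ≤ ∫ ω, ∏ j, φ j (Y ω j) ∂P :=
    integral_mono i₁ iφ fun ω => Finset.prod_le_prod (fun j _ => h0₁ j _) fun j _ => hle₁ j _
  have l₂ : ∫ ω, ∏ j, φ j (Y ω j) ∂P ≤ (∫ ω, ∏ j, g₂ j (Y ω j) ∂P)
      + T ^ d * (16 * (L ^ 4 / L ^ M) * ∑ j, ∫ ω, Y ω j ^ M ∂P) := by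
    have iS : Integrable (fun ω => T ^ d * (16 * (L ^ 4 / L ^ M) * ∑ j, Y ω j ^ M)) P :=
      ((integrable_finsetSum _ fun j _ => iM j).const_mul _).const_mul _
    rw [← integral_finsetSum _ fun j _ => iM j, ← integral_const_mul, ← integral_const_mul,
      ← integral_add i₂ iS]
    refine integral_mono iφ (i₂.add iS) fun ω => ?_
    have q : 0 ≤ ∏ j, g₂ j (Y ω j) := Finset.prod_nonneg fun j _ => h0₂ j _
    by_cases hbad : ∃ j, L < |Y ω j|
    · have h1 := prod_one_add_abs_le_of_lt hL hd hM hM4 hbad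
      have h2 := prod_le_of_linear_growth hφ0 hφT (Y ω)
      have h3 := h2.trans (mul_le_mul_of_nonneg_left h1 (by positivity))
      beta_reduce
      linarith
    · push Not at hbad
      have h1 : ∏ j, φ j (Y ω j) ≤ ∏ j, g₂ j (Y ω j) :=
        Finset.prod_le_prod (fun j _ => hφ0 j _) fun j _ => hle₂ j _ (hbad j)
      have h2 : 0 ≤ ∑ j, Y ω j ^ M := Finset.sum_nonneg fun j _ => hM.pow_nonneg _
      have h3 : 0 ≤ T ^ d * (16 * (L ^ 4 / L ^ M) * ∑ j, Y ω j ^ M) := by positivity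
      beta_reduce
      linarith
  have hS : 0 ≤ T ^ d * (16 * (L ^ 4 / L ^ M) * ∑ j, ∫ ω, Y ω j ^ M ∂P) := by
    have : 0 ≤ ∑ j, ∫ ω, Y ω j ^ M ∂P :=
      Finset.sum_nonneg fun j _ => integral_nonneg fun ω => hM.pow_nonneg _
    positivity
  have := abs_le.1 f₁
  have := abs_le.1 f₂
  have := abs_le.1 s₁
  have := abs_le.1 s₂
  rw [abs_le]
  constructor <;> linarith

end

/-! ### Choice of the smoothing parameters -/

/-- The exponent of the frequency cutoff for indicator functions of width at least `N ^ (-C)`. Four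
densities of size `N ^ (9 * C + 5)` against the factor `N ^ (-(freqExp C / 4))` leave `N ^ (-2)`. -/
noncomputable def freqExp (C : ℝ) : ℝ := 144 * C + 88

/-- The number of moments needed for indicator functions of width at least `N ^ (-C)`: tails beyond
`N ^ (1 / 64)` must be smaller than `N ^ (-(4 * C + 2))`, since the test functions reach the size
`N ^ (4 * C)`. -/
noncomputable def momDeg (C : ℝ) : ℕ := 2 * (⌈128 * C⌉₊ + 66)

lemma even_momDeg (C : ℝ) : Even (momDeg C) := even_two_mul _

lemma le_momDeg (C : ℝ) : 132 ≤ momDeg C := by unfold momDeg; omega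

lemma le_cast_momDeg (C : ℝ) : 256 * C + 132 ≤ momDeg C := by
  have := Nat.le_ceil (128 * C)
  unfold momDeg; push_cast; linarith

/-- The one-dimensional factors of the test functions. -/
def IsFactor (δ : ℝ) (φ : ℝ → ℝ) : Prop := φ = F δ ∨ (φ = fun y => |y|) ∨ φ = fun _ => 1

/-- With tails beyond `N ^ (1 / 64)`, the densities are bounded by a multiple of `N ^ (1 / 32)`
uniformly in `δ`; only their decay at infinity feels the width `δ` and the slopes of width
`N ^ (-(8 * C + 4))`. -/
lemma IsFactor.isSandwiched {C N δ : ℝ} (hC : 0 < C) (hN : 1 ≤ N) (hδ : N ^ (-C) ≤ δ)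
    {φ : ℝ → ℝ} (h : IsFactor δ φ) :
    IsSandwiched (3 / cosMass * N ^ (1 / 32 : ℝ)) (6 / cosMass * N ^ (9 * C + 4)) (N ^ C)
      (N ^ (1 / 64 : ℝ)) δ (N ^ (-(8 * C + 4))) φ := by
  have hκ := cosMass_pos
  have hN0 : 0 < N := by linarith
  have hL : 1 ≤ N ^ (1 / 64 : ℝ) := Real.one_le_rpow hN (by norm_num)
  have hL2 : (N ^ (1 / 64 : ℝ)) ^ 2 = N ^ (1 / 32 : ℝ) := by
    rw [← Real.rpow_natCast, ← Real.rpow_mul hN0.le]; norm_num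
  have hT : 1 ≤ N ^ C := Real.one_le_rpow hN hC.le
  have hE : 1 ≤ N ^ (9 * C + 4) := Real.one_le_rpow hN (by linarith)
  have hB1 : 3 * (N ^ (1 / 64 : ℝ)) ^ 2 / cosMass ≤ 3 / cosMass * N ^ (1 / 32 : ℝ) := by
    rw [hL2]; apply le_of_eq; ring
  have hE1 : 6 / cosMass ≤ 6 / cosMass * N ^ (9 * C + 4) :=
    le_mul_of_one_le_right (by positivity) hE
  rcases h with rfl | rfl | rfl
  · have hδ0 : 0 < δ := lt_of_lt_of_le (by positivity) hδ
    have hinv : 1 / δ ≤ N ^ C := by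
      rw [div_le_iff₀ hδ0]
      calc (1 : ℝ) = N ^ C * N ^ (-C) := by
            rw [← Real.rpow_add hN0, add_neg_cancel, Real.rpow_zero]
        _ ≤ _ := by gcongr
    refine (isSandwiched_F (by positivity) (le_trans ?_ hδ) ?_).mono ?_ ?_
    · exact Real.rpow_le_rpow_of_exponent_le hN (by linarith)
    · refine le_trans ?_ hinv
      gcongr; linarith
    · have : 1 ≤ N ^ (1 / 32 : ℝ) := Real.one_le_rpow hN (by norm_num)
      rw [div_mul_eq_mul_div]
      gcongr; linarith
    · have e : 1 / (cosMass * (δ * N ^ (-(8 * C + 4)))) = 1 / cosMass * (1 / δ * N ^ (8 * C + 4)) := by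
        rw [Real.rpow_neg hN0.le]; field_simp
      have e2 : N ^ (9 * C + 4) = N ^ C * N ^ (8 * C + 4) := by
        rw [← Real.rpow_add hN0]; congr 1; ring
      rw [e, e2]
      gcongr
      norm_num
  · exact (isSandwiched_abs hL hT).mono hB1 hE1
  · exact (isSandwiched_one hL hT).mono hB1 hE1

lemma pow_le_of_le_of_le_four {d : ℕ} (hd : d ≤ 4) {x c N a : ℝ} (hx : 0 ≤ x) (hc : 1 ≤ c)
    (hN : 1 ≤ N) (ha : 0 ≤ a) (h : x ≤ c * N ^ a) : x ^ d ≤ c ^ 4 * N ^ (4 * a) := by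
  have h1 : 1 ≤ c * N ^ a := one_le_mul_of_one_le_of_one_le hc (Real.one_le_rpow hN ha)
  calc x ^ d ≤ (c * N ^ a) ^ d := pow_le_pow_left₀ hx h d
    _ ≤ (c * N ^ a) ^ 4 := pow_le_pow_right₀ h1 hd
    _ = c ^ 4 * N ^ (4 * a) := by
      rw [mul_pow, ← Real.rpow_natCast (N ^ a), ← Real.rpow_mul (by linarith), mul_comm a]
      norm_num

/-- The smoothing errors are negligible, and smoothing costs a factor `N ^ (1 / 8)`. -/
theorem exists_abs_integral_prod_sub_le {d : ℕ} (hd : d ≤ 4) {K A C S : ℝ} (hK : 1 ≤ K)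
    (hA : 0 ≤ A) (hC : 0 < C) (hS : 0 ≤ S) :
    ∃ A', 0 ≤ A' ∧ ∀ N : ℝ, 1 ≤ N → ∀ δ, N ^ (-C) ≤ δ → ∀ {Ω : Type w} [MeasurableSpace Ω]
      (P : Measure Ω) [IsProbabilityMeasure P] (Y : Ω → Fin d → ℝ),
      (∀ j, AllMoments P fun ω => Y ω j) → (∀ j, ∫ ω, Y ω j ^ momDeg C ∂P ≤ S) →
      ∀ W : (Fin d → ℝ) → ℝ, AllMoments (stdGauss d) W →
      (∀ y, |W y| ≤ K ^ 2 * edgeMajorant d y) → ∀ r : ℝ,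
      (∀ t, |(wchf P (fun _ => 1) Y t).re - (wchf (stdGauss d) W (fun y => y) t).re|
        ≤ A * freqBound r (freqExp C) N t) →
      ∀ φ : Fin d → ℝ → ℝ, (∀ j, IsFactor δ (φ j)) →
      |(∫ ω, ∏ j, φ j (Y ω j) ∂P) - ∫ y, W y * ∏ j, φ j (y j) ∂(stdGauss d)|
        ≤ A' * (N ^ (1 / 8 - r) + N ^ (-2 : ℝ)) := by
  have hκ := cosMass_pos
  have htm := tailMass_nonneg
  obtain ⟨c₁, hc₁, hc₁1⟩ : ∃ c, c = 3 / cosMass * Real.pi + 1 ∧ 1 ≤ c :=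
    ⟨_, rfl, by have := Real.pi_pos; have : 0 ≤ 3 / cosMass * Real.pi := by positivity
                linarith⟩
  obtain ⟨c₂, hc₂, hc₂1⟩ : ∃ c, c = 9 / cosMass * tailMass + 1 ∧ 1 ≤ c :=
    ⟨_, rfl, by have : 0 ≤ 9 / cosMass * tailMass := by positivity
                linarith⟩
  obtain ⟨R, hR, hR0⟩ : ∃ R, R = ∫ y, (edgeMajorant d y * ∏ j, (1 + |y j|)) ^ 2 ∂(stdGauss d)
    ∧ 0 ≤ R := ⟨_, rfl, integral_nonneg fun y => sq_nonneg _⟩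
  obtain ⟨G, hG, hG0⟩ : ∃ G, G = ∫ x, x ^ (2 * momDeg C) ∂(gaussianReal 0 1) ∧ 0 ≤ G :=
    ⟨_, rfl, integral_nonneg fun y => (even_two_mul _).pow_nonneg _⟩
  refine ⟨A * (c₁ ^ 4 + c₂ ^ 4) + 64 * S + (K ^ 4 * R + 4 * (G + 4)), by positivity, ?_⟩
  intro N hN δ hδ Ω _ P _ Y hY hYM W hW hWle r hb φ hφ
  have hN0 : 0 < N := by linarith
  have hL : 1 ≤ N ^ (1 / 64 : ℝ) := Real.one_le_rpow hN (by norm_num)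
  have hT : 0 ≤ N ^ C := by positivity
  have hε : 0 < N ^ (-(4 * C + 2)) := by positivity
  have hmain := abs_integral_prod_sub_le hd hY hW hN0.le hA hε hT hL (even_momDeg C)
    (by linarith [le_momDeg C]) hb fun j => (hφ j).isSandwiched hC hN hδ
  refine hmain.trans ?_
  have hn2 : 0 < N ^ (-2 : ℝ) := by positivity
  have hnr : 0 < N ^ (1 / 8 - r) := by positivity
  have hadd : ∀ a b : ℝ, N ^ a * N ^ b = N ^ (a + b) := fun a b => (Real.rpow_add hN0 a b).symm
  -- inversion error
  have e1 : N ^ (-r) * (3 / cosMass * N ^ (1 / 32 : ℝ) * Real.pi) ^ d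
      ≤ c₁ ^ 4 * N ^ (1 / 8 - r) := by
    have h1 := pow_le_of_le_of_le_four hd (x := 3 / cosMass * N ^ (1 / 32 : ℝ) * Real.pi)
      (c := c₁) (N := N) (a := 1 / 32) (by have := Real.pi_pos; positivity) hc₁1 hN (by norm_num)
      (by rw [hc₁]; have : 0 ≤ N ^ (1 / 32 : ℝ) := by positivity
          nlinarith)
    calc _ ≤ N ^ (-r) * (c₁ ^ 4 * N ^ (4 * (1 / 32) : ℝ)) := by gcongr
      _ = c₁ ^ 4 * (N ^ (-r) * N ^ (4 * (1 / 32) : ℝ)) := by ring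
      _ = _ := by rw [hadd]; congr 2; ring
  have e2 : N ^ (-(freqExp C / 4)) * ((3 / cosMass * N ^ (1 / 32 : ℝ)
      + 6 / cosMass * N ^ (9 * C + 4)) * tailMass) ^ d ≤ c₂ ^ 4 * N ^ (-2 : ℝ) := by
    have h0 : N ^ (1 / 32 : ℝ) ≤ N ^ (9 * C + 5) :=
      Real.rpow_le_rpow_of_exponent_le hN (by linarith)
    have h0' : N ^ (9 * C + 4) ≤ N ^ (9 * C + 5) :=
      Real.rpow_le_rpow_of_exponent_le hN (by linarith)
    have h1 := pow_le_of_le_of_le_four hd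
      (x := (3 / cosMass * N ^ (1 / 32 : ℝ) + 6 / cosMass * N ^ (9 * C + 4)) * tailMass)
      (c := c₂) (N := N) (a := 9 * C + 5) (by positivity) hc₂1 hN (by linarith) (by
        calc (3 / cosMass * N ^ (1 / 32 : ℝ) + 6 / cosMass * N ^ (9 * C + 4)) * tailMass
            ≤ (3 / cosMass * N ^ (9 * C + 5) + 6 / cosMass * N ^ (9 * C + 5)) * tailMass := by
              gcongr
          _ = 9 / cosMass * tailMass * N ^ (9 * C + 5) := by ring
          _ ≤ _ := by
              rw [hc₂]
              have : 0 ≤ N ^ (9 * C + 5) := by positivity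
              nlinarith)
    calc _ ≤ N ^ (-(freqExp C / 4)) * (c₂ ^ 4 * N ^ (4 * (9 * C + 5))) := by gcongr
      _ = c₂ ^ 4 * (N ^ (-(freqExp C / 4)) * N ^ (4 * (9 * C + 5))) := by ring
      _ = _ := by rw [hadd, freqExp]; congr 2; ring
  have hTd : (N ^ C) ^ d ≤ N ^ (4 * C) := by
    simpa using pow_le_of_le_of_le_four hd (x := N ^ C) (c := 1) (N := N) (a := C) (by positivity)
      le_rfl hN hC.le (by simp)
  have hTd0 : 0 ≤ (N ^ C) ^ d := by positivity
  have hMc := le_cast_momDeg C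
  have hLp : ∀ m : ℕ, (N ^ (1 / 64 : ℝ)) ^ m = N ^ ((m : ℝ) / 64) := fun m => by
    rw [← Real.rpow_natCast, ← Real.rpow_mul hN0.le]; congr 1; ring
  have hd' : (d : ℝ) ≤ 4 := by exact_mod_cast hd
  -- tails of the walk
  have e3 : (N ^ C) ^ d * (16 * ((N ^ (1 / 64 : ℝ)) ^ 4 / (N ^ (1 / 64 : ℝ)) ^ momDeg C)
      * ∑ j, ∫ ω, Y ω j ^ momDeg C ∂P) ≤ 64 * S * N ^ (-2 : ℝ) := by
    have h1 : ∑ j, ∫ ω, Y ω j ^ momDeg C ∂P ≤ 4 * S := by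
      refine (Finset.sum_le_sum fun j _ => hYM j).trans ?_
      rw [Finset.sum_const, Finset.card_univ, Fintype.card_fin, nsmul_eq_mul]
      gcongr
    have h0 : 0 ≤ ∑ j, ∫ ω, Y ω j ^ momDeg C ∂P :=
      Finset.sum_nonneg fun j _ => integral_nonneg fun ω => (even_momDeg C).pow_nonneg _
    have h2 : (N ^ (1 / 64 : ℝ)) ^ 4 / (N ^ (1 / 64 : ℝ)) ^ momDeg C ≤ N ^ (-(4 * C + 2)) := by
      rw [hLp, hLp, ← Real.rpow_sub hN0]
      refine Real.rpow_le_rpow_of_exponent_le hN ?_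
      push_cast; linarith
    calc _ ≤ N ^ (4 * C) * (16 * N ^ (-(4 * C + 2)) * (4 * S)) := by gcongr
      _ = 64 * S * (N ^ (4 * C) * N ^ (-(4 * C + 2))) := by ring
      _ = _ := by rw [hadd]; congr 2; ring
  -- the exceptional set of the Gaussian vector
  have e4 : (N ^ C) ^ d * (N ^ (-(4 * C + 2)) * (∫ y, (W y * ∏ j, (1 + |y j|)) ^ 2 ∂(stdGauss d))
      + d * (∫ x, badInd (N ^ (1 / 64 : ℝ)) δ (N ^ (-(8 * C + 4))) x ∂(gaussianReal 0 1))
        / N ^ (-(4 * C + 2))) ≤ (K ^ 4 * R + 4 * (G + 4)) * N ^ (-2 : ℝ) := by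
    have h1 : ∫ y, (W y * ∏ j, (1 + |y j|)) ^ 2 ∂(stdGauss d) ≤ K ^ 4 * R := by
      rw [hR, ← integral_const_mul]
      have hp := allMoments_prod_one_add_abs (d := d) allMoments_apply_stdGauss
      refine integral_mono ((hW.mul hp).pow 2).integrable
        ((((allMoments_edgeMajorant d).mul hp).pow 2).integrable.const_mul _) fun y => ?_
      have h2 : |W y * ∏ j, (1 + |y j|)| ≤ K ^ 2 * (edgeMajorant d y * ∏ j, (1 + |y j|)) := by
        have hp0 : 0 ≤ ∏ j, (1 + |y j|) := Finset.prod_nonneg fun j _ => by positivity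
        rw [abs_mul, abs_of_nonneg hp0, ← mul_assoc]
        exact mul_le_mul_of_nonneg_right (hWle y) hp0
      have h3 := pow_le_pow_left₀ (abs_nonneg _) h2 2
      rw [sq_abs] at h3
      refine h3.trans_eq ?_
      ring
    have h2 := integral_badInd_le (L := N ^ (1 / 64 : ℝ)) (δ := δ) (η := N ^ (-(8 * C + 4)))
      (by positivity) (by positivity) (even_two_mul (momDeg C))
    rw [← hG, hLp] at h2
    have h3 : G / N ^ (((2 * momDeg C : ℕ) : ℝ) / 64) ≤ G * N ^ (-(8 * C + 4)) := by
      rw [div_eq_mul_inv, ← Real.rpow_neg hN0.le]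
      gcongr
      push_cast; linarith
    have h4 : ∫ x, badInd (N ^ (1 / 64 : ℝ)) δ (N ^ (-(8 * C + 4))) x ∂(gaussianReal 0 1)
        ≤ (G + 4) * N ^ (-(8 * C + 4)) := by linarith
    have h5 : 0 ≤ ∫ x, badInd (N ^ (1 / 64 : ℝ)) δ (N ^ (-(8 * C + 4))) x ∂(gaussianReal 0 1) :=
      integral_nonneg fun x => badInd_nonneg _ _ _ _
    have h6 : 0 ≤ ∫ y, (W y * ∏ j, (1 + |y j|)) ^ 2 ∂(stdGauss d) :=
      integral_nonneg fun x => sq_nonneg _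
    calc _ ≤ N ^ (4 * C) * (N ^ (-(4 * C + 2)) * (K ^ 4 * R)
          + 4 * ((G + 4) * N ^ (-(8 * C + 4))) / N ^ (-(4 * C + 2))) := by gcongr
      _ = K ^ 4 * R * (N ^ (4 * C) * N ^ (-(4 * C + 2)))
          + 4 * (G + 4) * (N ^ (4 * C) * (N ^ (-(8 * C + 4)) * N ^ (4 * C + 2))) := by
          rw [Real.rpow_neg hN0.le (4 * C + 2), div_inv_eq_mul]; ring
      _ = _ := by
          rw [hadd, hadd, hadd, add_mul]
          congr 3 <;> ring
  have e5 := mul_le_mul_of_nonneg_left (add_le_add e1 e2) hA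
  have x1 : 0 ≤ A * c₁ ^ 4 * N ^ (-2 : ℝ) := by positivity
  have x2 : 0 ≤ A * c₂ ^ 4 * N ^ (1 / 8 - r) := by positivity
  have x3 : 0 ≤ 64 * S * N ^ (1 / 8 - r) := by positivity
  have x4 : 0 ≤ (K ^ 4 * R + 4 * (G + 4)) * N ^ (1 / 8 - r) := by positivity
  refine (add_le_add (add_le_add e5 e3) e4).trans ?_
  linarith

/-! ### The Edgeworth expansion for walks along frames -/

/-- Independent copies of a centred variable of variance one all of whose moments are finite, those
of order up to `M` being bounded by `K`. -/
structure IidStandardized {Ω : Type*} [MeasurableSpace Ω] (μ : Measure Ω) (K : ℝ) (M : ℕ)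
    (ξ : ℕ → Ω → ℝ) : Prop where
  indep : iIndepFun ξ μ
  ident : ∀ i, IdentDistrib (ξ i) (ξ 0) μ μ
  allMoments : AllMoments μ (ξ 0)
  mean : ∫ ω, ξ 0 ω ∂μ = 0
  var : ∫ ω, ξ 0 ω ^ 2 ∂μ = 1
  moment_le : ∀ j, j ≤ M → ∫ ω, |ξ 0 ω| ^ j ∂μ ≤ K

lemma walk_apply {d : ℕ} (s : Finset ℕ) (v : ℕ → Fin d → ℝ) (a : ℕ → ℝ) (j : Fin d) :
    walk s v a j = ∑ k ∈ s, v k j * a k := by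
  simp [walk, Finset.sum_apply, mul_comm]

lemma dotProduct_walk {d : ℕ} (s : Finset ℕ) (v : ℕ → Fin d → ℝ) (a : ℕ → ℝ) (t : Fin d → ℝ) :
    t ⬝ᵥ walk s v a = ∑ k ∈ s, (t ⬝ᵥ v k) * a k := by
  simp [walk, dotProduct_sum, dotProduct_smul, mul_comm]

section

variable {Ω : Type*} [MeasurableSpace Ω] {μ : Measure Ω} {K : ℝ} {M : ℕ} {ξ : ℕ → Ω → ℝ}

lemma IidStandardized.standardized (h : IidStandardized μ K M ξ) (hM : 6 ≤ M) :
    Standardized μ K (ξ 0) :=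
  ⟨h.allMoments, h.mean, h.var, fun j _ hj => h.moment_le j (hj.trans hM)⟩

lemma IidStandardized.allMoments_walk (h : IidStandardized μ K M ξ) {d : ℕ} (s : Finset ℕ)
    (v : ℕ → Fin d → ℝ) (j : Fin d) : AllMoments μ fun ω => walk s v (fun i => ξ i ω) j := by
  simp_rw [walk_apply]
  exact allMoments_sum_mul h.ident h.allMoments s fun k => v k j

lemma IidStandardized.wchf_walk (h : IidStandardized μ K M ξ) {d : ℕ} (s : Finset ℕ)
    (v : ℕ → Fin d → ℝ) (t : Fin d → ℝ) :
    wchf μ (fun _ => 1) (fun ω => walk s v fun i => ξ i ω) t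
      = ∏ k ∈ s, chf μ (ξ 0) (t ⬝ᵥ v k) := by
  rw [wchf, ← integral_cexp_sum_eq_prod h.indep h.ident s fun k => t ⬝ᵥ v k]
  simp_rw [dotProduct_walk, Complex.ofReal_one, one_mul]

/-- The even moments of the walk are bounded uniformly in `N`. -/
lemma IidStandardized.integral_walk_pow_le [IsProbabilityMeasure μ] (h : IidStandardized μ K M ξ)
    (hM : Even M) (hM0 : 0 < M) (hK : 0 ≤ K) {d : ℕ} {s : Finset ℕ} {v : ℕ → Fin d → ℝ} {A N : ℝ}
    (hF : IsFrame A N s v) (hN : 1 ≤ N) (hAN : A ≤ N) (j : Fin d) :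
    ∫ ω, walk s v (fun i => ξ i ω) j ^ M ∂μ ≤ Real.exp (2 ^ M * K * 2) := by
  simp_rw [walk_apply]
  have hN0 : 0 < N := by linarith
  have h1 : ∀ k ∈ s, |v k j| ≤ 1 := by
    intro k hk
    have h2 := hF.six (Pi.single j 1)
    simp only [nsq_single, single_dotProduct, one_mul, one_pow, mul_one] at h2
    have h3 := Finset.single_le_sum (f := fun k => v k j ^ 6)
      (fun k _ => (by decide : Even 6).pow_nonneg _) hk
    have h4 : A / N ^ 2 ≤ 1 := by
      rw [div_le_one (by positivity)]; nlinarith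
    have h5 : |v k j| ^ 6 ≤ 1 ^ 6 := by
      rw [(by decide : Even 6).pow_abs]; linarith
    exact le_of_pow_le_pow_left₀ (by norm_num) zero_le_one h5
  have h2 := one_add_integral_sum_pow_le h.indep h.ident h.allMoments h.mean hM hM0 hK h.moment_le s
    (fun k => v k j) h1
  have h3 := hF.sum_apply_sq_le hN hAN j
  have h4 : Real.exp (2 ^ M * K * ∑ k ∈ s, v k j ^ 2) ≤ Real.exp (2 ^ M * K * 2) := by
    gcongr
  linarith

end

lemma one_le_edgeMajorant (d : ℕ) (y : Fin d → ℝ) : 1 ≤ edgeMajorant d y := by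
  unfold edgeMajorant
  have h1 : 0 ≤ ∑ β : Fin 4 → Fin d, |hermiteMulti β y| := Finset.sum_nonneg fun _ _ => abs_nonneg _
  have h2 : 0 ≤ ∑ ρ : Fin 3 → Fin d, ∑ β : Fin 3 → Fin d, |hermiteMulti (Fin.append β ρ) y| :=
    Finset.sum_nonneg fun _ _ => Finset.sum_nonneg fun _ _ => abs_nonneg _
  linarith

/-- Second order Edgeworth expansion, and Gaussian approximation, of the walk along a well spread
frame. -/
theorem exists_abs_integral_walk_sub_le {d : ℕ} (hd : d ≤ 4) {K A C : ℝ} (hK : 1 ≤ K) (hA : 1 ≤ A)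
    (hC : 0 < C) :
    ∃ A', 0 ≤ A' ∧ ∀ᶠ N : ℝ in atTop, ∀ {Ω : Type w} [MeasurableSpace Ω] (μ : Measure Ω)
      [IsProbabilityMeasure μ] (ξ : ℕ → Ω → ℝ), IidStandardized μ K (momDeg C) ξ →
      ∀ (s : Finset ℕ) (v : ℕ → Fin d → ℝ), IsFrame A N s v →
      IsSpread (freqExp C) (1 / (20 * K)) N s v → ∀ δ, N ^ (-C) ≤ δ →
      ∀ φ : Fin d → ℝ → ℝ, (∀ j, IsFactor δ (φ j)) →
      |(∫ ω, ∏ j, φ j (walk s v (fun i => ξ i ω) j) ∂μ)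
          - ∫ y, edgeWeight (mom μ (ξ 0) 3) (mom μ (ξ 0) 4) s v y * ∏ j, φ j (y j) ∂(stdGauss d)|
        ≤ A' * N ^ (-(3 / 2) : ℝ) ∧
      |(∫ ω, ∏ j, φ j (walk s v (fun i => ξ i ω) j) ∂μ) - ∫ y, ∏ j, φ j (y j) ∂(stdGauss d)|
        ≤ A' * N ^ (-(1 / 2) : ℝ) := by
  obtain ⟨A₁, hA₁, h₁⟩ := exists_abs_re_prod_chf_sub_edgeFT_le.{w} (D := freqExp C) hK hA
  obtain ⟨A₂, hA₂, h₂⟩ := exists_abs_re_prod_chf_sub_exp_le.{w} (D := freqExp C) hK hA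
  have hS := (Real.exp_pos (2 ^ momDeg C * K * 2)).le
  obtain ⟨B₁, hB₁, k₁⟩ := exists_abs_integral_prod_sub_le.{w} hd hK hA₁ hC hS
  obtain ⟨B₂, hB₂, k₂⟩ := exists_abs_integral_prod_sub_le.{w} hd hK hA₂ hC hS
  refine ⟨2 * B₁ + 2 * B₂, by positivity, ?_⟩
  filter_upwards [h₁, h₂, eventually_ge_atTop (1 : ℝ), eventually_ge_atTop A] with N h₁ h₂ hN hAN
  intro Ω _ μ _ ξ hξ s v hF hSp δ hδ φ hφ
  have hM6 : 6 ≤ momDeg C := by linarith [le_momDeg C]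
  have hst := hξ.standardized hM6
  have hm3 : |mom μ (ξ 0) 3| ≤ K := hst.abs_mom_le (by norm_num) (by norm_num)
  have hm4 : |mom μ (ξ 0) 4| ≤ K := hst.abs_mom_le (by norm_num) (by norm_num)
  have hY := hξ.allMoments_walk s v
  have hYM := hξ.integral_walk_pow_le (even_momDeg C) (by linarith) (by linarith) hF hN hAN
  have hpow : ∀ {a b : ℝ}, a ≤ b → N ^ a ≤ N ^ b := fun h =>
    Real.rpow_le_rpow_of_exponent_le hN h
  constructor
  · have h := k₁ N hN δ hδ μ _ hY hYM _ (allMoments_edgeWeight (mom μ (ξ 0) 3) (mom μ (ξ 0) 4) s v)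
      (fun y => abs_edgeWeight_le hF hN hAN hK hm3 hm4 y) (7 / 4) (fun t => by
        rw [hξ.wchf_walk, wchf, integral_edgeWeight_mul_cexp, Complex.ofReal_re]
        exact h₁ μ (ξ 0) s v hd hst hF hSp t) φ hφ
    have e1 : N ^ (1 / 8 - 7 / 4 : ℝ) ≤ N ^ (-(3 / 2) : ℝ) := hpow (by norm_num)
    have e2 : N ^ (-2 : ℝ) ≤ N ^ (-(3 / 2) : ℝ) := hpow (by norm_num)
    have e3 := mul_le_mul_of_nonneg_left (add_le_add e1 e2) hB₁
    have e4 : 0 ≤ B₂ * N ^ (-(3 / 2) : ℝ) := by positivity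
    linarith
  · have h := k₂ N hN δ hδ μ _ hY hYM (fun _ => 1) (AllMoments.const 1)
      (fun y => by
        rw [abs_one]
        exact one_le_mul_of_one_le_of_one_le (one_le_pow₀ hK) (one_le_edgeMajorant d y)) (3 / 4)
      (fun t => by
        rw [hξ.wchf_walk, wchf]
        simp_rw [Complex.ofReal_one, one_mul]
        rw [integral_stdGauss_cexp, Complex.ofReal_re]
        exact h₂ μ (ξ 0) s v hd hst hF hSp t) φ hφ
    simp only [one_mul] at h
    have e1 : N ^ (1 / 8 - 3 / 4 : ℝ) ≤ N ^ (-(1 / 2) : ℝ) := hpow (by norm_num)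
    have e2 : N ^ (-2 : ℝ) ≤ N ^ (-(1 / 2) : ℝ) := hpow (by norm_num)
    have e3 := mul_le_mul_of_nonneg_left (add_le_add e1 e2) hB₂
    have e4 : 0 ≤ B₁ * N ^ (-(1 / 2) : ℝ) := by positivity
    linarith

/-! ### Coefficients and step vectors of the Weyl polynomial -/

lemma b_eq (N : ℝ) (k : ℕ) (x : ℝ) : b N k x = Real.sqrt N * wcoef x k := by
  unfold b wcoef; ring

lemma deriv_b {N x : ℝ} (hx : 0 < x) (k : ℕ) :
    deriv (b N k) x = Real.sqrt N * (wcoef x k * dev x k) := by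
  have h1 : HasDerivAt (fun y : ℝ => Real.exp (-y ^ 2 / 2)) (Real.exp (-x ^ 2 / 2) * (-x)) x := by
    have : HasDerivAt (fun y : ℝ => -y ^ 2 / 2) (-x) x := by
      exact (((hasDerivAt_pow 2 x).neg).div_const 2).congr_deriv (by push_cast; ring)
    exact this.exp
  have h2 := (((h1.const_mul (Real.sqrt N)).mul (hasDerivAt_pow k x)).div_const
    (Real.sqrt (Nat.factorial k : ℝ))).deriv
  have e : (b N k) = fun y => (Real.sqrt N * Real.exp (-y ^ 2 / 2)) * y ^ k
      / Real.sqrt (Nat.factorial k : ℝ) := rfl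
  rw [e]
  refine h2.trans ?_
  unfold wcoef dev
  rcases Nat.eq_zero_or_pos k with rfl | hk
  · simp
  · obtain ⟨m, rfl⟩ := Nat.exists_eq_succ_of_ne_zero hk.ne'
    simp only [Nat.succ_eq_add_one, Nat.add_sub_cancel, pow_succ]
    field_simp
    ring

lemma u_eq_smul {N x : ℝ} (hx : 0 < x) (k : ℕ) : u N k x = Real.sqrt N • uvec x k := by
  rw [u, uvec, b_eq, deriv_b hx]
  ext j; fin_cases j <;> simp

lemma v_eq_smul {N x y : ℝ} (hx : 0 < x) (hy : 0 < y) (k : ℕ) :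
    v N k x y = Real.sqrt N • vvec x y k := by
  rw [v, vvec, b_eq, b_eq, deriv_b hx, deriv_b hy]
  ext j; fin_cases j <;> simp

lemma inv_smul_walk {d : ℕ} {c : ℝ} (hc : c ≠ 0) (s : Finset ℕ) (v : ℕ → Fin d → ℝ) (a : ℕ → ℝ) :
    c⁻¹ • walk s (fun k => c • v k) a = walk s v a := by
  unfold walk
  simp_rw [fun i => smul_comm (a i) c (v i), ← Finset.smul_sum]
  rw [smul_smul, inv_mul_cancel₀ hc, one_smul]

lemma weylPoly_eq (s : Finset ℕ) (a : ℕ → ℝ) (x : ℝ) : weylPoly s a x = walk s (uvec x) a 0 := by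
  rw [walk_apply, weylPoly, Finset.mul_sum]
  refine Finset.sum_congr rfl fun k _ => ?_
  simp only [uvec, Matrix.cons_val_zero, wcoef]
  ring

/-- The test function for the number of zeros, as a product of one-dimensional factors. -/
lemma Phi_eq_prod (δ : ℝ) (y : Fin 2 → ℝ) :
    Phi δ y = ∏ j, (![F δ, fun z => |z|] : Fin 2 → ℝ → ℝ) j (y j) := by
  simp [Phi, Fin.prod_univ_two, mul_comm]

lemma Psi_eq_prod (δ : ℝ) (y : Fin 4 → ℝ) :
    Psi δ y = ∏ j, (![F δ, fun z => |z|, F δ, fun z => |z|] : Fin 4 → ℝ → ℝ) j (y j) := by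
  simp [Psi, Phi, Fin.prod_univ_four]; ring

lemma F_eq_prod (δ : ℝ) (y : Fin 2 → ℝ) :
    F δ (y 0) = ∏ j, (![F δ, fun _ => 1] : Fin 2 → ℝ → ℝ) j (y j) := by
  simp [Fin.prod_univ_two]

/-! ### Comparison with Gaussian coefficients -/

lemma integral_abs_pow_le {Ω : Type*} [MeasurableSpace Ω] {μ : Measure Ω} [IsProbabilityMeasure μ]
    {X : Ω → ℝ} (hX : AllMoments μ X) {M : ℕ} {j : ℕ} (hj : j ≤ M) :
    ∫ ω, |X ω| ^ j ∂μ ≤ 1 + ∫ ω, |X ω| ^ M ∂μ := by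
  have hi := (hX.abs.pow M).integrable
  have h : ∫ ω, (1 + |X ω| ^ M) ∂μ = 1 + ∫ ω, |X ω| ^ M ∂μ := by
    rw [integral_add (integrable_const _) hi]; simp
  rw [← h]
  refine integral_mono (hX.abs.pow j).integrable ((integrable_const _).add hi) fun ω => ?_
  have h0 := abs_nonneg (X ω)
  rcases le_total |X ω| 1 with h1 | h1
  · have h2 := pow_le_one₀ (n := j) h0 h1
    have h3 := pow_nonneg h0 M
    show |X ω| ^ j ≤ 1 + |X ω| ^ M
    linarith
  · have h2 := pow_le_pow_right₀ h1 hj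
    show |X ω| ^ j ≤ 1 + |X ω| ^ M
    linarith

lemma iidStandardized_of_subgaussian {Ω : Type*} [MeasurableSpace Ω] {μ : Measure Ω}
    [IsProbabilityMeasure μ] {ξ : ℕ → Ω → ℝ} {K : ℝ} {M : ℕ} (hind : iIndepFun ξ μ)
    (hid : ∀ i, IdentDistrib (ξ i) (ξ 0) μ μ) (hsub : ∃ c : NNReal, HasSubgaussianMGF (ξ 0) c μ)
    (hmean : ∫ ω, ξ 0 ω ∂μ = 0) (hvar : ∫ ω, ξ 0 ω ^ 2 ∂μ = 1)
    (hK : ∫ ω, |ξ 0 ω| ^ M ∂μ ≤ K) : IidStandardized μ (1 + K) M ξ := by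
  obtain ⟨c, hc⟩ := hsub
  have hm : AllMoments μ (ξ 0) := fun p => hc.memLp p
  exact ⟨hind, hid, hm, hmean, hvar, fun j hj => (integral_abs_pow_le hm hj).trans (by linarith)⟩

section

variable {Ω : Type*} [MeasurableSpace Ω] {ν : Measure Ω} {G : ℕ → Ω → ℝ}

lemma integral_comp_of_hasLaw {g : Ω → ℝ} (h : HasLaw g (gaussianReal 0 1) ν) {f : ℝ → ℝ}
    (hf : Measurable f) : ∫ ω, f (g ω) ∂ν = ∫ x, f x ∂(gaussianReal 0 1) := by
  rw [← h.map_eq, integral_map h.aemeasurable hf.aestronglyMeasurable]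

lemma mom_eq_of_hasLaw {g : Ω → ℝ} (h : HasLaw g (gaussianReal 0 1) ν) (j : ℕ) :
    mom ν g j = ∫ x, x ^ j ∂(gaussianReal 0 1) :=
  integral_comp_of_hasLaw h (f := fun x => x ^ j) (by fun_prop)

lemma iidStandardized_of_gaussian [IsProbabilityMeasure ν] (hind : iIndepFun G ν)
    (hlaw : ∀ i, HasLaw (G i) (gaussianReal 0 1) ν) (M : ℕ) :
    IidStandardized ν (1 + ∫ x, |x| ^ M ∂(gaussianReal 0 1)) M G := by
  have hid : ∀ i, IdentDistrib (G i) (G 0) ν ν := fun i =>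
    ⟨(hlaw i).aemeasurable, (hlaw 0).aemeasurable, by rw [(hlaw i).map_eq, (hlaw 0).map_eq]⟩
  have hm : AllMoments ν (G 0) := by
    intro p
    have h := allMoments_gaussianReal p
    rw [← (hlaw 0).map_eq] at h
    exact h.comp_of_map (hlaw 0).aemeasurable
  refine ⟨hind, hid, hm, ?_, ?_, fun j hj => ?_⟩
  · rw [integral_comp_of_hasLaw (hlaw 0) (f := fun x => x) measurable_id]
    exact integral_id_gaussianReal
  · rw [integral_comp_of_hasLaw (hlaw 0) (f := fun x => x ^ 2) (by fun_prop)]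
    exact integral_sq_gaussianReal
  · have h := integral_comp_of_hasLaw (hlaw 0) (f := fun x => |x| ^ M) (by fun_prop)
    rw [← h]
    exact integral_abs_pow_le hm hj

/-- Gaussian coefficients, with third moment `0` and fourth moment `3`, have no correction term. -/
lemma edgeWeight_of_gaussian {d : ℕ} (s : Finset ℕ) (v : ℕ → Fin d → ℝ) (y : Fin d → ℝ) :
    edgeWeight 0 3 s v y = 1 := by
  simp [edgeWeight]

end

lemma IidStandardized.mono {Ω : Type*} [MeasurableSpace Ω] {μ : Measure Ω} {K K' : ℝ} {M : ℕ}
    {ξ : ℕ → Ω → ℝ} (h : IidStandardized μ K M ξ) (hK : K ≤ K') : IidStandardized μ K' M ξ :=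
  ⟨h.indep, h.ident, h.allMoments, h.mean, h.var, fun j hj => (h.moment_le j hj).trans hK⟩

/-- The correction term of the expansion as an integral against the polynomial `Γ₂`. -/
lemma integral_edgeWeight_mul {d : ℕ} {Ω : Type*} [MeasurableSpace Ω] {μ : Measure Ω}
    {N : ℝ} (hN : 0 < N) (s : Finset ℕ) {ξ : ℕ → Ω → ℝ}
    (hid : ∀ i, IdentDistrib (ξ i) (ξ 0) μ μ) (v : ℕ → Fin d → ℝ) {h : (Fin d → ℝ) → ℝ}
    (hh : AllMoments (stdGauss d) h) :
    ∫ y, edgeWeight (mom μ (ξ 0) 3) (mom μ (ξ 0) 4) s v y * h y ∂(stdGauss d)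
      = (∫ y, h y ∂(stdGauss d)) + (1 / N) * ∫ y, h y *
        walkGamma2 μ N s ξ (fun k => Real.sqrt N • v k) y ∂(stdGauss d) := by
  have e : ∀ y, h y * walkGamma2 μ N s ξ (fun k => Real.sqrt N • v k) y
      = N * (edgeWeight (mom μ (ξ 0) 3) (mom μ (ξ 0) 4) s v y * h y - h y) := by
    intro y
    rw [← one_add_walkGamma2_eq hN s hid v y]
    field_simp
    ring
  simp_rw [e]
  rw [integral_const_mul, integral_sub
    ((allMoments_edgeWeight _ _ s v).mul hh).integrable hh.integrable]
  field_simp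
  ring

lemma IsFactor.measurable_and_linear_growth {δ : ℝ} (hδ : 0 < δ) {φ : ℝ → ℝ} (h : IsFactor δ φ) :
    Measurable φ ∧ (∀ y, 0 ≤ φ y) ∧ ∃ T, ∀ y, φ y ≤ T * (1 + |y|) := by
  rcases h with rfl | rfl | rfl
  · have := isSandwiched_F (L := 1) (T := 1 / (2 * δ)) hδ le_rfl le_rfl
    exact ⟨this.measurable, this.nonneg, _, this.le⟩
  · have := isSandwiched_abs (L := 1) (T := 1) (δ := δ) (η := δ) le_rfl le_rfl
    exact ⟨this.measurable, this.nonneg, _, this.le⟩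
  · have := isSandwiched_one (L := 1) (T := 1) (δ := δ) (η := δ) le_rfl le_rfl
    exact ⟨this.measurable, this.nonneg, _, this.le⟩

/-- Comparison of the walk with general coefficients and the walk with Gaussian coefficients. The
expansion is applied to both and subtracted. -/
theorem exists_abs_integral_walk_sub_gaussian_le {d : ℕ} (hd : d ≤ 4) {K A C : ℝ} (hA : 1 ≤ A)
    (hC : 0 < C) :
    ∃ A' η, 0 ≤ A' ∧ 0 < η ∧ ∀ᶠ N : ℝ in atTop, ∀ {Ω : Type w} {Ω' : Type w'} [MeasurableSpace Ω]
      [MeasurableSpace Ω'] (μ : Measure Ω) [IsProbabilityMeasure μ] (ν : Measure Ω')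
      [IsProbabilityMeasure ν] (ξ : ℕ → Ω → ℝ) (G : ℕ → Ω' → ℝ),
      IidStandardized μ (1 + K) (momDeg C) ξ → iIndepFun G ν →
      (∀ i, HasLaw (G i) (gaussianReal 0 1) ν) → ∀ (s : Finset ℕ) (v : ℕ → Fin d → ℝ),
      IsFrame A N s v → IsSpread (freqExp C) η N s v → ∀ δ, N ^ (-C) ≤ δ →
      ∀ φ : Fin d → ℝ → ℝ, (∀ j, IsFactor δ (φ j)) →
      |(∫ ω, ∏ j, φ j (walk s v (fun i => ξ i ω) j) ∂μ)
          - (∫ ω, ∏ j, φ j (walk s v (fun i => G i ω) j) ∂ν)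
          - (1 / N) * ∫ y, (∏ j, φ j (y j))
            * walkGamma2 μ N s ξ (fun k => Real.sqrt N • v k) y ∂(stdGauss d)|
        ≤ A' * N ^ (-(3 / 2) : ℝ) ∧
      |(∫ ω, ∏ j, φ j (walk s v (fun i => ξ i ω) j) ∂μ)
          - ∫ ω, ∏ j, φ j (walk s v (fun i => G i ω) j) ∂ν| ≤ A' * N ^ (-(1 / 2) : ℝ) := by
  obtain ⟨K', h1, h2, h3⟩ : ∃ K', 1 ≤ K' ∧ 1 + K ≤ K' ∧
      1 + ∫ x, |x| ^ momDeg C ∂(gaussianReal 0 1) ≤ K' := by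
    refine ⟨max (1 + K) (1 + ∫ x, |x| ^ momDeg C ∂(gaussianReal 0 1)), ?_, le_max_left _ _,
      le_max_right _ _⟩
    have : 0 ≤ ∫ x, |x| ^ momDeg C ∂(gaussianReal 0 1) := integral_nonneg fun x => by positivity
    exact le_trans (by linarith) (le_max_right _ _)
  obtain ⟨A₁, hA₁, k₁⟩ := exists_abs_integral_walk_sub_le.{w} hd h1 hA hC
  obtain ⟨A₂, hA₂, k₂⟩ := exists_abs_integral_walk_sub_le.{w'} hd h1 hA hC
  refine ⟨A₁ + A₂, 1 / (20 * K'), by positivity, by positivity, ?_⟩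
  filter_upwards [k₁, k₂, eventually_gt_atTop (0 : ℝ)] with N k₁ k₂ hN
  intro Ω Ω' _ _ μ _ ν _ ξ G hξ hind hlaw s v hF hS δ hδ φ hφ
  have hδ0 : 0 < δ := lt_of_lt_of_le (by positivity) hδ
  obtain ⟨a₁, b₁⟩ := k₁ μ ξ (hξ.mono h2) s v hF hS δ hδ φ hφ
  obtain ⟨a₂, b₂⟩ := k₂ ν G ((iidStandardized_of_gaussian hind hlaw _).mono h3) s v hF hS δ hδ φ hφ
  rw [mom_eq_of_hasLaw (hlaw 0), mom_eq_of_hasLaw (hlaw 0), integral_pow_three_gaussianReal,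
    integral_pow_four_gaussianReal] at a₂
  simp_rw [edgeWeight_of_gaussian, one_mul] at a₂
  have hh : AllMoments (stdGauss d) fun y => ∏ j, φ j (y j) := by
    refine AllMoments.prod _ fun j _ => ?_
    obtain ⟨m, h0, T, hT⟩ := (hφ j).measurable_and_linear_growth hδ0
    refine (((AllMoments.const 1).add (allMoments_apply_stdGauss j).abs).const_mul T).mono
      (m.comp (measurable_pi_apply j)).aestronglyMeasurable fun y => ?_
    rw [abs_of_nonneg (h0 _)]
    exact (hT _).trans (le_abs_self _)
  rw [integral_edgeWeight_mul hN s hξ.ident v hh] at a₁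
  have := abs_le.1 a₁
  have := abs_le.1 a₂
  have := abs_le.1 b₁
  have := abs_le.1 b₂
  constructor <;> rw [abs_le] <;> constructor <;> linarith

end WeylEW

theorem mainTheorem3
    (c₁ c₂ εg C : ℝ) (hc₁ : 0 < c₁) (hc₂ : c₁ < c₂) (hε : 0 < εg) (hε' : εg < 1 / 2)
    (hC : 0 < C) :
    ∃ M₀ : ℕ, ∀ K : ℝ, ∃ A N₀ : ℝ, 0 < A ∧ 0 < N₀ ∧
      ∀ {Ω Ω' : Type*} [MeasurableSpace Ω] [MeasurableSpace Ω']
        (μ : Measure Ω) [IsProbabilityMeasure μ] (ν : Measure Ω') [IsProbabilityMeasure ν]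
        (ξ : ℕ → Ω → ℝ) (G : ℕ → Ω' → ℝ),
        -- i.i.d. subgaussian coefficients of mean zero and variance one
        iIndepFun ξ μ → (∀ i, IdentDistrib (ξ i) (ξ 0) μ μ) →
        (∃ c : NNReal, HasSubgaussianMGF (ξ 0) c μ) →
        (∫ ω, ξ 0 ω ∂μ) = 0 → (∫ ω, ξ 0 ω ^ 2 ∂μ) = 1 →
        (∫ ω, |ξ 0 ω| ^ M₀ ∂μ) ≤ K →
        -- i.i.d. standard Gaussian coefficients
        iIndepFun G ν → (∀ i, HasLaw (G i) (gaussianReal 0 1) ν) →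
        ∀ (ι n : ℕ) (N δ : ℝ), ι ≤ 1 → N₀ ≤ N → c₂ * N ≤ Real.sqrt n - N → N ^ (-C) ≤ δ →
        ∀ x ∈ Set.Icc (c₁ * N) (c₂ * N),
          |(∫ ω, WeylEW.F δ (WeylEW.weylPoly (Finset.Icc ι n) (fun i => ξ i ω) x) ∂μ)
              - ∫ ω, WeylEW.F δ (WeylEW.weylPoly (Finset.Icc ι n) (fun i => G i ω) x) ∂ν|
            ≤ A * N ^ (-(1 / 2) : ℝ) ∧
          |(∫ ω, WeylEW.Phi δ ((Real.sqrt N)⁻¹ •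
                WeylEW.walk (Finset.Icc ι n) (fun k => WeylEW.u N k x) (fun i => ξ i ω)) ∂μ)
              - (∫ ω, WeylEW.Phi δ ((Real.sqrt N)⁻¹ •
                WeylEW.walk (Finset.Icc ι n) (fun k => WeylEW.u N k x) (fun i => G i ω)) ∂ν)
              - (1 / N) * ∫ t, WeylEW.Phi δ t *
                WeylEW.walkGamma2 μ N (Finset.Icc ι n) ξ (fun k => WeylEW.u N k x) t
                  ∂(WeylEW.stdGauss 2)|
            ≤ A * (N ^ (-(3 / 2) : ℝ) + (1 / N) * WeylEW.specNorm
                (WeylEW.walkCov μ N (Finset.Icc ι n) ξ (fun k => WeylEW.u N k x) - 1)) ∧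
          ∀ y ∈ Set.Icc (c₁ * N) (c₂ * N), N ^ εg ≤ |x - y| →
            |(∫ ω, WeylEW.Psi δ ((Real.sqrt N)⁻¹ •
                  WeylEW.walk (Finset.Icc ι n) (fun k => WeylEW.v N k x y) (fun i => ξ i ω)) ∂μ)
                - (∫ ω, WeylEW.Psi δ ((Real.sqrt N)⁻¹ •
                  WeylEW.walk (Finset.Icc ι n) (fun k => WeylEW.v N k x y) (fun i => G i ω)) ∂ν)
                - (1 / N) * ∫ t, WeylEW.Psi δ t *
                  WeylEW.walkGamma2 μ N (Finset.Icc ι n) ξ (fun k => WeylEW.v N k x y) t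
                    ∂(WeylEW.stdGauss 4)|
              ≤ A * (N ^ (-(3 / 2) : ℝ) + (1 / N) * WeylEW.specNorm
                  (WeylEW.walkCov μ N (Finset.Icc ι n) ξ (fun k => WeylEW.v N k x y) - 1)) := by
  classical
  obtain ⟨A₁, hA₁, frame₁⟩ := WeylEW.isFrame_uvec (c₁ := c₁) (c₂ := c₂) hc₁
  obtain ⟨A₂, hA₂, frame₂⟩ := WeylEW.isFrame_vvec hc₁ hc₂ hε
  refine ⟨WeylEW.momDeg C, fun K => ?_⟩
  obtain ⟨B₁, η₁, hB₁, hη₁, walk₁⟩ :=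
    WeylEW.exists_abs_integral_walk_sub_gaussian_le (d := 2) (K := K) (by norm_num) hA₁ hC
  obtain ⟨B₂, η₂, hB₂, hη₂, walk₂⟩ :=
    WeylEW.exists_abs_integral_walk_sub_gaussian_le (d := 4) (K := K) (by norm_num) hA₂ hC
  have spread₁ := WeylEW.isSpread_uvec (c₂ := c₂) (WeylEW.freqExp C) hc₁ hη₁
  have spread₂ := WeylEW.isSpread_vvec (WeylEW.freqExp C) hc₁ hc₂ hε hε' hη₂
  obtain ⟨N₀, hN₀⟩ := Filter.eventually_atTop.1
    (frame₁.and (frame₂.and (walk₁.and (walk₂.and (spread₁.and spread₂)))))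
  refine ⟨B₁ + B₂ + 1, max N₀ 1, by positivity, by positivity, ?_⟩
  intro Ω Ω' _ _ μ _ ν _ ξ G hind hid hsub hmean hvar hmom hindG hlaw ι n N δ hι hN hn hδ x hx
  obtain ⟨frame₁, frame₂, walk₁, walk₂, spread₁, spread₂⟩ := hN₀ N ((le_max_left _ _).trans hN)
  have hN0 : 0 < N := lt_of_lt_of_le one_pos ((le_max_right _ _).trans hN)
  have hx0 : 0 < x := lt_of_lt_of_le (by positivity) hx.1
  have hs : Real.sqrt N ≠ 0 := (Real.sqrt_pos.2 hN0).ne'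
  have hξ := WeylEW.iidStandardized_of_subgaussian hind hid hsub hmean hvar hmom
  -- the covariance is so close to the identity that the bound holds without the spectral norm term
  have hspec : ∀ {d : ℕ} (V : Matrix (Fin d) (Fin d) ℝ), N ^ (-(3 / 2) : ℝ)
      ≤ N ^ (-(3 / 2) : ℝ) + (1 / N) * WeylEW.specNorm V := fun V =>
    le_add_of_nonneg_right (mul_nonneg (by positivity) (norm_nonneg _))
  have hF : WeylEW.IsFactor δ (WeylEW.F δ) := Or.inl rfl
  have habs : WeylEW.IsFactor δ (fun y : ℝ => |y|) := Or.inr (Or.inl rfl)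
  have hone : WeylEW.IsFactor δ (fun _ : ℝ => 1) := Or.inr (Or.inr rfl)
  have hu : (fun k => WeylEW.u N k x) = fun k => Real.sqrt N • WeylEW.uvec x k :=
    funext fun k => WeylEW.u_eq_smul hx0 k
  -- the first claim also concerns the walk in the plane: its second coordinate is tested against `1`
  have main₁ := walk₁ μ ν ξ G hξ hindG hlaw _ _ (frame₁ ι n x hι hn hx) (spread₁ ι n x hι hn hx)
    δ hδ
  refine ⟨?_, ?_, fun y hy hxy => ?_⟩
  · have h := (main₁ ![WeylEW.F δ, fun _ => 1] (by intro j; fin_cases j <;> assumption)).2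
    simp_rw [← WeylEW.F_eq_prod] at h
    simp_rw [WeylEW.weylPoly_eq]
    refine h.trans ?_
    gcongr
    linarith
  · have h := (main₁ ![WeylEW.F δ, fun z => |z|] (by intro j; fin_cases j <;> assumption)).1
    simp_rw [← WeylEW.Phi_eq_prod] at h
    simp_rw [hu, WeylEW.inv_smul_walk hs]
    refine h.trans ?_
    gcongr
    · linarith
    · exact hspec _
  · have hy0 : 0 < y := lt_of_lt_of_le (by positivity) hy.1
    have hv : (fun k => WeylEW.v N k x y) = fun k => Real.sqrt N • WeylEW.vvec x y k :=
      funext fun k => WeylEW.v_eq_smul hx0 hy0 k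
    have h := (walk₂ μ ν ξ G hξ hindG hlaw _ _ (frame₂ ι n x y hι hn hx hy hxy)
      (spread₂ ι n x y hι hn hx hy hxy) δ hδ
      ![WeylEW.F δ, fun z => |z|, WeylEW.F δ, fun z => |z|]
      (by intro j; fin_cases j <;> assumption)).1
    simp_rw [← WeylEW.Psi_eq_prod] at h
    simp_rw [hv, WeylEW.inv_smul_walk hs]
    refine h.trans ?_
    gcongr
    · linarith
    · exact hspec _
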